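/- Consider the fine Kolmogorov backward equation \[u_t+xu_y=x^2u_{xx}\qquad(1)\] for a function $u$ of $(t,x,y)\in\mathbb R^3$. By a solution we mean a $C^\infty$ solution on some open subset of $\mathbb R^3$. A point transformation is a $C^\infty$ diffeomorphism $\Phi$ between open subsets of $\mathbb R^4_{t,x,y,u}$. It is a point symmetry of (1) if it preserves the solution set: whenever $\Phi$ maps the graph of a smooth function $v$ with open domain onto the graph of a smooth function $w$ with open domain, $v$ is a solution of (1) if and only if $w$ is. The point symmetries of (1) constitute a pseudogroup $G$ of transformations of $\mathbb R^4$: $G$ contains the identity and is closed under composition, inversion, restriction to open sets and gluing. It consists exactly of the point transformations that, near each point of their domain, are of the form \[ \tilde t=t+\lambda,\quad \tilde x=\frac{\alpha\delta-\beta\gamma}{(\gamma y+\delta)^2}\,x,\quad \tilde y=\frac{\alpha y+\beta}{\gamma y+\delta},\quad \tilde u=\sigma\exp\Bigl(\frac{\gamma}{\gamma y+\delta}\,x\Bigr)\bigl(u+f(t,x,y)\bigr),\qquad(2) \] where $\alpha,\beta,\gamma,\delta,\lambda,\sigma$ are real constants with $\alpha\delta-\beta\gamma=\pm1$ and $\sigma\ne0$,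 and $f$ is a solution of (1). If the domain of the transformation is connected, then the same constants can be taken at all its points; if, in addition, every line parallel to the $u$-axis meets the domain in a connected set, then the transformation is of the form (2), with one function $f$, on its entire domain. All these constants and all solutions $f$ occur: for any such constants and any solution $f$, the formulas (2) define a point symmetry with the domain $\{(t,x,y,u)\mid(t,x,y)\in\operatorname{dom}f,\ \gamma y+\delta\ne0\}$. The constants $\lambda$, $\sigma$, the function $f$, and the tuple $(\alpha,\beta,\gamma,\delta)$ up to simultaneously alternating the signs of its entries, are uniquely determined by the transformation (already by its restriction to any nonempty open set on which (2) holds, as far as the constants and the values of $f$ over this set are concerned), and alternating these signs does not change the transformation. -/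

import Mathlib

open scoped ContDiff

namespace FineKolmogorov

/-- The space of the independent variables `(t, x, y)`. -/
abbrev Base : Type := ℝ × ℝ × ℝ

/-- The space of the independent and dependent variables, `((t, x, y), u)`. -/
abbrev Total : Type := Base × ℝ

/-- The equation `u_t + x u_y = x² u_xx` for `u = v(t, x, y)` at the point `(t, x, y)`. -/
def EquationAt (v : Base → ℝ) (t x y : ℝ) : Prop :=
  deriv (fun s => v (s, x, y)) t + x * deriv (fun s => v (t, x, s)) y =
    x ^ 2 * iteratedDeriv 2 (fun s => v (t, s, y)) x

/-- `v` is a (smooth, local) solution of the equation, with the open domain `D`. The values of `v`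
outside of `D` are irrelevant. -/
structure IsSolutionOn (v : Base → ℝ) (D : Set Base) : Prop where
  isOpen : IsOpen D
  smooth : ContDiffOn ℝ ∞ v D
  equation : ∀ t x y : ℝ, (t, x, y) ∈ D → EquationAt v t x y

/-- A (local) point transformation: a diffeomorphism between open subsets of the space of the
independent and dependent variables. -/
def IsPointTransformation (Φ : OpenPartialHomeomorph Total Total) : Prop :=
  ContDiffOn ℝ ∞ Φ Φ.source ∧ ContDiffOn ℝ ∞ Φ.symm Φ.target

/-- A point symmetry of the equation: a point transformation that preserves the solution set.
Functions are transformed through their graphs: whenever `Φ` maps the graph of a smooth function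
`v` with open domain `D` onto the graph of a smooth function `w` with open domain `D'`,
the function `v` is a solution if and only if `w` is. -/
def IsPointSymmetry (Φ : OpenPartialHomeomorph Total Total) : Prop :=
  IsPointTransformation Φ ∧
    ∀ (v w : Base → ℝ) (D D' : Set Base), IsOpen D → IsOpen D' →
      ContDiffOn ℝ ∞ v D → ContDiffOn ℝ ∞ w D' →
      Set.graphOn v D ⊆ Φ.source → Φ '' Set.graphOn v D = Set.graphOn w D' →
      (IsSolutionOn v D ↔ IsSolutionOn w D')

/-- The constant parameters of the transformations. -/
structure Params where
  (α β γ δ lam σ : ℝ)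
  det_eq : α * δ - β * γ = 1 ∨ α * δ - β * γ = -1
  σ_ne_zero : σ ≠ 0

/-- The transformation formulas with constant parameters `A` and parameter function `f`
(meaningful where `γ y + δ ≠ 0`). -/
noncomputable def Params.map (A : Params) (f : Base → ℝ) : Total → Total :=
  fun ((t, x, y), u) =>
    ((t + A.lam,
      (A.α * A.δ - A.β * A.γ) / (A.γ * y + A.δ) ^ 2 * x,
      (A.α * y + A.β) / (A.γ * y + A.δ)),
      A.σ * Real.exp (A.γ / (A.γ * y + A.δ) * x) * (u + f (t, x, y)))

/-- The set where `γ y + δ ≠ 0`. -/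
def Params.regular (A : Params) : Set Total :=
  {p | A.γ * p.1.2.2 + A.δ ≠ 0}

/-- On the set `Ω`, the map `Φ` is given by the formulas with constant parameters `A` and a
parameter function `f` that is a solution of the equation on the projection of `Ω`. -/
def HasFormOn (Φ : Total → Total) (A : Params) (f : Base → ℝ) (Ω : Set Total) : Prop :=
  IsSolutionOn f (Prod.fst '' Ω) ∧ Ω ⊆ A.regular ∧ Set.EqOn Φ (A.map f) Ω

/-- `A` and `B` agree up to simultaneously alternating the signs of `α`, `β`, `γ`, `δ`. -/
def Params.SameUpToSign (A B : Params) : Prop :=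
  A.lam = B.lam ∧ A.σ = B.σ ∧
    ((A.α = B.α ∧ A.β = B.β ∧ A.γ = B.γ ∧ A.δ = B.δ) ∨
      (A.α = -B.α ∧ A.β = -B.β ∧ A.γ = -B.γ ∧ A.δ = -B.δ))

end FineKolmogorov

/-! Sufficiency is a computation. The change of (t, x, y) produces an extra first-order term in x,
and the factor σ exp(kx) with k = γ/(γy+δ), k' = -k², compensates it (`Params.equationAt_iff`);
linearity of the equation allows adding f.

For necessity, Φ = (T, X, Y, U) is tested on explicit solutions. Where the image of the tangent
space of a graph is transversal to the vertical direction, the inverse function theorem makes the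
image the graph of a solution w (`IsPointSymmetry.exists_image`), and the equation for w becomes a
condition on the 2-jet of v (`IsPointSymmetry.exists_jet`). At points with x ≠ 0 the value, the
gradient, u_tt and u_yy of a solution are arbitrary (`exists_solution_with_jet`). Varying u_tt and
u_yy shows that T and Y do not depend on x and u (`IsPointSymmetry.fderiv_xu_eq_zero`). Varying u_t
and u_y gives X_u = 0 and two relations between X, X_x and the derivatives of T and Y
(`IsPointSymmetry.determining_base`). Along an x-line the derivatives of T and Y are constant, so
these relations become a polynomial identity in x, which forces T_t = 1, T_y = Y_t = 0 and X = x
Y_y. Points with x = 0 or X = 0 are reached by continuity.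

On a ball this gives T = t + λ, Y = η(y), X = x η'(y). Solutions affine in x now suffice: U = W u +
V (`IsPointSymmetry.exists_affine`), and W = σ exp(hx) with h = -η''/(2η') and h' = -h²
(`IsPointSymmetry.exists_factor`). Hence g = |η'|^(-1/2) and ηg are affine in y, so η is fractional
linear with determinant ±1 (`exists_fractional_linear`). The function f = V/W is a solution because
constants are mapped to solutions.

The pseudogroup axioms follow from the local form. Since the constants are determined up to sign on
any nonempty open set (`sameUpToSign_of_eqOn`), they cannot change over a connected domain;
connected vertical fibres make f single-valued. -/

namespace FineKolmogorov

open Filter Topology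

/-! ### Second-order chain rule and derivatives along lines. -/

section Calculus

variable {E F G : Type*} [NormedAddCommGroup E] [NormedSpace ℝ E]
  [NormedAddCommGroup F] [NormedSpace ℝ F] [NormedAddCommGroup G] [NormedSpace ℝ G]

/-- The second-order chain rule on the diagonal. -/
theorem fderiv_fderiv_comp_apply {f : F → G} {g : E → F} {p : E}
    (hf : ContDiffAt ℝ 2 f (g p)) (hg : ContDiffAt ℝ 2 g p) (n : E) :
    fderiv ℝ (fderiv ℝ (f ∘ g)) p n n =
      fderiv ℝ (fderiv ℝ f) (g p) (fderiv ℝ g p n) (fderiv ℝ g p n) +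
        fderiv ℝ f (g p) (fderiv ℝ (fderiv ℝ g) p n n) := by
  have hf' : ∀ᶠ q in 𝓝 (g p), DifferentiableAt ℝ f q :=
    (hf.eventually (by simp)).mono fun q hq => hq.differentiableAt (by simp)
  have hg' : ∀ᶠ q in 𝓝 p, DifferentiableAt ℝ g q :=
    (hg.eventually (by simp)).mono fun q hq => hq.differentiableAt (by simp)
  have hev : fderiv ℝ (f ∘ g) =ᶠ[𝓝 p] fun q => (fderiv ℝ f (g q)).comp (fderiv ℝ g q) := by
    filter_upwards [hg.continuousAt.eventually hf', hg'] with q h1 h2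
    exact fderiv_comp q h1 h2
  have df : DifferentiableAt ℝ (fderiv ℝ f) (g p) :=
    (hf.fderiv_right (m := 1) (by norm_num)).differentiableAt (by simp)
  have dg : DifferentiableAt ℝ (fderiv ℝ g) p :=
    (hg.fderiv_right (m := 1) (by norm_num)).differentiableAt (by simp)
  have h1 : HasFDerivAt (fun q => fderiv ℝ f (g q))
      ((fderiv ℝ (fderiv ℝ f) (g p)).comp (fderiv ℝ g p)) p :=
    df.hasFDerivAt.comp p hg'.self_of_nhds.hasFDerivAt
  have h2 := h1.clm_comp dg.hasFDerivAt
  rw [hev.fderiv_eq, h2.fderiv]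
  simp [add_comm]

/-- Derivative along a line. -/
theorem hasDerivAt_line {f : E → G} {p : E} (hf : DifferentiableAt ℝ f p) (n : E) (s : ℝ) :
    HasDerivAt (fun r : ℝ => f (p + (r - s) • n)) (fderiv ℝ f p n) s := by
  have h1 : HasDerivAt (fun r : ℝ => p + (r - s) • n) n s := by
    simpa using (((hasDerivAt_id s).sub_const s).smul_const n).const_add p
  have h2 : HasFDerivAt f (fderiv ℝ f p) (p + (s - s) • n) := by simpa using hf.hasFDerivAt
  exact h2.comp_hasDerivAt s h1

/-- Second derivative along a line. -/
theorem hasDerivAt_deriv_line {f : E → G} {p : E} (hf : ContDiffAt ℝ 2 f p) (n : E) (s : ℝ) :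
    HasDerivAt (deriv fun r : ℝ => f (p + (r - s) • n)) (fderiv ℝ (fderiv ℝ f) p n n) s := by
  have hc : Tendsto (fun r : ℝ => p + (r - s) • n) (𝓝 s) (𝓝 p) := by
    have : ContinuousAt (fun r : ℝ => p + (r - s) • n) s := by fun_prop
    simpa [ContinuousAt] using this
  have hev : deriv (fun r : ℝ => f (p + (r - s) • n)) =ᶠ[𝓝 s]
      fun r => fderiv ℝ f (p + (r - s) • n) n := by
    filter_upwards [hc.eventually (hf.eventually (by simp))] with r hr
    have := hasDerivAt_line (hr.differentiableAt (by simp)) n r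
    have h2 : (fun r' : ℝ => f (p + (r' - s) • n)) =
        fun r' : ℝ => f (p + (r - s) • n + (r' - r) • n) := by
      ext r'; congr 1; module
    rw [h2]; exact this.deriv
  have df : DifferentiableAt ℝ (fderiv ℝ f) p :=
    (hf.fderiv_right (m := 1) (by norm_num)).differentiableAt (by simp)
  have := (hasDerivAt_line df n s).clm_apply (hasDerivAt_const s n)
  simpa using this.congr_of_eventuallyEq hev

theorem iteratedDeriv_two_line {f : E → G} {p : E} (hf : ContDiffAt ℝ 2 f p) (n : E) (s : ℝ) :
    iteratedDeriv 2 (fun r : ℝ => f (p + (r - s) • n)) s = fderiv ℝ (fderiv ℝ f) p n n := by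
  rw [iteratedDeriv_succ, iteratedDeriv_one]
  exact (hasDerivAt_deriv_line hf n s).deriv

end Calculus

theorem differentiableAt_of_smooth {E F : Type*} [NormedAddCommGroup E] [NormedSpace ℝ E]
    [NormedAddCommGroup F] [NormedSpace ℝ F] {v : E → F} {z : E}
    (hv : ContDiffAt ℝ ∞ v z) : DifferentiableAt ℝ v z :=
  hv.differentiableAt (by simp)

theorem contDiffAt_two_of_smooth {E F : Type*} [NormedAddCommGroup E] [NormedSpace ℝ E]
    [NormedAddCommGroup F] [NormedSpace ℝ F] {v : E → F} {z : E}
    (hv : ContDiffAt ℝ ∞ v z) : ContDiffAt ℝ 2 v z :=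
  hv.of_le (WithTop.coe_le_coe.2 le_top)

theorem eventually_smooth {E F : Type*} [NormedAddCommGroup E] [NormedSpace ℝ E]
    [NormedAddCommGroup F] [NormedSpace ℝ F] {v : E → F} {z : E}
    (hv : ContDiffAt ℝ ∞ v z) : ∀ᶠ q in 𝓝 z, DifferentiableAt ℝ v q :=
  ((contDiffAt_two_of_smooth hv).eventually (by simp)).mono
    fun _ hq => hq.differentiableAt (by simp)

theorem base_apply {G : Type*} [NormedAddCommGroup G] [NormedSpace ℝ G] (L : Base →L[ℝ] G)
    (a b c : ℝ) : L (a, b, c) = a • L (1, 0, 0) + b • L (0, 1, 0) + c • L (0, 0, 1) := by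
  simp only [← map_smul, ← map_add]
  simp

theorem total_apply {G : Type*} [NormedAddCommGroup G] [NormedSpace ℝ G] (L : Total →L[ℝ] G)
    (a b c d : ℝ) : L ((a, b, c), d) =
      a • L ((1, 0, 0), 0) + b • L ((0, 1, 0), 0) + c • L ((0, 0, 1), 0) + d • L (0, 1) := by
  simp only [← map_smul, ← map_add]
  simp

/-! ### The equation in terms of Fréchet derivatives. -/

section Slices

variable {v : Base → ℝ} {t x y : ℝ}

theorem hasDerivAt_slice_t (hv : DifferentiableAt ℝ v (t, x, y)) :
    HasDerivAt (fun s => v (s, x, y)) (fderiv ℝ v (t, x, y) (1, 0, 0)) t := by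
  simpa using hasDerivAt_line hv (1, 0, 0) t

theorem hasDerivAt_slice_x (hv : DifferentiableAt ℝ v (t, x, y)) :
    HasDerivAt (fun s => v (t, s, y)) (fderiv ℝ v (t, x, y) (0, 1, 0)) x := by
  simpa using hasDerivAt_line hv (0, 1, 0) x

theorem hasDerivAt_slice_y (hv : DifferentiableAt ℝ v (t, x, y)) :
    HasDerivAt (fun s => v (t, x, s)) (fderiv ℝ v (t, x, y) (0, 0, 1)) y := by
  simpa using hasDerivAt_line hv (0, 0, 1) y

theorem hasDerivAt_deriv_slice_x (hv : ContDiffAt ℝ 2 v (t, x, y)) :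
    HasDerivAt (deriv fun s => v (t, s, y))
      (fderiv ℝ (fderiv ℝ v) (t, x, y) (0, 1, 0) (0, 1, 0)) x := by
  simpa using hasDerivAt_deriv_line hv (0, 1, 0) x

theorem iteratedDeriv_two_slice_x (hv : ContDiffAt ℝ 2 v (t, x, y)) :
    iteratedDeriv 2 (fun s => v (t, s, y)) x =
      fderiv ℝ (fderiv ℝ v) (t, x, y) (0, 1, 0) (0, 1, 0) := by
  simpa using iteratedDeriv_two_line hv (0, 1, 0) x

theorem equationAt_iff_fderiv (hv : ContDiffAt ℝ ∞ v (t, x, y)) :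
    EquationAt v t x y ↔
      fderiv ℝ v (t, x, y) (1, 0, 0) + x * fderiv ℝ v (t, x, y) (0, 0, 1) =
        x ^ 2 * fderiv ℝ (fderiv ℝ v) (t, x, y) (0, 1, 0) (0, 1, 0) := by
  have hd := differentiableAt_of_smooth hv
  rw [EquationAt, (hasDerivAt_slice_t hd).deriv, (hasDerivAt_slice_y hd).deriv,
    iteratedDeriv_two_slice_x (contDiffAt_two_of_smooth hv)]

theorem EquationAt.congr {v' : Base → ℝ} (h : v =ᶠ[𝓝 (t, x, y)] v') :
    EquationAt v t x y ↔ EquationAt v' t x y := by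
  have c1 : Tendsto (fun s : ℝ => (s, x, y)) (𝓝 t) (𝓝 (t, x, y)) :=
    (by fun_prop : Continuous fun s : ℝ => (s, x, y)).tendsto t
  have c2 : Tendsto (fun s : ℝ => (t, s, y)) (𝓝 x) (𝓝 (t, x, y)) :=
    (by fun_prop : Continuous fun s : ℝ => (t, s, y)).tendsto x
  have c3 : Tendsto (fun s : ℝ => (t, x, s)) (𝓝 y) (𝓝 (t, x, y)) :=
    (by fun_prop : Continuous fun s : ℝ => (t, x, s)).tendsto y
  have h1 : (fun s => v (s, x, y)) =ᶠ[𝓝 t] fun s => v' (s, x, y) := c1.eventually h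
  have h2 : (fun s => v (t, s, y)) =ᶠ[𝓝 x] fun s => v' (t, s, y) := c2.eventually h
  have h3 : (fun s => v (t, x, s)) =ᶠ[𝓝 y] fun s => v' (t, x, s) := c3.eventually h
  rw [EquationAt, EquationAt, h1.deriv_eq, h3.deriv_eq, h2.iteratedDeriv_eq 2]

end Slices

/-! ### Invariance of the equation under the homogeneous transformations. -/

/-- The equation for `w`, written in terms of the pullback `q` of `w` by the map
`(t, x, y) ↦ (t + λ, x ρ(y), η(y))` with `ρ = η'`. -/
theorem equationAt_iff_pullback {w q : Base → ℝ} {η ρ : ℝ → ℝ} {ρ' lam t x y : ℝ}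
    (hη : HasDerivAt η (ρ y) y) (hρ : HasDerivAt ρ ρ' y) (hne : ρ y ≠ 0)
    (hw : ContDiffAt ℝ ∞ w (t + lam, x * ρ y, η y))
    (hq : ∀ᶠ z : Base in 𝓝 (t, x, y), w (z.1 + lam, z.2.1 * ρ z.2.2, η z.2.2) = q z) :
    EquationAt w (t + lam) (x * ρ y) (η y) ↔
      deriv (fun s => q (s, x, y)) t + x * deriv (fun s => q (t, x, s)) y
          - ρ' / ρ y * x ^ 2 * deriv (fun s => q (t, s, y)) x =
        x ^ 2 * iteratedDeriv 2 (fun s => q (t, s, y)) x := by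
  have c1 : Tendsto (fun s : ℝ => (s, x, y)) (𝓝 t) (𝓝 (t, x, y)) :=
    (by fun_prop : Continuous fun s : ℝ => (s, x, y)).tendsto t
  have c2 : Tendsto (fun s : ℝ => (t, s, y)) (𝓝 x) (𝓝 (t, x, y)) :=
    (by fun_prop : Continuous fun s : ℝ => (t, s, y)).tendsto x
  have c3 : Tendsto (fun s : ℝ => (t, x, s)) (𝓝 y) (𝓝 (t, x, y)) :=
    (by fun_prop : Continuous fun s : ℝ => (t, x, s)).tendsto y
  have h1 : (fun s => w (s + lam, x * ρ y, η y)) =ᶠ[𝓝 t] fun s => q (s, x, y) := c1.eventually hq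
  have h2 : (fun s => w (t + lam, s * ρ y, η y)) =ᶠ[𝓝 x] fun s => q (t, s, y) := c2.eventually hq
  have h3 : (fun s => w (t + lam, x * ρ s, η s)) =ᶠ[𝓝 y] fun s => q (t, x, s) := c3.eventually hq
  have hd := differentiableAt_of_smooth hw
  rw [equationAt_iff_fderiv hw, ← h1.deriv_eq, ← h2.deriv_eq, ← h3.deriv_eq,
    ← h2.iteratedDeriv_eq 2]
  set L := fderiv ℝ w (t + lam, x * ρ y, η y) with hL
  have e1 : deriv (fun s => w (s + lam, x * ρ y, η y)) t = L (1, 0, 0) := by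
    have hc : HasDerivAt (fun s : ℝ => ((s + lam, x * ρ y, η y) : Base)) (1, 0, 0) t :=
      ((hasDerivAt_id t).add_const lam).prodMk (hasDerivAt_const t (x * ρ y, η y))
    exact (hd.hasFDerivAt.comp_hasDerivAt t hc).deriv
  have e2 : deriv (fun s => w (t + lam, s * ρ y, η y)) x = ρ y * L (0, 1, 0) := by
    have hc : HasDerivAt (fun s : ℝ => ((t + lam, s * ρ y, η y) : Base)) (0, 1 * ρ y, 0) x :=
      (hasDerivAt_const x (t + lam)).prodMk
        (((hasDerivAt_id x).mul_const (ρ y)).prodMk (hasDerivAt_const x (η y)))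
    refine (hd.hasFDerivAt.comp_hasDerivAt x hc).deriv.trans ?_
    rw [base_apply]; simp [hL]
  have e3 : deriv (fun s => w (t + lam, x * ρ s, η s)) y =
      x * ρ' * L (0, 1, 0) + ρ y * L (0, 0, 1) := by
    have hc : HasDerivAt (fun s : ℝ => ((t + lam, x * ρ s, η s) : Base)) (0, x * ρ', ρ y) y :=
      (hasDerivAt_const y (t + lam)).prodMk ((hρ.const_mul x).prodMk hη)
    refine (hd.hasFDerivAt.comp_hasDerivAt y hc).deriv.trans ?_
    rw [base_apply]; simp [hL]
  have e4 : iteratedDeriv 2 (fun s => w (t + lam, s * ρ y, η y)) x =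
      ρ y ^ 2 * fderiv ℝ (fderiv ℝ w) (t + lam, x * ρ y, η y) (0, 1, 0) (0, 1, 0) := by
    have := iteratedDeriv_two_line (contDiffAt_two_of_smooth hw) (0, ρ y, 0) x
    have e : ((0, ρ y, 0) : Base) = ρ y • ((0, 1, 0) : Base) := by simp
    have e' : (fun r : ℝ => w ((t + lam, x * ρ y, η y) + (r - x) • ((0, ρ y, 0) : Base))) =
        fun s => w (t + lam, s * ρ y, η y) := by
      ext r; congr 1; simp; ring
    rw [e', e] at this
    rw [this, map_smul]
    simp only [map_smul, smul_apply, smul_eq_mul]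
    ring
  rw [e1, e2, e3, e4]
  -- Since the second coordinate x ρ(y) depends on y, the y-derivative of q contains x ρ' w_x; the
  -- term with ρ'/ρ removes exactly this contribution.
  have key : L (1, 0, 0) + x * (x * ρ' * L (0, 1, 0) + ρ y * L (0, 0, 1)) -
      ρ' / ρ y * x ^ 2 * (ρ y * L (0, 1, 0)) = L (1, 0, 0) + x * ρ y * L (0, 0, 1) := by
    field_simp; ring
  rw [key]
  have : ∀ a b : ℝ, a = b → (L (1, 0, 0) + x * ρ y * L (0, 0, 1) = a ↔
      L (1, 0, 0) + x * ρ y * L (0, 0, 1) = b) := fun a b h => by rw [h]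
  apply this; ring

/-- The factor at `u` in the transformation formulas. -/
noncomputable def Params.factor (A : Params) (z : Base) : ℝ :=
  A.σ * Real.exp (A.γ / (A.γ * z.2.2 + A.δ) * z.2.1)

/-- The transformation of the independent variables. -/
noncomputable def Params.baseMap (A : Params) (z : Base) : Base :=
  (z.1 + A.lam, (A.α * A.δ - A.β * A.γ) / (A.γ * z.2.2 + A.δ) ^ 2 * z.2.1,
    (A.α * z.2.2 + A.β) / (A.γ * z.2.2 + A.δ))

theorem Params.map_apply (A : Params) (f : Base → ℝ) (z : Base) (u : ℝ) :
    A.map f (z, u) = (A.baseMap z, A.factor z * (u + f z)) := rfl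

theorem Params.factor_ne_zero (A : Params) (z : Base) : A.factor z ≠ 0 :=
  mul_ne_zero A.σ_ne_zero (Real.exp_ne_zero _)

theorem Params.det_ne_zero (A : Params) : A.α * A.δ - A.β * A.γ ≠ 0 := by
  rcases A.det_eq with h | h <;> simp [h]

theorem Params.contDiffAt_factor (A : Params) {z : Base} (hz : A.γ * z.2.2 + A.δ ≠ 0) :
    ContDiffAt ℝ ∞ A.factor z := by
  unfold Params.factor
  fun_prop (disch := assumption)

theorem Params.contDiffAt_baseMap (A : Params) {z : Base} (hz : A.γ * z.2.2 + A.δ ≠ 0) :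
    ContDiffAt ℝ ∞ A.baseMap z := by
  unfold Params.baseMap
  have : (A.γ * z.2.2 + A.δ) ^ 2 ≠ 0 := pow_ne_zero 2 hz
  fun_prop (disch := assumption)

/-- Solutions correspond to solutions under the homogeneous part of the transformation. -/
theorem Params.equationAt_iff (A : Params) {v w : Base → ℝ} {t x y : ℝ}
    (hy : A.γ * y + A.δ ≠ 0) (hv : ContDiffAt ℝ ∞ v (t, x, y))
    (hw : ContDiffAt ℝ ∞ w (A.baseMap (t, x, y)))
    (h : ∀ᶠ z in 𝓝 (t, x, y), w (A.baseMap z) = A.factor z * v z) :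
    EquationAt w (A.baseMap (t, x, y)).1 (A.baseMap (t, x, y)).2.1 (A.baseMap (t, x, y)).2.2 ↔
      EquationAt v t x y := by
  set d := A.α * A.δ - A.β * A.γ with hd
  have hd0 : d ≠ 0 := A.det_ne_zero
  have hlin : HasDerivAt (fun s => A.γ * s + A.δ) A.γ y := by
    simpa using ((hasDerivAt_id y).const_mul A.γ).add_const A.δ
  have hη : HasDerivAt (fun s => (A.α * s + A.β) / (A.γ * s + A.δ)) (d / (A.γ * y + A.δ) ^ 2) y := by
    have h1 : HasDerivAt (fun s => A.α * s + A.β) A.α y := by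
      simpa using ((hasDerivAt_id y).const_mul A.α).add_const A.β
    exact (h1.div hlin hy).congr_deriv (by rw [hd]; congr 1; ring)
  have hρ : HasDerivAt (fun s => d / (A.γ * s + A.δ) ^ 2) (-2 * A.γ * d / (A.γ * y + A.δ) ^ 3) y := by
    refine ((hasDerivAt_const y d).div (hlin.pow 2) (pow_ne_zero 2 hy)).congr_deriv ?_
    simp; field_simp
  -- The Riccati equation k' = -k² for the coefficient of x in the exponent.
  have hh : HasDerivAt (fun s => A.γ / (A.γ * s + A.δ)) (-(A.γ / (A.γ * y + A.δ)) ^ 2) y := by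
    refine ((hasDerivAt_const y A.γ).div hlin hy).congr_deriv ?_
    field_simp; ring
  have hne : d / (A.γ * y + A.δ) ^ 2 ≠ 0 := div_ne_zero hd0 (pow_ne_zero 2 hy)
  have hb : ∀ z : Base, A.baseMap z = (z.1 + A.lam, z.2.1 * (d / (A.γ * z.2.2 + A.δ) ^ 2),
      (A.α * z.2.2 + A.β) / (A.γ * z.2.2 + A.δ)) := fun z => by
    simp [Params.baseMap, hd, mul_comm]
  simp only [hb] at hw h ⊢
  rw [equationAt_iff_pullback (η := fun s => (A.α * s + A.β) / (A.γ * s + A.δ))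
    (ρ := fun s => d / (A.γ * s + A.δ) ^ 2) hη hρ hne hw h, equationAt_iff_fderiv hv]
  have hvd := differentiableAt_of_smooth hv
  have vt := hasDerivAt_slice_t hvd
  have vx := hasDerivAt_slice_x hvd
  have vy := hasDerivAt_slice_y hvd
  set k := A.γ / (A.γ * y + A.δ) with hk
  set m := A.factor (t, x, y) with hm
  have hm0 : m ≠ 0 := A.factor_ne_zero _
  set L := fderiv ℝ v (t, x, y)
  have mx : ∀ s, HasDerivAt (fun s => A.factor (t, s, y)) (k * A.factor (t, s, y)) s := fun s => by
    have := ((((hasDerivAt_id s).const_mul k)).exp).const_mul A.σ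
    simp only [Params.factor, id] at this ⊢
    exact this.congr_deriv (by ring)
  have my : HasDerivAt (fun s => A.factor (t, x, s)) (-k ^ 2 * x * m) y := by
    have := ((hh.mul_const x).exp).const_mul A.σ
    simp only [Params.factor, hm] at this ⊢
    exact this.congr_deriv (by ring)
  have q1 : deriv (fun s => A.factor (s, x, y) * v (s, x, y)) t = m * L (1, 0, 0) :=
    (vt.const_mul m).deriv
  have q2 : deriv (fun s => A.factor (t, x, s) * v (t, x, s)) y =
      -k ^ 2 * x * m * v (t, x, y) + m * L (0, 0, 1) := (my.mul vy).deriv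
  have q3 : deriv (fun s => A.factor (t, s, y) * v (t, s, y)) x =
      k * m * v (t, x, y) + m * L (0, 1, 0) := ((mx x).mul vx).deriv
  have c2 : Tendsto (fun s : ℝ => (t, s, y)) (𝓝 x) (𝓝 (t, x, y)) :=
    (by fun_prop : Continuous fun s : ℝ => (t, s, y)).tendsto x
  have dv : ∀ᶠ s in 𝓝 x, deriv (fun s => A.factor (t, s, y) * v (t, s, y)) s =
      A.factor (t, s, y) * (k * v (t, s, y) + deriv (fun s => v (t, s, y)) s) := by
    filter_upwards [c2.eventually (eventually_smooth hv)] with s hs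
    have h1 := hasDerivAt_slice_x hs
    rw [h1.deriv]
    refine ((mx s).mul h1).deriv.trans ?_
    ring
  have vxd : HasDerivAt (deriv fun s => v (t, s, y))
      (fderiv ℝ (fderiv ℝ v) (t, x, y) (0, 1, 0) (0, 1, 0)) x :=
    hasDerivAt_deriv_slice_x (contDiffAt_two_of_smooth hv)
  have q4 : iteratedDeriv 2 (fun s => A.factor (t, s, y) * v (t, s, y)) x =
      m * (fderiv ℝ (fderiv ℝ v) (t, x, y) (0, 1, 0) (0, 1, 0) + 2 * k * L (0, 1, 0)
        + k ^ 2 * v (t, x, y)) := by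
    rw [iteratedDeriv_succ, iteratedDeriv_one, EventuallyEq.deriv_eq dv]
    refine ((mx x).mul ((vx.const_mul k).add vxd)).deriv.trans ?_
    simp only [Pi.add_apply, vx.deriv]
    ring
  rw [q1, q2, q3, q4]
  -- With ρ'/ρ = -2k, the left side of the pulled-back equation has the extra terms m x²(-k²v + 2k²v
  -- + 2k v_x), the right side m x²(k²v + 2k v_x). They cancel.
  have hfr : -2 * A.γ * d / (A.γ * y + A.δ) ^ 3 / (d / (A.γ * y + A.δ) ^ 2) = -2 * k := by
    rw [hk]; field_simp
  rw [hfr]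
  constructor
  · intro h
    apply mul_left_cancel₀ hm0
    linear_combination h
  · intro h
    linear_combination m * h

/-! ### Images of solutions under point symmetries. -/

theorem IsPointTransformation.contDiffAt {Φ : OpenPartialHomeomorph Total Total}
    (h : IsPointTransformation Φ) {p : Total} (hp : p ∈ Φ.source) : ContDiffAt ℝ ∞ Φ p :=
  h.1.contDiffAt (Φ.open_source.mem_nhds hp)

theorem IsSolutionOn.contDiffAt {v : Base → ℝ} {D : Set Base} (hv : IsSolutionOn v D) {z : Base}
    (hz : z ∈ D) : ContDiffAt ℝ ∞ v z :=
  hv.smooth.contDiffAt (hv.isOpen.mem_nhds hz)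

theorem IsSolutionOn.mono {v : Base → ℝ} {D D' : Set Base} (hv : IsSolutionOn v D)
    (h : D' ⊆ D) (h' : IsOpen D') : IsSolutionOn v D' :=
  ⟨h', hv.smooth.mono h, fun t x y hz => hv.equation t x y (h hz)⟩

/-- A point symmetry maps a solution, near a point where the image of its graph is transversal to
the vertical direction, to a solution. -/
theorem IsPointSymmetry.exists_image {Φ : OpenPartialHomeomorph Total Total}
    (hΦ : IsPointSymmetry Φ) {v : Base → ℝ} {D : Set Base} {z₀ : Base} (hv : IsSolutionOn v D)
    (hz : z₀ ∈ D) (hs : (z₀, v z₀) ∈ Φ.source)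
    (hinj : ∀ n : Base, (fderiv ℝ Φ (z₀, v z₀) (n, fderiv ℝ v z₀ n)).1 = 0 → n = 0) :
    ∃ w : Base → ℝ, ContDiffAt ℝ ∞ w (Φ (z₀, v z₀)).1 ∧
      EquationAt w (Φ (z₀, v z₀)).1.1 (Φ (z₀, v z₀)).1.2.1 (Φ (z₀, v z₀)).1.2.2 ∧
      ∀ᶠ z in 𝓝 z₀, w (Φ (z, v z)).1 = (Φ (z, v z)).2 := by
  set φ : Base → Base := fun z => (Φ (z, v z)).1 with hφ
  have hgc : ∀ z ∈ D, ContDiffAt ℝ ∞ (fun z => (z, v z)) z := fun z hz =>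
    contDiffAt_id.prodMk (hv.contDiffAt hz)
  set D₁ : Set Base := D ∩ (fun z => (z, v z)) ⁻¹' Φ.source with hD₁
  have hD₁o : IsOpen D₁ := by
    have : ContinuousOn (fun z => (z, v z)) D := continuousOn_id.prodMk hv.smooth.continuousOn
    exact this.isOpen_inter_preimage hv.isOpen Φ.open_source
  have hΓ : ∀ z ∈ D₁, ContDiffAt ℝ ∞ (fun z => Φ (z, v z)) z := fun z hz =>
    ContDiffAt.comp z (hΦ.1.contDiffAt hz.2) (hgc z hz.1)
  have hφc : ∀ z ∈ D₁, ContDiffAt ℝ ∞ φ z := fun z hz => (hΓ z hz).fst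
  have hz₁ : z₀ ∈ D₁ := ⟨hz, hs⟩
  have hder : HasFDerivAt φ ((ContinuousLinearMap.fst ℝ Base ℝ).comp
      ((fderiv ℝ Φ (z₀, v z₀)).comp ((ContinuousLinearMap.id ℝ Base).prod (fderiv ℝ v z₀)))) z₀ := by
    have h1 := (differentiableAt_of_smooth (hΦ.1.contDiffAt hs)).hasFDerivAt
    have h2 := (hasFDerivAt_id z₀).prodMk (differentiableAt_of_smooth (hv.contDiffAt hz)).hasFDerivAt
    exact (HasFDerivAt.comp z₀ h1 h2).fst
  set M : Base →L[ℝ] Base := (ContinuousLinearMap.fst ℝ Base ℝ).comp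
      ((fderiv ℝ Φ (z₀, v z₀)).comp ((ContinuousLinearMap.id ℝ Base).prod (fderiv ℝ v z₀)))
    with hM
  have hMinj : Function.Injective (M : Base →ₗ[ℝ] Base) := by
    rw [← LinearMap.ker_eq_bot, LinearMap.ker_eq_bot']
    intro n hn
    exact hinj n hn
  set Me : Base ≃L[ℝ] Base := (LinearEquiv.ofInjectiveEndo _ hMinj).toContinuousLinearEquiv
  have hMe : (Me : Base →L[ℝ] Base) = M := by ext <;> rfl
  have hder' : HasFDerivAt φ (Me : Base →L[ℝ] Base) z₀ := by rw [hMe]; exact hder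
  set e := (hφc z₀ hz₁).toOpenPartialHomeomorph φ hder' (by simp) with he
  have hee : ∀ z, e z = φ z := fun z => rfl
  have hze : z₀ ∈ e.source := (hφc z₀ hz₁).mem_toOpenPartialHomeomorph_source hder' (by simp)
  have hfc : ContinuousOn (fderiv ℝ φ) D₁ := by
    have : ContDiffOn ℝ ∞ φ D₁ := fun z hz => (hφc z hz).contDiffWithinAt
    exact this.continuousOn_fderiv_of_isOpen hD₁o (by simp)
  -- The local inverse must be smooth on all of `e '' S`, not only at the image of `z₀`. Hence the
  -- restriction to points with invertible derivative, an open condition.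
  set S : Set Base := e.source ∩ (D₁ ∩ fderiv ℝ φ ⁻¹' (Set.range ((↑) : (Base ≃L[ℝ] Base) → _)))
    with hS
  have hSo : IsOpen S :=
    e.open_source.inter (hfc.isOpen_inter_preimage hD₁o (ContinuousLinearEquiv.isOpen))
  have hzS : z₀ ∈ S := ⟨hze, hz₁, ⟨Me, hder'.fderiv.symm⟩⟩
  have hSD : S ⊆ D := fun z hz => hz.2.1.1
  set w : Base → ℝ := fun ζ => (Φ (e.symm ζ, v (e.symm ζ))).2 with hw
  have hwφ : ∀ z ∈ S, w (φ z) = (Φ (z, v z)).2 := fun z hz => by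
    simp only [hw, ← hee, e.left_inv hz.1]
  have hT : IsOpen (e '' S) := e.isOpen_image_of_subset_source hSo fun z hz => hz.1
  have hwc : ContDiffOn ℝ ∞ w (e '' S) := by
    rintro _ ⟨z, hz, rfl⟩
    obtain ⟨L, hL⟩ := hz.2.2
    have hsymm : ContDiffAt ℝ ∞ e.symm (e z) := by
      refine e.contDiffAt_symm (f₀' := L) (e.map_source hz.1) ?_ ?_
      · rw [e.left_inv hz.1, hL]
        exact (differentiableAt_of_smooth (hφc z hz.2.1)).hasFDerivAt
      · rw [e.left_inv hz.1]; exact hφc z hz.2.1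
    have h1 : ContDiffAt ℝ ∞ (fun z => Φ (z, v z)) (e.symm (e z)) := by
      rw [e.left_inv hz.1]; exact hΓ z hz.2.1
    exact (ContDiffAt.comp (e z) h1 hsymm).snd.contDiffWithinAt
  have himg : Φ '' Set.graphOn v S = Set.graphOn w (e '' S) := by
    simp only [Set.graphOn, Set.image_image]
    refine Set.image_congr fun z hz => ?_
    rw [hee, hwφ z hz]
  have hsub : Set.graphOn v S ⊆ Φ.source := by
    rintro _ ⟨z, hz, rfl⟩
    exact hz.2.1.2
  have hsol := (hΦ.2 v w S (e '' S) hSo hT (hv.smooth.mono hSD) hwc hsub himg).1 (hv.mono hSD hSo)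
  have hmem : φ z₀ ∈ e '' S := ⟨z₀, hzS, rfl⟩
  refine ⟨w, hsol.contDiffAt hmem, hsol.equation _ _ _ hmem, ?_⟩
  filter_upwards [hSo.mem_nhds hzS] with z hz using hwφ z hz

/-- The conditions that the image of a solution is a solution, in terms of the derivatives of
the solution. Here `dw` and `w₂` are the gradient and the second `x`-derivative of the image. -/
theorem IsPointSymmetry.exists_jet {Φ : OpenPartialHomeomorph Total Total}
    (hΦ : IsPointSymmetry Φ) {v : Base → ℝ} {D : Set Base} {z₀ : Base} (hv : IsSolutionOn v D)
    (hz : z₀ ∈ D) (hs : (z₀, v z₀) ∈ Φ.source)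
    (hinj : ∀ n : Base, (fderiv ℝ Φ (z₀, v z₀) (n, fderiv ℝ v z₀ n)).1 = 0 → n = 0) :
    ∃ (dw : Base →L[ℝ] ℝ) (w₂ : ℝ),
      (∀ n, dw (fderiv ℝ Φ (z₀, v z₀) (n, fderiv ℝ v z₀ n)).1 =
        (fderiv ℝ Φ (z₀, v z₀) (n, fderiv ℝ v z₀ n)).2) ∧
      (∀ n c, (fderiv ℝ Φ (z₀, v z₀) (n, fderiv ℝ v z₀ n)).1 = (0, c, 0) →
        c ^ 2 * w₂ + dw (fderiv ℝ (fderiv ℝ Φ) (z₀, v z₀) (n, fderiv ℝ v z₀ n) (n, fderiv ℝ v z₀ n) +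
            fderiv ℝ Φ (z₀, v z₀) (0, fderiv ℝ (fderiv ℝ v) z₀ n n)).1 =
          (fderiv ℝ (fderiv ℝ Φ) (z₀, v z₀) (n, fderiv ℝ v z₀ n) (n, fderiv ℝ v z₀ n) +
            fderiv ℝ Φ (z₀, v z₀) (0, fderiv ℝ (fderiv ℝ v) z₀ n n)).2) ∧
      dw (1, 0, 0) + (Φ (z₀, v z₀)).1.2.1 * dw (0, 0, 1) = (Φ (z₀, v z₀)).1.2.1 ^ 2 * w₂ := by
  obtain ⟨w, hw, heq, hev⟩ := hΦ.exists_image hv hz hs hinj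
  set g : Base → Total := fun z => (z, v z) with hg
  have hvc := hv.contDiffAt hz
  have hgc : ContDiffAt ℝ ∞ g z₀ := contDiffAt_id.prodMk hvc
  have hΦc : ContDiffAt ℝ ∞ Φ (g z₀) := hΦ.1.contDiffAt hs
  have hΓc : ContDiffAt ℝ ∞ (Φ ∘ g) z₀ := hΦc.comp z₀ hgc
  have dg : ∀ z, DifferentiableAt ℝ v z → fderiv ℝ g z =
      (ContinuousLinearMap.id ℝ Base).prod (fderiv ℝ v z) := fun z h =>
    ((hasFDerivAt_id z).prodMk h.hasFDerivAt).fderiv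
  have dg0 : ∀ n, fderiv ℝ g z₀ n = (n, fderiv ℝ v z₀ n) := fun n => by
    rw [dg z₀ (differentiableAt_of_smooth hvc)]; rfl
  have ddg : ∀ n, fderiv ℝ (fderiv ℝ g) z₀ n n = (0, fderiv ℝ (fderiv ℝ v) z₀ n n) := fun n => by
    have h1 : fderiv ℝ g =ᶠ[𝓝 z₀] fun z =>
        (ContinuousLinearMap.inl ℝ Base ℝ) + (ContinuousLinearMap.inr ℝ Base ℝ).comp (fderiv ℝ v z) := by
      filter_upwards [eventually_smooth hvc] with z h
      rw [dg z h]
      ext <;> simp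
    have d2 : DifferentiableAt ℝ (fderiv ℝ v) z₀ :=
      ((contDiffAt_two_of_smooth hvc).fderiv_right (m := 1) (by norm_num)).differentiableAt (by simp)
    rw [h1.fderiv_eq]
    have h3 := ((hasFDerivAt_const (ContinuousLinearMap.inr ℝ Base ℝ) z₀).clm_comp
      d2.hasFDerivAt).const_add (ContinuousLinearMap.inl ℝ Base ℝ)
    rw [h3.fderiv]
    simp
  have dΓ : ∀ n, fderiv ℝ (Φ ∘ g) z₀ n = fderiv ℝ Φ (g z₀) (n, fderiv ℝ v z₀ n) := fun n => by
    rw [fderiv_comp z₀ (differentiableAt_of_smooth hΦc) (differentiableAt_of_smooth hgc),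
      ContinuousLinearMap.comp_apply, dg0]
  have ddΓ := fun n => fderiv_fderiv_comp_apply (contDiffAt_two_of_smooth hΦc)
    (contDiffAt_two_of_smooth hgc) n
  simp only [ddg, dg0] at ddΓ
  have lin : ∀ {G : Type} [NormedAddCommGroup G] [NormedSpace ℝ G] (L : Total →L[ℝ] G) (n : Base),
      fderiv ℝ (L ∘ Φ ∘ g) z₀ n = L (fderiv ℝ (Φ ∘ g) z₀ n) ∧
      fderiv ℝ (fderiv ℝ (L ∘ Φ ∘ g)) z₀ n n = L (fderiv ℝ (fderiv ℝ (Φ ∘ g)) z₀ n n) := by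
    intro G _ _ L n
    constructor
    · rw [fderiv_comp z₀ L.differentiableAt (differentiableAt_of_smooth hΓc), L.fderiv]; rfl
    · rw [fderiv_fderiv_comp_apply (f := L) L.contDiff.contDiffAt (contDiffAt_two_of_smooth hΓc)]
      have : fderiv ℝ (L : Total → G) = fun _ => L := by ext1 x; exact L.fderiv
      simp [this]
  set P₁ := ContinuousLinearMap.fst ℝ Base ℝ with hP₁
  set P₂ := ContinuousLinearMap.snd ℝ Base ℝ with hP₂
  have hev' : w ∘ (P₁ ∘ Φ ∘ g) =ᶠ[𝓝 z₀] P₂ ∘ Φ ∘ g := hev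
  have hF : ContDiffAt ℝ ∞ (P₁ ∘ Φ ∘ g) z₀ := P₁.contDiff.contDiffAt.comp z₀ hΓc
  have hw' : ContDiffAt ℝ ∞ w ((P₁ ∘ Φ ∘ g) z₀) := hw
  refine ⟨fderiv ℝ w (Φ (g z₀)).1,
    fderiv ℝ (fderiv ℝ w) (Φ (g z₀)).1 (0, 1, 0) (0, 1, 0), fun n => ?_, fun n c hn => ?_, ?_⟩
  · have h1 := congrArg (fun L : Base →L[ℝ] ℝ => L n) hev'.fderiv_eq
    rw [fderiv_comp z₀ (differentiableAt_of_smooth hw') (differentiableAt_of_smooth hF),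
      ContinuousLinearMap.comp_apply, (lin P₁ n).1, (lin P₂ n).1, dΓ] at h1
    exact h1
  · have h1 := congrArg (fun L : Base →L[ℝ] Base →L[ℝ] ℝ => L n n)
      (hev'.fderiv (𝕜 := ℝ)).fderiv_eq
    rw [fderiv_fderiv_comp_apply (contDiffAt_two_of_smooth hw') (contDiffAt_two_of_smooth hF),
      (lin P₁ n).1, (lin P₁ n).2, (lin P₂ n).2, dΓ, ddΓ] at h1
    -- For a tangent vector carried to a multiple of the x-direction, only the pure second
    -- x-derivative of w occurs, which is the one in the equation.
    have hn' : P₁ (fderiv ℝ Φ (g z₀) (n, fderiv ℝ v z₀ n)) = c • ((0, 1, 0) : Base) := by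
      simp only [hP₁, ContinuousLinearMap.coe_fst']
      rw [hn]; simp
    rw [hn', map_smul] at h1
    simp only [smul_apply, map_smul, smul_eq_mul] at h1
    rw [← mul_assoc, ← pow_two] at h1
    exact h1
  · exact (equationAt_iff_fderiv hw).1 heq

/-! ### Explicit solutions with prescribed jets. -/

theorem isOpen_x_ne_zero : IsOpen {z : Base | z.2.1 ≠ 0} :=
  isOpen_ne.preimage (by fun_prop : Continuous fun z : Base => z.2.1)

/-- Solutions that are quadratic in `(t, y)`. -/
theorem exists_solution_of_coeffs {A A' B B' C C' : ℝ → ℝ} {k l : ℝ}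
    (sA : ∀ x ≠ 0, ContDiffAt ℝ ∞ A x) (sB : ∀ x ≠ 0, ContDiffAt ℝ ∞ B x)
    (sC : ∀ x ≠ 0, ContDiffAt ℝ ∞ C x)
    (hA : ∀ x ≠ 0, HasDerivAt A (A' x) x) (hB : ∀ x ≠ 0, HasDerivAt B (B' x) x)
    (hC : ∀ x ≠ 0, HasDerivAt C (C' x) x)
    (hA' : ∀ x ≠ 0, HasDerivAt A' (B x / x ^ 2 + C x / x) x)
    (hB' : ∀ x ≠ 0, HasDerivAt B' (k / x ^ 2) x) (hC' : ∀ x ≠ 0, HasDerivAt C' (l / x) x)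
    (t₀ y₀ : ℝ) {x₀ : ℝ} (hx₀ : x₀ ≠ 0) (hB₀ : B' x₀ = 0) (hC₀ : C' x₀ = 0) :
    ∃ v : Base → ℝ, IsSolutionOn v {z | z.2.1 ≠ 0} ∧ v (t₀, x₀, y₀) = A x₀ ∧
      (∀ n : Base, fderiv ℝ v (t₀, x₀, y₀) n = B x₀ * n.1 + A' x₀ * n.2.1 + C x₀ * n.2.2) ∧
      (∀ n : Base, fderiv ℝ (fderiv ℝ v) (t₀, x₀, y₀) n n =
        (B x₀ / x₀ ^ 2 + C x₀ / x₀) * n.2.1 ^ 2 + k * n.1 ^ 2 + l * n.2.2 ^ 2) := by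
  -- Comparing the coefficients of 1, t - t₀ and y - y₀ in the equation gives A'' = B/x² + C/x, B''
  -- = k/x², C'' = l/x. The conditions B'(x₀) = C'(x₀) = 0 remove the mixed derivatives with x at
  -- the base point.
  set v : Base → ℝ := fun z => A z.2.1 + (z.1 - t₀) * B z.2.1 + (z.2.2 - y₀) * C z.2.1 +
    k / 2 * (z.1 - t₀) ^ 2 + l / 2 * (z.2.2 - y₀) ^ 2 with hv
  have sv : ∀ z : Base, z.2.1 ≠ 0 → ContDiffAt ℝ ∞ v z := fun z hz => by
    have p2 : ContDiffAt ℝ ∞ (fun z : Base => z.2.1) z := by fun_prop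
    have a1 : ContDiffAt ℝ ∞ (fun z : Base => A z.2.1) z := (sA _ hz).comp z p2
    have b1 : ContDiffAt ℝ ∞ (fun z : Base => B z.2.1) z := (sB _ hz).comp z p2
    have c1 : ContDiffAt ℝ ∞ (fun z : Base => C z.2.1) z := (sC _ hz).comp z p2
    fun_prop
  have hline : ∀ (n : Base) (s : ℝ), x₀ + s * n.2.1 ≠ 0 →
      HasDerivAt (fun s : ℝ => v ((t₀, x₀, y₀) + (s - 0) • n))
        (A' (x₀ + s * n.2.1) * n.2.1 + (n.1 * B (x₀ + s * n.2.1) +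
          s * n.1 * (B' (x₀ + s * n.2.1) * n.2.1)) +
          (n.2.2 * C (x₀ + s * n.2.1) + s * n.2.2 * (C' (x₀ + s * n.2.1) * n.2.1)) +
          k * n.1 ^ 2 * s + l * n.2.2 ^ 2 * s) s := fun n s hs => by
    have e : (fun s : ℝ => v ((t₀, x₀, y₀) + (s - 0) • n)) = fun s => A (x₀ + s * n.2.1) +
        s * n.1 * B (x₀ + s * n.2.1) + s * n.2.2 * C (x₀ + s * n.2.1) + k / 2 * (s * n.1) ^ 2 +
        l / 2 * (s * n.2.2) ^ 2 := by
      ext s; simp [hv]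
    rw [e]
    have hl : ∀ m : ℝ, HasDerivAt (fun s : ℝ => s * m) m s := fun m => by
      simpa using (hasDerivAt_id s).mul_const m
    have hx := (hl n.2.1).const_add x₀
    have a1 := (hA _ hs).comp s hx
    have b1 := (hl n.1).mul ((hB _ hs).comp s hx)
    have c1 := (hl n.2.2).mul ((hC _ hs).comp s hx)
    have d1 := ((hl n.1).pow 2).const_mul (k / 2)
    have e1 := ((hl n.2.2).pow 2).const_mul (l / 2)
    refine ((((a1.add b1).add c1).add d1).add e1).congr_deriv ?_
    simp only [Function.comp]
    ring
  refine ⟨v, ⟨isOpen_x_ne_zero, fun z hz => (sv z hz).contDiffWithinAt, ?_⟩, by simp [hv],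
    fun n => ?_, fun n => ?_⟩
  · intro t x y hx
    replace hx : x ≠ 0 := hx
    have d1 : deriv (fun s => v (s, x, y)) t = B x + k * (t - t₀) := by
      have h0 : HasDerivAt (fun s => s - t₀) 1 t := (hasDerivAt_id t).sub_const t₀
      have := (((((hasDerivAt_const t (A x)).add (h0.mul_const (B x))).add
        (hasDerivAt_const t ((y - y₀) * C x))).add ((h0.pow 2).const_mul (k / 2))).add
        (hasDerivAt_const t (l / 2 * (y - y₀) ^ 2)))
      refine this.deriv.trans ?_
      simp; ring
    have d2 : deriv (fun s => v (t, x, s)) y = C x + l * (y - y₀) := by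
      have h0 : HasDerivAt (fun s => s - y₀) 1 y := (hasDerivAt_id y).sub_const y₀
      have := (((((hasDerivAt_const y (A x)).add (hasDerivAt_const y ((t - t₀) * B x))).add
        (h0.mul_const (C x))).add (hasDerivAt_const y (k / 2 * (t - t₀) ^ 2))).add
        ((h0.pow 2).const_mul (l / 2)))
      refine this.deriv.trans ?_
      simp; ring
    have d3 : ∀ᶠ s in 𝓝 x, deriv (fun s => v (t, s, y)) s =
        A' s + (t - t₀) * B' s + (y - y₀) * C' s := by
      filter_upwards [isOpen_ne.mem_nhds hx] with s hs
      have := ((((hA s hs).add ((hB s hs).const_mul (t - t₀))).add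
        ((hC s hs).const_mul (y - y₀))).add_const (k / 2 * (t - t₀) ^ 2)).add_const
          (l / 2 * (y - y₀) ^ 2)
      exact this.deriv
    rw [EquationAt, d1, d2, iteratedDeriv_succ, iteratedDeriv_one, EventuallyEq.deriv_eq d3]
    have := ((hA' x hx).add ((hB' x hx).const_mul (t - t₀))).add ((hC' x hx).const_mul (y - y₀))
    rw [show deriv (fun s => A' s + (t - t₀) * B' s + (y - y₀) * C' s) x = _ from this.deriv]
    field_simp
    ring
  · have h1 := hasDerivAt_line (differentiableAt_of_smooth (sv (t₀, x₀, y₀) hx₀)) n 0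
    rw [h1.unique (hline n 0 (by simpa using hx₀))]
    simp; ring
  · have h1 := hasDerivAt_deriv_line (contDiffAt_two_of_smooth (sv (t₀, x₀, y₀) hx₀)) n 0
    have hcont : ∀ᶠ s : ℝ in 𝓝 0, x₀ + s * n.2.1 ≠ 0 := by
      have : ContinuousAt (fun s : ℝ => x₀ + s * n.2.1) 0 := by fun_prop
      exact this.eventually_ne (by simpa using hx₀)
    have h2 := h1.congr_of_eventuallyEq (EventuallyEq.symm
      (hcont.mono fun s hs => (hline n s hs).deriv))
    have hl : ∀ m : ℝ, HasDerivAt (fun s : ℝ => s * m) m 0 := fun m => by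
      simpa using (hasDerivAt_id (0 : ℝ)).mul_const m
    have hl' : ∀ m : ℝ, HasDerivAt (fun s : ℝ => m * s) m 0 := fun m => by
      simpa using (hasDerivAt_id (0 : ℝ)).const_mul m
    have hx := (hl n.2.1).const_add x₀
    have hx₀' : x₀ + 0 * n.2.1 ≠ 0 := by simpa using hx₀
    have h3 := (((((((hA' _ hx₀').comp 0 hx).mul_const n.2.1).add
      ((((hB _ hx₀').comp 0 hx).const_mul n.1).add
        ((hl n.1).mul (((hB' _ hx₀').comp 0 hx).mul_const n.2.1)))).add
      ((((hC _ hx₀').comp 0 hx).const_mul n.2.2).add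
        ((hl n.2.2).mul (((hC' _ hx₀').comp 0 hx).mul_const n.2.1)))).add
      (hl' (k * n.1 ^ 2))).add (hl' (l * n.2.2 ^ 2)))
    refine (h2.unique h3).trans ?_
    simp [hB₀, hC₀]
    ring

/-- Solutions with prescribed values of the first derivatives and of some second derivatives. -/
theorem exists_solution_with_jet (t₀ : ℝ) {x₀ : ℝ} (y₀ : ℝ) (hx₀ : x₀ ≠ 0) (u₀ a b c k l : ℝ) :
    ∃ v : Base → ℝ, IsSolutionOn v {z | z.2.1 ≠ 0} ∧ v (t₀, x₀, y₀) = u₀ ∧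
      (∀ n : Base, fderiv ℝ v (t₀, x₀, y₀) n = a * n.1 + b * n.2.1 + c * n.2.2) ∧
      (∀ n : Base, fderiv ℝ (fderiv ℝ v) (t₀, x₀, y₀) n n =
        (a / x₀ ^ 2 + c / x₀) * n.2.1 ^ 2 + k * n.1 ^ 2 + l * n.2.2 ^ 2) := by
  -- `Real.log` is log |x|, so the same formulas work on both sides of x = 0.
  set lg : ℝ → ℝ := fun x => Real.log x - Real.log x₀ with hlg
  have dlg : ∀ x ≠ 0, HasDerivAt lg (1 / x) x := fun x hx =>
    ((Real.hasDerivAt_log hx).sub_const (Real.log x₀)).congr_deriv (one_div x).symm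
  have slg : ∀ x ≠ 0, ContDiffAt ℝ ∞ lg x := fun x hx => by
    simp only [hlg]; fun_prop (disch := assumption)
  have lg0 : lg x₀ = 0 := by simp [hlg]
  -- These solve P₁'' = 1/x², P₂'' = P₁/x², Q₁'' = 1/x, Q₂'' = Q₁/x, each vanishing at x₀ together
  -- with its first derivative.
  set P₁ : ℝ → ℝ := fun x => x / x₀ - 1 - lg x with hP₁
  set P₂ : ℝ → ℝ := fun x => lg x ^ 2 / 2 + 2 * lg x + x / x₀ * lg x - 3 * (x / x₀ - 1) with hP₂
  set Q₁ : ℝ → ℝ := fun x => x * lg x - (x - x₀) with hQ₁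
  set Q₂ : ℝ → ℝ := fun x => x ^ 2 / 2 * lg x + x₀ * (x * lg x) - 5 / 4 * x ^ 2 + x₀ * x + x₀ ^ 2 / 4
    with hQ₂
  have did := fun x : ℝ => hasDerivAt_id' x
  have dP₁ : ∀ x ≠ 0, HasDerivAt P₁ (1 / x₀ - 1 / x) x := fun x hx =>
    (((did x).div_const x₀).sub_const 1).sub (dlg x hx)
  have dQ₁ : ∀ x ≠ 0, HasDerivAt Q₁ (lg x) x := fun x hx =>
    (((did x).mul (dlg x hx)).sub ((did x).sub_const x₀)).congr_deriv (by field_simp; ring)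
  have dP₂ : ∀ x ≠ 0, HasDerivAt P₂ (lg x * (1 / x) + 2 * (1 / x) + lg x / x₀ - 2 / x₀) x :=
    fun x hx => by
    refine ((((((dlg x hx).pow 2).div_const 2).add ((dlg x hx).const_mul 2)).add
      (((did x).div_const x₀).mul (dlg x hx))).sub
        ((((did x).div_const x₀).sub_const 1).const_mul 3)).congr_deriv ?_
    field_simp
    simp
    ring
  have dQ₂ : ∀ x ≠ 0, HasDerivAt Q₂ (x * lg x + x₀ * lg x - 2 * x + 2 * x₀) x := fun x hx => by
    refine ((((((((did x).pow 2).div_const 2).mul (dlg x hx)).add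
      (((did x).mul (dlg x hx)).const_mul x₀)).sub (((did x).pow 2).const_mul (5 / 4))).add
        ((did x).const_mul x₀)).add_const (x₀ ^ 2 / 4)).congr_deriv ?_
    field_simp
    simp
    ring
  have dinv : ∀ x : ℝ, x ≠ 0 → HasDerivAt (fun x : ℝ => 1 / x) (-1 / x ^ 2) x := fun x hx => by
    simpa [neg_div] using hasDerivAt_inv hx
  obtain ⟨v, h1, h2, h3, h4⟩ := exists_solution_of_coeffs (k := k) (l := l)
    (A := fun x => u₀ + b * (x - x₀) + a * P₁ x + c * Q₁ x + k * P₂ x + l * Q₂ x)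
    (A' := fun x => b + a * (1 / x₀ - 1 / x) + c * lg x +
      k * (lg x * (1 / x) + 2 * (1 / x) + lg x / x₀ - 2 / x₀) +
      l * (x * lg x + x₀ * lg x - 2 * x + 2 * x₀))
    (B := fun x => a + k * P₁ x) (B' := fun x => k * (1 / x₀ - 1 / x))
    (C := fun x => c + l * Q₁ x) (C' := fun x => l * lg x)
    (fun x hx => by have := slg x hx; simp only [hP₁, hP₂, hQ₁, hQ₂]; fun_prop)
    (fun x hx => by have := slg x hx; simp only [hP₁]; fun_prop)
    (fun x hx => by have := slg x hx; simp only [hQ₁]; fun_prop)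
    (fun x hx => by
      refine (((((((did x).sub_const x₀).const_mul b).const_add u₀).add
        ((dP₁ x hx).const_mul a)).add ((dQ₁ x hx).const_mul c)).add
        ((dP₂ x hx).const_mul k)).add ((dQ₂ x hx).const_mul l) |>.congr_deriv ?_
      ring)
    (fun x hx => ((dP₁ x hx).const_mul k).const_add a)
    (fun x hx => ((dQ₁ x hx).const_mul l).const_add c)
    (fun x hx => by
      refine ((((((dinv x hx).const_sub (1 / x₀)).const_mul a).const_add b).add
        ((dlg x hx).const_mul c)).add (((((dlg x hx).mul (dinv x hx)).add
          ((dinv x hx).const_mul 2)).add ((dlg x hx).div_const x₀)).sub_const (2 / x₀)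
            |>.const_mul k)).add (((((did x).mul (dlg x hx)).add ((dlg x hx).const_mul x₀)).sub
            ((did x).const_mul 2)).add_const (2 * x₀) |>.const_mul l) |>.congr_deriv ?_
      simp only [hP₁, hQ₁]
      field_simp
      ring)
    (fun x hx => (((dinv x hx).const_sub (1 / x₀)).const_mul k).congr_deriv (by ring))
    (fun x hx => ((dlg x hx).const_mul l).congr_deriv (by ring))
    t₀ y₀ hx₀ (by simp) (by simp [lg0])
  have eP : P₁ x₀ = 0 := by simp [hP₁, lg0, hx₀]
  have eQ : Q₁ x₀ = 0 := by simp [hQ₁, lg0]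
  have eP₂ : P₂ x₀ = 0 := by simp [hP₂, lg0, hx₀]
  have eQ₂ : Q₂ x₀ = 0 := by simp [hQ₂, lg0]; ring
  refine ⟨v, h1, by simpa [eP, eQ, eP₂, eQ₂] using h2, fun n => ?_, fun n => ?_⟩
  · rw [h3]; simp [eP, eQ, lg0]; left; field_simp; simp
  · rw [h4]; simp [eP, eQ]

/-! ### Transversality of the image of a graph to the vertical direction. -/

section Transformation

variable {Φ : OpenPartialHomeomorph Total Total} {p : Total}

theorem IsPointTransformation.fderiv_symm_fderiv (h : IsPointTransformation Φ)
    (hp : p ∈ Φ.source) (n : Total) : fderiv ℝ Φ.symm (Φ p) (fderiv ℝ Φ p n) = n := by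
  have h1 := (differentiableAt_of_smooth (h.contDiffAt hp)).hasFDerivAt
  have h2 := (differentiableAt_of_smooth
    (h.2.contDiffAt (Φ.open_target.mem_nhds (Φ.map_source hp)))).hasFDerivAt
  have h3 := (h2.comp p h1).unique ((hasFDerivAt_id p).congr_of_eventuallyEq
    (by filter_upwards [Φ.eventually_left_inverse hp] with q hq using hq))
  exact congrArg (fun L : Total →L[ℝ] Total => L n) h3

theorem IsPointTransformation.fderiv_injective (h : IsPointTransformation Φ) (hp : p ∈ Φ.source) :
    Function.Injective (fderiv ℝ Φ p) :=
  Function.LeftInverse.injective (h.fderiv_symm_fderiv hp)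

theorem IsPointTransformation.fderiv_surjective (h : IsPointTransformation Φ)
    (hp : p ∈ Φ.source) : Function.Surjective (fderiv ℝ Φ p) :=
  LinearMap.injective_iff_surjective (f := (fderiv ℝ Φ p : Total →ₗ[ℝ] Total)) |>.1
    (h.fderiv_injective hp)

/-- There are enough gradients for which the tangent spaces of graphs avoid a given line. -/
theorem exists_generic_gradient {k : Total} (hk : k ≠ 0) :
    ∃ a c b₀ : ℝ, ∀ b ≠ b₀, a * k.1.1 + b * k.1.2.1 + c * k.1.2.2 ≠ k.2 := by
  obtain ⟨⟨k₁, k₂, k₃⟩, k₄⟩ := k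
  by_cases h2 : k₂ = 0
  · have : ∃ a c : ℝ, a * k₁ + c * k₃ ≠ k₄ := by
      by_contra! hcon
      have h4 := hcon 0 0
      have h1 := hcon 1 0
      have h3 := hcon 0 1
      apply hk
      simp only [Prod.mk_eq_zero]
      refine ⟨⟨?_, h2, ?_⟩, ?_⟩ <;> linarith
    obtain ⟨a, c, hac⟩ := this
    exact ⟨a, c, 0, fun b _ => by simpa [h2] using hac⟩
  · refine ⟨0, 0, k₄ / k₂, fun b hb h => hb ?_⟩
    simp only [zero_mul, zero_add, add_zero] at h
    field_simp
    exact h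

/-- If a graph is tangent to the line that is mapped to the vertical one only trivially, then the
image of its tangent space is transversal to the vertical direction. -/
theorem IsPointTransformation.transversal (h : IsPointTransformation Φ) (hp : p ∈ Φ.source)
    {k : Total} (hk : fderiv ℝ Φ p k = (0, 1)) {l : Base →L[ℝ] ℝ} (hl : l k.1 ≠ k.2) (n : Base)
    (hn : (fderiv ℝ Φ p (n, l n)).1 = 0) : n = 0 := by
  set r := (fderiv ℝ Φ p (n, l n)).2 with hr
  have h1 : fderiv ℝ Φ p (n, l n) = fderiv ℝ Φ p (r • k) := by
    rw [map_smul, hk]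
    ext1
    · simp [hn]
    · simp [hr]
  have h2 := h.fderiv_injective hp h1
  have e1 : n = r • k.1 := congrArg Prod.fst h2
  have e2 : l n = r * k.2 := congrArg Prod.snd h2
  have e3 : r * (l k.1 - k.2) = 0 := by
    rw [e1, map_smul, smul_eq_mul] at e2
    linarith
  have : r = 0 := (mul_eq_zero.1 e3).resolve_right (sub_ne_zero.2 hl)
  rw [e1, this, zero_smul]

/-- Transversality makes n ↦ (DΦ(n, l n)).1 an injective endomorphism of a finite-dimensional space.
The lemma yields the tangent vector carried to the x-direction, and shows that the gradient of the
image depends only on the 1-jet of the solution. -/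
theorem IsPointTransformation.exists_fderiv_fst_eq (h : IsPointTransformation Φ)
    (hp : p ∈ Φ.source) {k : Total} (hk : fderiv ℝ Φ p k = (0, 1)) {l : Base →L[ℝ] ℝ}
    (hl : l k.1 ≠ k.2) (m : Base) : ∃ n, (fderiv ℝ Φ p (n, l n)).1 = m := by
  set M : Base →L[ℝ] Base := (ContinuousLinearMap.fst ℝ Base ℝ).comp
      ((fderiv ℝ Φ p).comp ((ContinuousLinearMap.id ℝ Base).prod l))
  have hM : Function.Injective (M : Base →ₗ[ℝ] Base) := by
    rw [← LinearMap.ker_eq_bot, LinearMap.ker_eq_bot']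
    exact fun n hn => h.transversal hp hk hl n hn
  exact LinearMap.injective_iff_surjective.1 hM m

end Transformation

/-! ### Determining equations for the transformed independent variables. -/

/-- The covector with the given coordinates. -/
noncomputable def covector (a b c : ℝ) : Base →L[ℝ] ℝ :=
  a • ContinuousLinearMap.fst ℝ ℝ (ℝ × ℝ) +
    b • (ContinuousLinearMap.fst ℝ ℝ ℝ).comp (ContinuousLinearMap.snd ℝ ℝ (ℝ × ℝ)) +
    c • (ContinuousLinearMap.snd ℝ ℝ ℝ).comp (ContinuousLinearMap.snd ℝ ℝ (ℝ × ℝ))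

theorem covector_apply (a b c : ℝ) (n : Base) :
    covector a b c n = a * n.1 + b * n.2.1 + c * n.2.2 := by
  simp [covector]

/-- The conditions that the image of a solution with a given jet is a solution. -/
theorem IsPointSymmetry.exists_jet_of_covector {Φ : OpenPartialHomeomorph Total Total}
    (hΦ : IsPointSymmetry Φ) {t x y u : ℝ} (hp : ((t, x, y), u) ∈ Φ.source) (hx : x ≠ 0)
    {L : Total →L[ℝ] Total} (hL : fderiv ℝ Φ ((t, x, y), u) = L)
    {k : Total} (hk : L k = (0, 1)) {a b c : ℝ} (hl : covector a b c k.1 ≠ k.2) (d e : ℝ) :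
    ∃ (dw : Base →L[ℝ] ℝ) (w₂ : ℝ),
      (∀ n, dw (L (n, covector a b c n)).1 = (L (n, covector a b c n)).2) ∧
      (∀ n r, (L (n, covector a b c n)).1 = (0, r, 0) →
        r ^ 2 * w₂ + dw (fderiv ℝ (fderiv ℝ Φ) ((t, x, y), u) (n, covector a b c n)
              (n, covector a b c n) + L (0, (a / x ^ 2 + c / x) * n.2.1 ^ 2 + d * n.1 ^ 2 +
                e * n.2.2 ^ 2)).1 =
          (fderiv ℝ (fderiv ℝ Φ) ((t, x, y), u) (n, covector a b c n) (n, covector a b c n) +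
            L (0, (a / x ^ 2 + c / x) * n.2.1 ^ 2 + d * n.1 ^ 2 + e * n.2.2 ^ 2)).2) ∧
      dw (1, 0, 0) + (Φ ((t, x, y), u)).1.2.1 * dw (0, 0, 1) =
        (Φ ((t, x, y), u)).1.2.1 ^ 2 * w₂ := by
  obtain ⟨v, h1, h2, h3, h4⟩ := exists_solution_with_jet t y hx u a b c d e
  have h3' : fderiv ℝ v (t, x, y) = covector a b c := by
    refine ContinuousLinearMap.ext fun n => ?_
    rw [h3, covector_apply]
  subst hL
  have := hΦ.exists_jet (z₀ := (t, x, y)) h1 hx (by rw [h2]; exact hp)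
    (by rw [h2, h3']; exact fun n hn => hΦ.1.transversal hp hk hl n hn)
  simpa only [h2, h3', h4] using this

/-- At generic points, the transformed `t` and `y` do not depend on `x` and `u`. -/
theorem IsPointSymmetry.fderiv_xu_eq_zero {Φ : OpenPartialHomeomorph Total Total}
    (hΦ : IsPointSymmetry Φ) {t x y u : ℝ} (hp : ((t, x, y), u) ∈ Φ.source) (hx : x ≠ 0)
    (hX : (Φ ((t, x, y), u)).1.2.1 ≠ 0) :
    (fderiv ℝ Φ ((t, x, y), u) ((0, 1, 0), 0)).1.1 = 0 ∧
    (fderiv ℝ Φ ((t, x, y), u) (0, 1)).1.1 = 0 ∧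
    (fderiv ℝ Φ ((t, x, y), u) ((0, 1, 0), 0)).1.2.2 = 0 ∧
    (fderiv ℝ Φ ((t, x, y), u) (0, 1)).1.2.2 = 0 := by
  obtain ⟨k, hk⟩ := hΦ.1.fderiv_surjective hp (0, 1)
  have hk0 : k ≠ 0 := by
    rintro rfl
    simp [Prod.ext_iff] at hk
  have hinj := hΦ.1.fderiv_injective hp
  have main : ∀ a b c : ℝ, covector a b c k.1 ≠ k.2 →
      (fderiv ℝ Φ ((t, x, y), u) ((0, 1, 0), b)).1.1 = 0 ∧
      (fderiv ℝ Φ ((t, x, y), u) ((0, 1, 0), b)).1.2.2 = 0 := by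
    intro a b c hl
    have hsurj := hΦ.1.exists_fderiv_fst_eq hp hk hl
    obtain ⟨n, hn⟩ := hsurj (0, 1, 0)
    -- Two solutions with the same 1-jet but different u_tt and u_yy are compared. Their images have
    -- the same gradient, and then by the equation and X ≠ 0 the same second x-derivative, so the
    -- second derivative along n cannot depend on d and e.
    have vanish : ∀ d e : ℝ, d * n.1 ^ 2 + e * n.2.2 ^ 2 = 0 := by
      intro d e
      obtain ⟨dw, w₂, a1, a2, a3⟩ := hΦ.exists_jet_of_covector hp hx rfl hk hl 0 0
      obtain ⟨dw', w₂', b1, b2, b3⟩ := hΦ.exists_jet_of_covector hp hx rfl hk hl d e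
      have hdw : dw' = dw := by
        refine ContinuousLinearMap.ext fun m => ?_
        obtain ⟨n', rfl⟩ := hsurj m
        rw [a1, b1]
      have hw₂ : w₂' = w₂ := by
        rw [hdw, a3] at b3
        exact (mul_left_cancel₀ (pow_ne_zero 2 hX) b3).symm
      have a4 := a2 n 1 hn
      have b4 := b2 n 1 hn
      rw [hdw, hw₂] at b4
      set L := fderiv ℝ Φ ((t, x, y), u)
      set r := d * n.1 ^ 2 + e * n.2.2 ^ 2 with hr
      set s := (a / x ^ 2 + c / x) * n.2.1 ^ 2
      have e1 : s + 0 * n.1 ^ 2 + 0 * n.2.2 ^ 2 = s := by ring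
      have e2 : s + d * n.1 ^ 2 + e * n.2.2 ^ 2 = s + r := by rw [hr]; ring
      have e3 : ((0 : Base), s + r) = (0, s) + (0, r) := by simp
      rw [e1] at a4
      rw [e2, e3, map_add] at b4
      simp only [Prod.fst_add, Prod.snd_add, map_add] at a4 b4
      -- The image of the vertical vector (0, r) is tangent to the image graph. By injectivity (0,
      -- r) is itself tangent to the original graph, so r = 0.
      have h5 : dw (L (0, r)).1 = (L (0, r)).2 := by linarith
      obtain ⟨m, hm⟩ := hsurj (L (0, r)).1
      have h6 := a1 m
      rw [hm, h5] at h6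
      have h7 : (m, covector a b c m) = ((0 : Base), r) := hinj (Prod.ext hm h6.symm)
      have h8 : m = 0 := congrArg Prod.fst h7
      have h9 : covector a b c m = r := congrArg Prod.snd h7
      rw [← h9, h8, map_zero]
    have n1 : n.1 = 0 := by simpa using vanish 1 0
    have n3 : n.2.2 = 0 := by simpa using vanish 0 1
    have hn' : n = n.2.1 • ((0, 1, 0) : Base) := by
      ext <;> simp [n1, n3]
    have hc : (n, covector a b c n) = n.2.1 • (((0, 1, 0) : Base), b) := by
      rw [Prod.smul_mk, ← hn', covector_apply, n1, n3]
      simp [mul_comm]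
    rw [hc, map_smul] at hn
    have h2 : n.2.1 ≠ 0 := by
      intro h0
      rw [h0, zero_smul] at hn
      simp [Prod.ext_iff] at hn
    constructor
    · have := congrArg Prod.fst hn
      simpa [h2] using this
    · have := congrArg (fun q => q.2.2) hn
      simpa [h2] using this
  -- T and Y are stationary along ∂_x + b ∂_u for two values of b, hence along ∂_x and ∂_u
  -- separately.
  obtain ⟨a, c, b₀, hb⟩ := exists_generic_gradient hk0
  have m1 := main a (b₀ + 1) c (by rw [covector_apply]; exact hb _ (by simp))
  have m2 := main a (b₀ + 2) c (by rw [covector_apply]; exact hb _ (by simp))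
  have split : ∀ b : ℝ, fderiv ℝ Φ ((t, x, y), u) ((0, 1, 0), b) =
      fderiv ℝ Φ ((t, x, y), u) ((0, 1, 0), 0) + b • fderiv ℝ Φ ((t, x, y), u) (0, 1) := fun b => by
    rw [← map_smul, ← map_add]; simp
  rw [split] at m1 m2
  simp only [Prod.fst_add, Prod.snd_add, Prod.smul_fst, Prod.smul_snd, smul_eq_mul] at m1 m2
  obtain ⟨m1, m3⟩ := m1
  obtain ⟨m2, m4⟩ := m2
  have r1 : (fderiv ℝ Φ ((t, x, y), u) (0, 1)).1.1 = 0 := by linarith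
  have r2 : (fderiv ℝ Φ ((t, x, y), u) (0, 1)).1.2.2 = 0 := by linarith
  rw [r1] at m1
  rw [r2] at m3
  exact ⟨by linarith, r1, by linarith, r2⟩

/-- If a linear functional of `DF(q) n` vanishes near `p`, then it vanishes at `D²F(p)(m, n)`. -/
theorem fderiv_fderiv_eq_zero_of_eventually {E F G : Type*}
    [NormedAddCommGroup E] [NormedSpace ℝ E] [NormedAddCommGroup F] [NormedSpace ℝ F]
    [NormedAddCommGroup G] [NormedSpace ℝ G] {f : E → F} {p : E} (hf : ContDiffAt ℝ ∞ f p)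
    (P : F →L[ℝ] G) (n : E) (h : ∀ᶠ q in 𝓝 p, P (fderiv ℝ f q n) = 0) (m : E) :
    P (fderiv ℝ (fderiv ℝ f) p m n) = 0 := by
  have df : DifferentiableAt ℝ (fderiv ℝ f) p :=
    ((contDiffAt_two_of_smooth hf).fderiv_right (m := 1) (by norm_num)).differentiableAt (by simp)
  have h1 : HasFDerivAt (fun q => P (fderiv ℝ f q n))
      (P.comp ((fderiv ℝ (fderiv ℝ f) p).flip n)) p := by
    refine P.hasFDerivAt.comp p ?_
    simpa using df.hasFDerivAt.clm_apply (hasFDerivAt_const n p)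
  have h2 : HasFDerivAt (fun q => P (fderiv ℝ f q n)) (0 : E →L[ℝ] G) p :=
    (hasFDerivAt_const (0 : G) p).congr_of_eventuallyEq h
  simpa using congrArg (fun L : E →L[ℝ] G => L m) (h1.unique h2)

theorem IsPointSymmetry.eventually_generic {Φ : OpenPartialHomeomorph Total Total}
    (hΦ : IsPointSymmetry Φ) {p : Total} (hp : p ∈ Φ.source) (hx : p.1.2.1 ≠ 0)
    (hX : (Φ p).1.2.1 ≠ 0) : ∀ᶠ q in 𝓝 p, q ∈ Φ.source ∧ q.1.2.1 ≠ 0 ∧ (Φ q).1.2.1 ≠ 0 := by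
  have c1 : ContinuousAt (fun q : Total => q.1.2.1) p := by fun_prop
  have c2 : ContinuousAt (fun q : Total => (Φ q).1.2.1) p :=
    ContinuousAt.comp (f := Φ) (g := fun q : Total => q.1.2.1) (by fun_prop)
      (hΦ.1.contDiffAt hp).continuousAt
  filter_upwards [Φ.open_source.mem_nhds hp, c1.eventually_ne hx, c2.eventually_ne hX]
    with q h1 h2 h3 using ⟨h1, h2, h3⟩

/-- Linear algebra for the determining equations obtained by varying `u_t`. -/
theorem determining_t {Tt Ty Yt Yy w₁ w₃ Q d x X w₂ : ℝ} (hQ : Q ≠ 0) (hx : x ≠ 0)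
    (h1 : w₁ * Tt + w₃ * Yt = Q) (h2 : w₁ * Ty + w₃ * Yy = 0) (h3 : d ^ 2 * w₂ = Q * (1 / x ^ 2))
    (h4 : w₁ + X * w₃ = X ^ 2 * w₂) :
    d ^ 2 * x ^ 2 * (Yy - X * Ty) = X ^ 2 * (Tt * Yy - Ty * Yt) := by
  apply mul_left_cancel₀ hQ
  have hQx : d ^ 2 * x ^ 2 * w₂ = Q := by
    have : d ^ 2 * x ^ 2 * w₂ = x ^ 2 * (d ^ 2 * w₂) := by ring
    rw [this, h3]; field_simp
  -- Cramer's rule for w₁ and w₃; the result is then substituted into the equation `h4`.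
  have e1 : (Tt * Yy - Ty * Yt) * w₁ = Q * Yy := by linear_combination Yy * h1 - Yt * h2
  have e3 : (Tt * Yy - Ty * Yt) * w₃ = -(Q * Ty) := by linear_combination Tt * h2 - Ty * h1
  linear_combination -(d ^ 2 * x ^ 2) * e1 - d ^ 2 * x ^ 2 * X * e3 +
    d ^ 2 * x ^ 2 * (Tt * Yy - Ty * Yt) * h4 + X ^ 2 * (Tt * Yy - Ty * Yt) * hQx

/-- Linear algebra for the determining equations obtained by varying `u_y`. -/
theorem determining_y {Tt Ty Yt Yy w₁ w₃ Q d x X w₂ : ℝ} (hQ : Q ≠ 0) (hx : x ≠ 0)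
    (h1 : w₁ * Tt + w₃ * Yt = 0) (h2 : w₁ * Ty + w₃ * Yy = Q) (h3 : d ^ 2 * w₂ = Q * (1 / x))
    (h4 : w₁ + X * w₃ = X ^ 2 * w₂) :
    d ^ 2 * x ^ 2 * (X * Tt - Yt) = X ^ 2 * (Tt * Yy - Ty * Yt) * x := by
  apply mul_left_cancel₀ hQ
  have hQx : d ^ 2 * x ^ 2 * w₂ = Q * x := by
    have : d ^ 2 * x ^ 2 * w₂ = x ^ 2 * (d ^ 2 * w₂) := by ring
    rw [this, h3]; field_simp
  have e1 : (Tt * Yy - Ty * Yt) * w₁ = -(Q * Yt) := by linear_combination Yy * h1 - Yt * h2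
  have e3 : (Tt * Yy - Ty * Yt) * w₃ = Q * Tt := by linear_combination Tt * h2 - Ty * h1
  linear_combination -(d ^ 2 * x ^ 2) * e1 - d ^ 2 * x ^ 2 * X * e3 +
    d ^ 2 * x ^ 2 * (Tt * Yy - Ty * Yt) * h4 + X ^ 2 * (Tt * Yy - Ty * Yt) * hQx

/-- Determining equations for the transformed independent variables at generic points. -/
theorem IsPointSymmetry.determining_base {Φ : OpenPartialHomeomorph Total Total}
    (hΦ : IsPointSymmetry Φ) {t x y u : ℝ} (hp : ((t, x, y), u) ∈ Φ.source) (hx : x ≠ 0)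
    (hX : (Φ ((t, x, y), u)).1.2.1 ≠ 0) {L : Total →L[ℝ] Total}
    (hL : fderiv ℝ Φ ((t, x, y), u) = L) {X Tt Ty Yt Yy Xx : ℝ}
    (eX : X = (Φ ((t, x, y), u)).1.2.1) (eTt : Tt = (L ((1, 0, 0), 0)).1.1)
    (eTy : Ty = (L ((0, 0, 1), 0)).1.1) (eYt : Yt = (L ((1, 0, 0), 0)).1.2.2)
    (eYy : Yy = (L ((0, 0, 1), 0)).1.2.2) (eXx : Xx = (L ((0, 1, 0), 0)).1.2.1) :
    Tt * Yy - Ty * Yt ≠ 0 ∧ (L (0, 1)).1.2.1 = 0 ∧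
      Xx ^ 2 * x ^ 2 * (Yy - X * Ty) = X ^ 2 * (Tt * Yy - Ty * Yt) ∧
      Xx ^ 2 * x ^ 2 * (X * Tt - Yt) = X ^ 2 * (Tt * Yy - Ty * Yt) * x := by
  obtain ⟨zTx, zTu, zYx, zYu⟩ := hΦ.fderiv_xu_eq_zero hp hx hX
  rw [hL] at zTx zTu zYx zYu
  have hsurj := hΦ.1.fderiv_surjective hp
  have hinj := hΦ.1.fderiv_injective hp
  rw [hL] at hsurj hinj
  have hT : ∀ a b c d : ℝ, (L ((a, b, c), d)).1.1 = a * Tt + c * Ty := fun a b c d => by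
    rw [total_apply L]; simp [zTx, zTu, eTt, eTy]
  have hY : ∀ a b c d : ℝ, (L ((a, b, c), d)).1.2.2 = a * Yt + c * Yy := fun a b c d => by
    rw [total_apply L]; simp [zYx, zYu, eYt, eYy]
  have hΔ : Tt * Yy - Ty * Yt ≠ 0 := by
    obtain ⟨⟨⟨m₁, m₂, m₃⟩, m₄⟩, hm⟩ := hsurj ((1, 0, 0), 0)
    obtain ⟨⟨⟨m₁', m₂', m₃'⟩, m₄'⟩, hm'⟩ := hsurj ((0, 0, 1), 0)
    have h1 := hT m₁ m₂ m₃ m₄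
    have h2 := hY m₁ m₂ m₃ m₄
    have h3 := hT m₁' m₂' m₃' m₄'
    have h4 := hY m₁' m₂' m₃' m₄'
    rw [hm] at h1 h2
    rw [hm'] at h3 h4
    simp only at h1 h2 h3 h4
    intro h0
    -- Multiplicativity of determinants for the (t, y)-block of DΦ and the (t, y)-components of the
    -- preimages of ∂_t and ∂_y.
    have : (m₁ * m₃' - m₃ * m₁') * (Tt * Yy - Ty * Yt) = 1 := by
      linear_combination -(m₁' * Yt + m₃' * Yy) * h1 - h4 + (m₁ * Yt + m₃ * Yy) * h3
    rw [h0] at this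
    simp at this
  obtain ⟨⟨⟨k₁, k₂, k₃⟩, k₄⟩, hk⟩ := hsurj (0, 1)
  have hk1 : k₁ = 0 ∧ k₃ = 0 := by
    have h1 := hT k₁ k₂ k₃ k₄
    have h2 := hY k₁ k₂ k₃ k₄
    rw [hk] at h1 h2
    simp only [Prod.fst_zero, Prod.snd_zero] at h1 h2
    constructor
    · apply (mul_eq_zero.1 (_ : (Tt * Yy - Ty * Yt) * k₁ = 0)).resolve_left hΔ
      linear_combination -Yy * h1 + Ty * h2
    · apply (mul_eq_zero.1 (_ : (Tt * Yy - Ty * Yt) * k₃ = 0)).resolve_left hΔ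
      linear_combination -Tt * h2 + Yt * h1
  obtain ⟨rfl, rfl⟩ := hk1
  have hk0 : (((0, k₂, 0), k₄) : Total) ≠ 0 := by
    intro h0
    rw [h0, map_zero] at hk
    simp [Prod.ext_iff] at hk
  obtain ⟨a₀, c₀, b₀, hb₀⟩ := exists_generic_gradient hk0
  have hgood : ∀ a b c : ℝ, b ≠ b₀ → covector a b c (0, k₂, 0) ≠ k₄ := fun a b c hb => by
    have := hb₀ b hb
    rw [covector_apply]
    simpa using this
  set Xu := (L (0, 1)).1.2.1 with eXu
  set H := fderiv ℝ (fderiv ℝ Φ) ((t, x, y), u) with hH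
  have hΦc := hΦ.1.contDiffAt hp
  have hev : ∀ᶠ q in 𝓝 ((t, x, y), u), (fderiv ℝ Φ q ((0, 1, 0), 0)).1.1 = 0 ∧
    (fderiv ℝ Φ q (0, 1)).1.1 = 0 ∧ (fderiv ℝ Φ q ((0, 1, 0), 0)).1.2.2 = 0 ∧
    (fderiv ℝ Φ q (0, 1)).1.2.2 = 0 := by
    filter_upwards [hΦ.eventually_generic hp hx hX] with q hq
    exact hΦ.fderiv_xu_eq_zero hq.1 hq.2.1 hq.2.2
  have split : ∀ (M : Total →L[ℝ] Total) (b : ℝ), M ((0, 1, 0), b) = M ((0, 1, 0), 0) + b • M (0, 1) :=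
    fun M b => by rw [← map_smul, ← map_add]; simp
  have hH1 : ∀ b : ℝ, (H ((0, 1, 0), b) ((0, 1, 0), b)).1.1 = 0 := fun b => by
    refine fderiv_fderiv_eq_zero_of_eventually hΦc
      ((ContinuousLinearMap.fst ℝ ℝ (ℝ × ℝ)).comp (ContinuousLinearMap.fst ℝ Base ℝ)) _ ?_ _
    filter_upwards [hev] with q hq
    rw [split]; simp [hq]
  have hH2 : ∀ b : ℝ, (H ((0, 1, 0), b) ((0, 1, 0), b)).1.2.2 = 0 := fun b => by
    refine fderiv_fderiv_eq_zero_of_eventually hΦc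
      (((ContinuousLinearMap.snd ℝ ℝ ℝ).comp (ContinuousLinearMap.snd ℝ ℝ (ℝ × ℝ))).comp
        (ContinuousLinearMap.fst ℝ Base ℝ)) _ ?_ _
    filter_upwards [hev] with q hq
    rw [split]; simp [hq]
  set Xt := (L ((1, 0, 0), 0)).1.2.1 with eXt
  set Xy := (L ((0, 0, 1), 0)).1.2.1 with eXy
  set Ut := (L ((1, 0, 0), 0)).2 with eUt
  set Ux := (L ((0, 1, 0), 0)).2 with eUx
  set Uy := (L ((0, 0, 1), 0)).2 with eUy
  set Uu := (L (0, 1)).2 with eUu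
  have hXL : ∀ a b c d : ℝ, (L ((a, b, c), d)).1.2.1 = a * Xt + b * Xx + c * Xy + d * Xu :=
    fun a b c d => by rw [total_apply L]; simp [eXt, eXx, eXy, eXu]
  have hUL : ∀ a b c d : ℝ, (L ((a, b, c), d)).2 = a * Ut + b * Ux + c * Uy + d * Uu :=
    fun a b c d => by rw [total_apply L]; simp [eUt, eUx, eUy, eUu]
  have hfst : ∀ a b c d : ℝ, (L ((a, b, c), d)).1 =
      (a * Tt + c * Ty, a * Xt + b * Xx + c * Xy + d * Xu, a * Yt + c * Yy) := fun a b c d => by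
    rw [← hT a b c d, ← hXL, ← hY a b c d]
  -- the conditions for the jet `(a, b, c)`
  have jets : ∀ a b c : ℝ, b ≠ b₀ → ∃ w₁ w₂ w₃ w₂₂ : ℝ,
      w₁ * Tt + w₂ * (Xt + a * Xu) + w₃ * Yt = Ut + a * Uu ∧
      w₂ * (Xx + b * Xu) = Ux + b * Uu ∧
      w₁ * Ty + w₂ * (Xy + c * Xu) + w₃ * Yy = Uy + c * Uu ∧
      (Xx + b * Xu) ^ 2 * w₂₂ + w₂ * ((H ((0, 1, 0), b) ((0, 1, 0), b)).1.2.1 +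
        Xu * (a / x ^ 2 + c / x)) = (H ((0, 1, 0), b) ((0, 1, 0), b)).2 + Uu * (a / x ^ 2 + c / x) ∧
      w₁ + X * w₃ = X ^ 2 * w₂₂ := by
    intro a b c hb
    obtain ⟨dw, w₂₂, j1, j2, j3⟩ := hΦ.exists_jet_of_covector hp hx hL hk (hgood a b c hb) 0 0
    have hdw : ∀ q : Base, dw q = q.1 * dw (1, 0, 0) + q.2.1 * dw (0, 1, 0) + q.2.2 * dw (0, 0, 1) :=
      fun q => by simpa using base_apply dw q.1 q.2.1 q.2.2
    have j1t := j1 (1, 0, 0)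
    have j1x := j1 (0, 1, 0)
    have j1y := j1 (0, 0, 1)
    simp only [covector_apply] at j1t j1x j1y
    rw [hfst, hUL, hdw] at j1t j1x j1y
    have j4 := j2 (0, 1, 0) (Xx + b * Xu) (by
      simp only [covector_apply]; rw [hfst]; simp)
    simp only [covector_apply, mul_zero, mul_one, zero_add, add_zero] at j4
    rw [hdw] at j4
    have hs : ∀ r : ℝ, (0, r) = (((0, 0, 0), r) : Total) := fun r => rfl
    simp only [Prod.fst_add, Prod.snd_add] at j4
    rw [hs, hT, hXL, hY, hUL, hH1, hH2] at j4
    refine ⟨dw (1, 0, 0), dw (0, 1, 0), dw (0, 0, 1), w₂₂, ?_, ?_, ?_, ?_, ?_⟩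
    · simp at j1t; linarith
    · simp at j1x; linarith
    · simp at j1y; linarith
    · simp at j4; linarith
    · rw [eX]; exact j3
  -- The conditions for the gradients (0, b, 0) and (1, b, 0), or (0, b, 1), are subtracted. The
  -- x-derivative of the image is determined by b alone, so all terms with the Hessian of Φ cancel
  -- and a linear system with the source Q = U_u - w₂ X_u remains.
  have eqs : ∀ b : ℝ, b ≠ b₀ →
      (Xx + b * Xu) ^ 2 * x ^ 2 * (Yy - X * Ty) = X ^ 2 * (Tt * Yy - Ty * Yt) ∧
      (Xx + b * Xu) ^ 2 * x ^ 2 * (X * Tt - Yt) = X ^ 2 * (Tt * Yy - Ty * Yt) * x := by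
    intro b hb
    have hD : Xx + b * Xu ≠ 0 := by
      intro h0
      have := hΦ.1.transversal hp (hL ▸ hk) (hgood 0 b 0 hb) (0, 1, 0) (by
        rw [covector_apply, hL, hfst]; simp [h0])
      simp [Prod.ext_iff] at this
    obtain ⟨w₁, w₂, w₃, w₂₂, o1, o2, o3, o4, o5⟩ := jets 0 b 0 hb
    -- If Q were 0, then s(∂_x + b ∂_u) with s = X_u/(X_x + b X_u) and ∂_u would have the same image
    -- under DΦ.
    have hQ : Uu - w₂ * Xu ≠ 0 := by
      intro h0
      set s := Xu / (Xx + b * Xu) with hs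
      have e1 : s * (Xx + b * Xu) = Xu := div_mul_cancel₀ _ hD
      have e2 : L ((0, s, 0), s * b) = L ((0, 0, 0), 1) := by
        refine Prod.ext ?_ ?_
        · rw [hfst, hfst]
          simp
          linarith
        · rw [hUL, hUL]
          linear_combination -h0 - s * o2 + w₂ * e1
      have e3 := hinj e2
      simp only [Prod.mk.injEq, true_and, and_true] at e3
      rw [e3.1] at e3
      simp at e3
    constructor
    · obtain ⟨w₁', w₂', w₃', w₂₂', a1, a2, a3, a4, a5⟩ := jets 1 b 0 hb
      have hw : w₂' = w₂ := mul_right_cancel₀ hD (a2.trans o2.symm)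
      rw [hw] at a1 a3 a4
      refine determining_t (w₁ := w₁' - w₁) (w₃ := w₃' - w₃) (w₂ := w₂₂' - w₂₂) hQ hx ?_ ?_ ?_ ?_
      · linear_combination a1 - o1
      · linear_combination a3 - o3
      · linear_combination a4 - o4
      · linear_combination a5 - o5
    · obtain ⟨w₁', w₂', w₃', w₂₂', a1, a2, a3, a4, a5⟩ := jets 0 b 1 hb
      have hw : w₂' = w₂ := mul_right_cancel₀ hD (a2.trans o2.symm)
      rw [hw] at a1 a3 a4
      refine determining_y (w₁ := w₁' - w₁) (w₃ := w₃' - w₃) (w₂ := w₂₂' - w₂₂) hQ hx ?_ ?_ ?_ ?_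
      · linear_combination a1 - o1
      · linear_combination a3 - o3
      · linear_combination a4 - o4
      · linear_combination a5 - o5
  -- The right sides do not depend on b, while the left sides are quadratic in b. The second
  -- difference over three admissible values gives X_u = 0.
  have s1 := eqs (b₀ + 1) (by simp)
  have s2 := eqs (b₀ + 2) (by simp)
  have s3 := eqs (b₀ + 3) (by simp)
  have hX' : X ≠ 0 := eX ▸ hX
  have hXu : Xu = 0 := by
    have hR : X ^ 2 * (Tt * Yy - Ty * Yt) ≠ 0 := mul_ne_zero (pow_ne_zero 2 hX') hΔ
    have hc : x ^ 2 * (Yy - X * Ty) ≠ 0 := by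
      intro h0
      apply hR
      rw [← s1.1, mul_assoc, h0, mul_zero]
    have : x ^ 2 * (Yy - X * Ty) * (2 * Xu ^ 2) = 0 := by
      linear_combination s1.1 - 2 * s2.1 + s3.1
    simpa [hc] using this
  rw [hXu] at s1
  simp only [mul_zero, add_zero] at s1
  exact ⟨hΔ, hXu, s1.1, s1.2⟩

/-! ### Solving the determining equations at generic points. -/

/-- The left side vanishes only at s = 0. If Ty ≠ 0, the root -Tt/Ty of the right side must be 0,
and then at s = -1/Ty a square equals minus a square, which contradicts Δ ≠ 0. With Ty = 0, the
values s = 0 and s = 1 give the rest. -/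
theorem coeffs_of_polynomial_identity {Tt Ty Yt Yy : ℝ} (hΔ : Tt * Yy - Ty * Yt ≠ 0)
    (h : ∀ s : ℝ, (Tt * Yy - Ty * Yt) ^ 2 * s ^ 2 = (Yt + s * Yy) ^ 2 * (Tt + s * Ty) ^ 3) :
    Ty = 0 ∧ Yt = 0 ∧ Tt = 1 := by
  have hTy : Ty = 0 := by
    by_contra hTy
    have h1 := h (-Tt / Ty)
    have h2 : Tt + -Tt / Ty * Ty = 0 := by field_simp; ring
    rw [h2] at h1
    have hTt : Tt = 0 := by simpa [hΔ, hTy] using h1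
    subst hTt
    have h3 := h (-1 / Ty)
    have h4 : 0 + -1 / Ty * Ty = -1 := by field_simp; ring
    rw [h4] at h3
    have h5 : (0 * Yy - Ty * Yt) ^ 2 * (-1 / Ty) ^ 2 = Yt ^ 2 := by field_simp; ring
    rw [h5] at h3
    have h6 : Yt = 0 := by nlinarith [sq_nonneg (Yt + -1 / Ty * Yy), sq_nonneg Yt]
    apply hΔ
    rw [h6]; ring
  subst hTy
  have hΔ' : Tt * Yy ≠ 0 := by simpa using hΔ
  have hTt := left_ne_zero_of_mul hΔ'
  have hYy := right_ne_zero_of_mul hΔ'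
  have hYt : Yt = 0 := by simpa [hTt] using (h 0).symm
  subst hYt
  refine ⟨rfl, rfl, ?_⟩
  have h1 := h 1
  have h2 : Tt ^ 2 * Yy ^ 2 * (Tt - 1) = 0 := by linear_combination -h1
  have h3 : Tt ^ 2 * Yy ^ 2 ≠ 0 := by positivity
  linarith [(mul_eq_zero.1 h2).resolve_left h3]

/-- Here s is the coordinate x, and `h2` is the s-derivative of `h1`. With d = Tt + s Ty and e = Y_y
- X T_y one has Δ = d e and e = X_x d; so `h3` becomes e² s² = X² d³, and multiplication by d²
eliminates X and X_x. -/
theorem identity_of_determining {Tt Ty Yt Yy X Xx s : ℝ} (hΔ : Tt * Yy - Ty * Yt ≠ 0)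
    (h1 : X * (Tt + s * Ty) = Yt + s * Yy) (h2 : Xx * (Tt + s * Ty) + X * Ty = Yy)
    (h3 : Xx ^ 2 * s ^ 2 * (Yy - X * Ty) = X ^ 2 * (Tt * Yy - Ty * Yt)) :
    (Tt * Yy - Ty * Yt) ^ 2 * s ^ 2 = (Yt + s * Yy) ^ 2 * (Tt + s * Ty) ^ 3 := by
  have e1 : (Tt + s * Ty) * (Yy - X * Ty) = Tt * Yy - Ty * Yt := by
    linear_combination -Ty * h1
  set d := Tt + s * Ty with hd
  set e := Yy - X * Ty with he
  have e2 : Xx * d = e := by rw [he]; linear_combination h2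
  have hd0 : d ≠ 0 := by
    intro h0
    rw [h0, zero_mul] at e1
    exact hΔ e1.symm
  rw [← e1] at h3 hΔ ⊢
  have he0 : e ≠ 0 := right_ne_zero_of_mul hΔ
  have e3 : e ^ 2 * s ^ 2 = X ^ 2 * d ^ 2 * d := by
    apply mul_right_cancel₀ he0
    rw [← e2] at h3 ⊢
    linear_combination d ^ 2 * h3
  rw [← h1]
  linear_combination d ^ 2 * e3

/-- At generic points, the transformed independent variables are `t + λ`, `x Y'(y)` and `Y(y)`,
in infinitesimal form. -/
theorem IsPointSymmetry.base_relations_of_generic {Φ : OpenPartialHomeomorph Total Total}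
    (hΦ : IsPointSymmetry Φ) {t x y u : ℝ} (hp : ((t, x, y), u) ∈ Φ.source) (hx : x ≠ 0)
    (hX : (Φ ((t, x, y), u)).1.2.1 ≠ 0) :
    (fderiv ℝ Φ ((t, x, y), u) ((1, 0, 0), 0)).1.1 = 1 ∧
    (fderiv ℝ Φ ((t, x, y), u) ((0, 0, 1), 0)).1.1 = 0 ∧
    (fderiv ℝ Φ ((t, x, y), u) ((1, 0, 0), 0)).1.2.2 = 0 ∧
    (Φ ((t, x, y), u)).1.2.1 = x * (fderiv ℝ Φ ((t, x, y), u) ((0, 0, 1), 0)).1.2.2 := by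
  have hev := hΦ.eventually_generic hp hx hX
  obtain ⟨r, hr, hball⟩ := Metric.eventually_nhds_iff.1 hev
  have hI : ∀ s ∈ Set.Ioo (x - r) (x + r), ((t, s, y), u) ∈ Φ.source ∧ s ≠ 0 ∧
      (Φ ((t, s, y), u)).1.2.1 ≠ 0 := fun s hs => by
    refine hball (y := ((t, s, y), u)) ?_
    simp only [Prod.dist_eq, dist_self, Real.dist_eq]
    simp [abs_lt]
    constructor <;> linarith [hs.1, hs.2]
  have hxI : x ∈ Set.Ioo (x - r) (x + r) := ⟨by linarith, by linarith⟩
  -- functionals of the derivative that are constant along the `x`-lines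
  have hconst : ∀ (P : Total →L[ℝ] ℝ) (n : Total),
      (∀ q : Total, q ∈ Φ.source → q.1.2.1 ≠ 0 → (Φ q).1.2.1 ≠ 0 →
        P (fderiv ℝ Φ q ((0, 1, 0), 0)) = 0) → ∀ s ∈ Set.Ioo (x - r) (x + r),
      P (fderiv ℝ Φ ((t, s, y), u) n) = P (fderiv ℝ Φ ((t, x, y), u) n) := by
    intro P n hP s hs
    have hd : ∀ s ∈ Set.Ioo (x - r) (x + r),
        HasDerivAt (fun s => P (fderiv ℝ Φ ((t, s, y), u) n)) 0 s := by
      intro s hs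
      obtain ⟨a1, a2, a3⟩ := hI s hs
      have hc := hΦ.1.contDiffAt a1
      have df : DifferentiableAt ℝ (fderiv ℝ Φ) ((t, s, y), u) :=
        ((contDiffAt_two_of_smooth hc).fderiv_right (m := 1) (by norm_num)).differentiableAt
          (by simp)
      have h1 := P.hasFDerivAt.comp_hasDerivAt s
        ((hasDerivAt_line df ((0, 1, 0), 0) s).clm_apply (hasDerivAt_const s n))
      have hsymm : IsSymmSndFDerivAt ℝ Φ ((t, s, y), u) :=
        (contDiffAt_two_of_smooth hc).isSymmSndFDerivAt (by simp)
      -- The x-derivative of P(DΦ n) is P(D²Φ(∂_x, n)). By symmetry it is the derivative along n of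
      -- P(DΦ ∂_x), which is identically zero nearby.
      have h0 : P (fderiv ℝ (fderiv ℝ Φ) ((t, s, y), u) n ((0, 1, 0), 0)) = 0 := by
        refine fderiv_fderiv_eq_zero_of_eventually hc P _ ?_ n
        filter_upwards [hΦ.eventually_generic a1 a2 a3] with q hq
        exact hP q hq.1 hq.2.1 hq.2.2
      rw [hsymm.eq] at h0
      refine (h1.congr_deriv (by simpa using h0)).congr_of_eventuallyEq ?_
      refine Eventually.of_forall fun s' => ?_
      simp
    exact (convex_Ioo (x - r) (x + r)).is_const_of_fderivWithin_eq_zero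
      (f := fun s => P (fderiv ℝ Φ ((t, s, y), u) n)) (𝕜 := ℝ)
      (fun s hs => (hd s hs).differentiableAt.differentiableWithinAt)
      (fun s hs => by
        rw [(isOpen_Ioo.uniqueDiffWithinAt hs |> fun h =>
          (hd s hs).hasFDerivAt.hasFDerivWithinAt.fderivWithin h)]
        ext; simp) hs hxI
  set PT : Total →L[ℝ] ℝ :=
    (ContinuousLinearMap.fst ℝ ℝ (ℝ × ℝ)).comp (ContinuousLinearMap.fst ℝ Base ℝ)
  set PY : Total →L[ℝ] ℝ := ((ContinuousLinearMap.snd ℝ ℝ ℝ).comp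
    (ContinuousLinearMap.snd ℝ ℝ (ℝ × ℝ))).comp (ContinuousLinearMap.fst ℝ Base ℝ)
  set Tt := (fderiv ℝ Φ ((t, x, y), u) ((1, 0, 0), 0)).1.1 with eTt
  set Ty := (fderiv ℝ Φ ((t, x, y), u) ((0, 0, 1), 0)).1.1 with eTy
  set Yt := (fderiv ℝ Φ ((t, x, y), u) ((1, 0, 0), 0)).1.2.2 with eYt
  set Yy := (fderiv ℝ Φ ((t, x, y), u) ((0, 0, 1), 0)).1.2.2 with eYy
  have zT : ∀ q : Total, q ∈ Φ.source → q.1.2.1 ≠ 0 → (Φ q).1.2.1 ≠ 0 →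
        PT (fderiv ℝ Φ q ((0, 1, 0), 0)) = 0 := fun q a1 a2 a3 =>
    (hΦ.fderiv_xu_eq_zero a1 a2 a3).1
  have zY : ∀ q : Total, q ∈ Φ.source → q.1.2.1 ≠ 0 → (Φ q).1.2.1 ≠ 0 →
        PY (fderiv ℝ Φ q ((0, 1, 0), 0)) = 0 := fun q a1 a2 a3 =>
    (hΦ.fderiv_xu_eq_zero a1 a2 a3).2.2.1
  have cTt := hconst PT ((1, 0, 0), 0) zT
  have cTy := hconst PT ((0, 0, 1), 0) zT
  have cYt := hconst PY ((1, 0, 0), 0) zY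
  have cYy := hconst PY ((0, 0, 1), 0) zY
  have det : ∀ s ∈ Set.Ioo (x - r) (x + r), Tt * Yy - Ty * Yt ≠ 0 ∧
      (Φ ((t, s, y), u)).1.2.1 * (Tt + s * Ty) = Yt + s * Yy ∧
      (fderiv ℝ Φ ((t, s, y), u) ((0, 1, 0), 0)).1.2.1 ^ 2 * s ^ 2 *
        (Yy - (Φ ((t, s, y), u)).1.2.1 * Ty) =
          (Φ ((t, s, y), u)).1.2.1 ^ 2 * (Tt * Yy - Ty * Yt) := by
    intro s hs
    obtain ⟨a1, a2, a3⟩ := hI s hs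
    obtain ⟨b1, -, b3, b4⟩ := hΦ.determining_base (Tt := Tt) (Ty := Ty) (Yt := Yt) (Yy := Yy)
      a1 a2 a3 rfl rfl (cTt s hs).symm (cTy s hs).symm
      (cYt s hs).symm (cYy s hs).symm rfl
    refine ⟨b1, ?_, b3⟩
    set Xx := (fderiv ℝ Φ ((t, s, y), u) ((0, 1, 0), 0)).1.2.1
    set X := (Φ ((t, s, y), u)).1.2.1
    have hne : Xx ^ 2 * s ^ 2 ≠ 0 := by
      intro h0
      rw [h0, zero_mul] at b3
      exact mul_ne_zero (pow_ne_zero 2 a3) b1 b3.symm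
    -- The quotient of the two determining relations, which determines X as a fractional linear
    -- function of x.
    have : X * Tt - Yt = s * (Yy - X * Ty) := by
      apply mul_left_cancel₀ hne
      linear_combination b4 - s * b3
    linear_combination this
  have hΔ := (det x hxI).1
  have ident : ∀ s ∈ Set.Ioo (x - r) (x + r),
      (Tt * Yy - Ty * Yt) ^ 2 * s ^ 2 = (Yt + s * Yy) ^ 2 * (Tt + s * Ty) ^ 3 := by
    intro s hs
    obtain ⟨-, b2, b3⟩ := det s hs
    refine identity_of_determining hΔ b2 ?_ b3
    have hXd : HasDerivAt (fun s => (Φ ((t, s, y), u)).1.2.1)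
        (fderiv ℝ Φ ((t, s, y), u) ((0, 1, 0), 0)).1.2.1 s := by
      have := (hasDerivAt_line (differentiableAt_of_smooth (hΦ.1.contDiffAt (hI s hs).1))
        ((0, 1, 0), 0) s)
      have h2 := (((ContinuousLinearMap.fst ℝ ℝ ℝ).comp (ContinuousLinearMap.snd ℝ ℝ (ℝ × ℝ))).comp
        (ContinuousLinearMap.fst ℝ Base ℝ)).hasFDerivAt.comp_hasDerivAt s this
      refine h2.congr_of_eventuallyEq (Eventually.of_forall fun s' => ?_)
      simp
    have h1 := hXd.mul (((hasDerivAt_id' s).mul_const Ty).const_add Tt)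
    have h2 : HasDerivAt (fun s => Yt + s * Yy) (1 * Yy) s :=
      ((hasDerivAt_id' s).mul_const Yy).const_add Yt
    have h3 := h1.unique (h2.congr_of_eventuallyEq (by
      filter_upwards [isOpen_Ioo.mem_nhds hs] with s' hs' using (det s' hs').2.1))
    linarith
  -- Passing to all s is needed because the coefficients are compared at points, such as s = 0, that
  -- may lie outside the interval.
  have identAll : ∀ s : ℝ,
      (Tt * Yy - Ty * Yt) ^ 2 * s ^ 2 = (Yt + s * Yy) ^ 2 * (Tt + s * Ty) ^ 3 := by
    open Polynomial in
    have hpoly : (C ((Tt * Yy - Ty * Yt) ^ 2) * (X : ℝ[X]) ^ 2) =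
        (C Yt + X * C Yy) ^ 2 * (C Tt + X * C Ty) ^ 3 := by
      refine Polynomial.eq_of_infinite_eval_eq _ _
        ((Set.Ioo_infinite (by linarith : x - r < x + r)).mono fun s hs => ?_)
      have := ident s hs
      simp only [mul_comm s] at this
      simpa using this
    intro s
    simpa [mul_comm s] using congrArg (Polynomial.eval s) hpoly
  obtain ⟨h1, h2, h3⟩ := coeffs_of_polynomial_identity hΔ identAll
  refine ⟨h3, h1, h2, ?_⟩
  have := (det x hxI).2.1
  rw [h1, h2, h3] at this
  linarith

/-! ### From generic points to all points, and integration over balls. -/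

theorem eq_of_fderiv_apply_eq_zero {E : Type*} [NormedAddCommGroup E] [NormedSpace ℝ E]
    {f : E → ℝ} {B : Set E} (hB : Convex ℝ B) (hf : ∀ q ∈ B, DifferentiableAt ℝ f q) {p q : E}
    (hp : p ∈ B) (hq : q ∈ B) (h : ∀ z ∈ segment ℝ p q, fderiv ℝ f z (q - p) = 0) : f q = f p := by
  obtain ⟨z, hz, he⟩ := domain_mvt (f' := fderiv ℝ f)
    (fun q hq => (hf q hq).hasFDerivAt.hasFDerivWithinAt) hB hp hq
  rw [h z hz, sub_eq_zero] at he
  exact he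

theorem eq_of_hasDerivAt_zero {f : ℝ → ℝ} {a b : ℝ} (h : ∀ s ∈ Set.Ioo a b, HasDerivAt f 0 s)
    {s s' : ℝ} (hs : s ∈ Set.Ioo a b) (hs' : s' ∈ Set.Ioo a b) : f s = f s' := by
  refine eq_of_fderiv_apply_eq_zero (convex_Ioo a b) (fun q hq => (h q hq).differentiableAt) hs' hs
    fun z hz => ?_
  rw [((h z ((convex_Ioo a b).segment_subset hs' hs hz)).hasFDerivAt).fderiv]
  simp

theorem exists_x_ne_zero {V : Set Total} (hV : IsOpen V) (hne : V.Nonempty) :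
    ∃ q ∈ V, q.1.2.1 ≠ 0 := by
  obtain ⟨⟨⟨t, x, y⟩, u⟩, hq⟩ := hne
  by_contra! hcon
  have hx : x = 0 := hcon _ hq
  have hc : ContinuousAt (fun s : ℝ => (((t, s, y), u) : Total)) x := by fun_prop
  have h1 : ∀ᶠ s in 𝓝 x, s = 0 := by
    filter_upwards [hc.preimage_mem_nhds (hV.mem_nhds hq)] with s hs using hcon _ hs
  rw [hx] at h1
  have h2 : ∀ᶠ s : ℝ in 𝓝[≠] 0, s = 0 := h1.filter_mono nhdsWithin_le_nhds
  have h3 : ∀ᶠ s : ℝ in 𝓝[≠] 0, s ≠ 0 := eventually_mem_nhdsWithin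
  obtain ⟨s, hs, hs'⟩ := (h2.and h3).exists
  exact hs' hs

/-- Since Φ is open, the condition X ≠ 0 is the condition x ≠ 0 on the open image of the points
already known to satisfy the latter. -/
theorem exists_generic {Φ : OpenPartialHomeomorph Total Total} {V : Set Total} (hV : IsOpen V)
    (hVΦ : V ⊆ Φ.source) (hne : V.Nonempty) : ∃ q ∈ V, q.1.2.1 ≠ 0 ∧ (Φ q).1.2.1 ≠ 0 := by
  have hc : IsOpen {q : Total | q.1.2.1 ≠ 0} :=
    isOpen_ne.preimage (by fun_prop : Continuous fun q : Total => q.1.2.1)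
  have h1 : IsOpen (Φ '' (V ∩ {q : Total | q.1.2.1 ≠ 0})) :=
    Φ.isOpen_image_of_subset_source (hV.inter hc) fun q hq => hVΦ hq.1
  obtain ⟨q, hq, hq'⟩ := exists_x_ne_zero hV hne
  obtain ⟨_, ⟨q', hq', rfl⟩, h2⟩ := exists_x_ne_zero h1 ⟨_, ⟨q, ⟨hq, hq'⟩, rfl⟩⟩
  exact ⟨q', hq'.1, hq'.2, h2⟩

/-- An identity that holds at generic points of an open subset holds on this subset. -/
theorem eq_zero_of_generic {Φ : OpenPartialHomeomorph Total Total} {V : Set Total}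
    (hV : IsOpen V) (hVΦ : V ⊆ Φ.source) {f : Total → ℝ} (hf : ContinuousOn f V)
    (h : ∀ q ∈ V, q.1.2.1 ≠ 0 → (Φ q).1.2.1 ≠ 0 → f q = 0) {p : Total} (hp : p ∈ V) : f p = 0 := by
  by_contra hne
  have h1 : IsOpen (V ∩ f ⁻¹' {0}ᶜ) := hf.isOpen_inter_preimage hV isOpen_compl_singleton
  obtain ⟨q, hq, h2, h3⟩ := exists_generic h1 (fun q hq => hVΦ hq.1) ⟨p, hp, hne⟩
  exact hq.2 (h q hq.1 h2 h3)

theorem IsPointTransformation.continuousOn_fderiv {Φ : OpenPartialHomeomorph Total Total}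
    (h : IsPointTransformation Φ) (n : Total) :
    ContinuousOn (fun q => fderiv ℝ Φ q n) Φ.source :=
  (h.1.continuousOn_fderiv_of_isOpen Φ.open_source (by simp)).clm_apply continuousOn_const

/-- The transformed independent variables, in infinitesimal form. -/
theorem IsPointSymmetry.base_relations {Φ : OpenPartialHomeomorph Total Total}
    (hΦ : IsPointSymmetry Φ) {p : Total} (hp : p ∈ Φ.source) :
    (∀ n, (fderiv ℝ Φ p n).1.1 = n.1.1) ∧
    (∀ n, (fderiv ℝ Φ p n).1.2.2 = n.1.2.2 * (fderiv ℝ Φ p ((0, 0, 1), 0)).1.2.2) ∧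
    (Φ p).1.2.1 = p.1.2.1 * (fderiv ℝ Φ p ((0, 0, 1), 0)).1.2.2 := by
  have gen : ∀ q ∈ Φ.source, q.1.2.1 ≠ 0 → (Φ q).1.2.1 ≠ 0 →
      (∀ n, (fderiv ℝ Φ q n).1.1 = n.1.1) ∧
      (∀ n, (fderiv ℝ Φ q n).1.2.2 = n.1.2.2 * (fderiv ℝ Φ q ((0, 0, 1), 0)).1.2.2) ∧
      (Φ q).1.2.1 = q.1.2.1 * (fderiv ℝ Φ q ((0, 0, 1), 0)).1.2.2 := by
    rintro ⟨⟨t, x, y⟩, u⟩ hq hx hX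
    obtain ⟨a1, a2, a3, a4⟩ := hΦ.fderiv_xu_eq_zero hq hx hX
    obtain ⟨b1, b2, b3, b4⟩ := hΦ.base_relations_of_generic hq hx hX
    refine ⟨?_, ?_, b4⟩
    · rintro ⟨⟨n₁, n₂, n₃⟩, n₄⟩
      rw [total_apply (fderiv ℝ Φ ((t, x, y), u))]
      simp [a1, a2, b1, b2]
    · rintro ⟨⟨n₁, n₂, n₃⟩, n₄⟩
      rw [total_apply (fderiv ℝ Φ ((t, x, y), u))]
      simp [a3, a4, b3]
  have c := hΦ.1.continuousOn_fderiv
  have cΦ : ContinuousOn Φ Φ.source := Φ.continuousOn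
  refine ⟨fun n => ?_, fun n => ?_, ?_⟩
  · rw [← sub_eq_zero]
    have cn := c n
    refine eq_zero_of_generic (Φ := Φ) (f := fun q => (fderiv ℝ Φ q n).1.1 - n.1.1) Φ.open_source
      subset_rfl (by fun_prop) (fun q h1 h2 h3 => ?_) hp
    rw [(gen q h1 h2 h3).1 n, sub_self]
  · rw [← sub_eq_zero]
    have cn := c n
    have cy := c ((0, 0, 1), 0)
    refine eq_zero_of_generic (Φ := Φ) (f := fun q => (fderiv ℝ Φ q n).1.2.2 -
      n.1.2.2 * (fderiv ℝ Φ q ((0, 0, 1), 0)).1.2.2) Φ.open_source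
      subset_rfl (by fun_prop) (fun q h1 h2 h3 => ?_) hp
    rw [(gen q h1 h2 h3).2.1 n, sub_self]
  · rw [← sub_eq_zero]
    have cy := c ((0, 0, 1), 0)
    refine eq_zero_of_generic (Φ := Φ) (f := fun q => (Φ q).1.2.1 -
      q.1.2.1 * (fderiv ℝ Φ q ((0, 0, 1), 0)).1.2.2) Φ.open_source
      subset_rfl (by fun_prop) (fun q h1 h2 h3 => ?_) hp
    rw [(gen q h1 h2 h3).2.2, sub_self]

theorem IsPointSymmetry.fderiv_y_ne_zero {Φ : OpenPartialHomeomorph Total Total}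
    (hΦ : IsPointSymmetry Φ) {p : Total} (hp : p ∈ Φ.source) :
    (fderiv ℝ Φ p ((0, 0, 1), 0)).1.2.2 ≠ 0 := by
  intro h0
  obtain ⟨n, hn⟩ := hΦ.1.fderiv_surjective hp ((0, 0, 1), 0)
  have := (hΦ.base_relations hp).2.1 n
  rw [hn, h0] at this
  simp at this

/-- Products carry the supremum metric, so balls are cubes. This allows varying each coordinate
independently of the others within one ball. -/
theorem mem_ball_total {t x y u t₀ x₀ y₀ u₀ r : ℝ} :
    (((t, x, y), u) : Total) ∈ Metric.ball ((t₀, x₀, y₀), u₀) r ↔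
      (|t - t₀| < r ∧ |x - x₀| < r ∧ |y - y₀| < r) ∧ |u - u₀| < r := by
  simp [Prod.dist_eq, Real.dist_eq]

theorem mem_ball_base {t x y t₀ x₀ y₀ r : ℝ} :
    ((t, x, y) : Base) ∈ Metric.ball (t₀, x₀, y₀) r ↔
      |t - t₀| < r ∧ |x - x₀| < r ∧ |y - y₀| < r := by
  simp [Prod.dist_eq, Real.dist_eq]

/-- Local form of the transformation of the independent variables, up to integrating an ordinary
differential equation for the function `η`. -/
theorem IsPointSymmetry.exists_base_form {Φ : OpenPartialHomeomorph Total Total}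
    (hΦ : IsPointSymmetry Φ) {t₀ x₀ y₀ u₀ r : ℝ} (hr : 0 < r)
    (hB : Metric.ball ((t₀, x₀, y₀), u₀) r ⊆ Φ.source) :
    ∃ (lam : ℝ) (η : ℝ → ℝ), (∀ s, |s - y₀| < r → ContDiffAt ℝ ∞ η s ∧ deriv η s ≠ 0) ∧
      ∀ q ∈ Metric.ball (((t₀, x₀, y₀), u₀) : Total) r,
        (Φ q).1 = (q.1.1 + lam, q.1.2.1 * deriv η q.1.2.2, η q.1.2.2) := by
  set B := Metric.ball (((t₀, x₀, y₀), u₀) : Total) r with hBdef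
  have hconv : Convex ℝ B := convex_ball _ _
  have hp₀ : ((t₀, x₀, y₀), u₀) ∈ B := Metric.mem_ball_self hr
  set PT : Total →L[ℝ] ℝ :=
    (ContinuousLinearMap.fst ℝ ℝ (ℝ × ℝ)).comp (ContinuousLinearMap.fst ℝ Base ℝ) with hPT
  set PY : Total →L[ℝ] ℝ := ((ContinuousLinearMap.snd ℝ ℝ ℝ).comp
    (ContinuousLinearMap.snd ℝ ℝ (ℝ × ℝ))).comp (ContinuousLinearMap.fst ℝ Base ℝ) with hPY
  have hd : ∀ q ∈ B, DifferentiableAt ℝ Φ q := fun q hq =>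
    differentiableAt_of_smooth (hΦ.1.contDiffAt (hB hq))
  have hTf : ∀ q ∈ B, HasFDerivAt (fun q => PT (Φ q) - PT q) (PT.comp (fderiv ℝ Φ q) - PT) q :=
    fun q hq => (PT.hasFDerivAt.comp q (hd q hq).hasFDerivAt).sub PT.hasFDerivAt
  have hYf : ∀ q ∈ B, HasFDerivAt (fun q => PY (Φ q)) (PY.comp (fderiv ℝ Φ q)) q :=
    fun q hq => PY.hasFDerivAt.comp q (hd q hq).hasFDerivAt
  have hT : ∀ q ∈ B, PT (Φ q) - PT q = PT (Φ ((t₀, x₀, y₀), u₀)) - PT ((t₀, x₀, y₀), u₀) := by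
    intro q hq
    refine eq_of_fderiv_apply_eq_zero (f := fun q => PT (Φ q) - PT q) hconv
      (fun q hq => (hTf q hq).differentiableAt) hp₀ hq fun z hz => ?_
    have hzB := hconv.segment_subset hp₀ hq hz
    rw [(hTf z hzB).fderiv]
    have := (hΦ.base_relations (hB hzB)).1 (q - ((t₀, x₀, y₀), u₀))
    simpa [hPT, sub_eq_zero] using this
  -- The differential of Y sees only the y-component, so on the cube Y is a function of y, and its
  -- restriction to the y-line through the centre already determines it.
  set η : ℝ → ℝ := fun s => PY (Φ ((t₀, x₀, s), u₀)) with hη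
  have hsB : ∀ s, |s - y₀| < r → ((t₀, x₀, s), u₀) ∈ B := fun s hs =>
    mem_ball_total.2 ⟨⟨by simpa using hr, by simpa using hr, hs⟩, by simpa using hr⟩
  have hY : ∀ q ∈ B, PY (Φ q) = η q.1.2.2 := by
    rintro ⟨⟨t, x, y⟩, u⟩ hq
    have hy := (mem_ball_total.1 hq).1.2.2
    refine eq_of_fderiv_apply_eq_zero (f := fun q => PY (Φ q)) hconv
      (fun q hq => (hYf q hq).differentiableAt) (hsB y hy) hq fun z hz => ?_
    have hzB := hconv.segment_subset (hsB y hy) hq hz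
    rw [(hYf z hzB).fderiv]
    have := (hΦ.base_relations (hB hzB)).2.1 (((t, x, y), u) - ((t₀, x₀, y), u₀))
    simpa [hPY] using this
  have hηd : ∀ t x y u, ((t, x, y), u) ∈ B →
      HasDerivAt η (fderiv ℝ Φ ((t, x, y), u) ((0, 0, 1), 0)).1.2.2 y := by
    intro t x y u hq
    have h1 := PY.hasFDerivAt.comp_hasDerivAt y (hasDerivAt_line (hd _ hq) ((0, 0, 1), 0) y)
    refine h1.congr_of_eventuallyEq ?_
    have hc : ContinuousAt (fun s : ℝ => (((t, x, s), u) : Total)) y := by fun_prop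
    filter_upwards [hc.preimage_mem_nhds (Metric.isOpen_ball.mem_nhds hq)] with s hs
    rw [← hY _ hs]
    simp
  refine ⟨PT (Φ ((t₀, x₀, y₀), u₀)) - PT ((t₀, x₀, y₀), u₀), η, fun s hs => ⟨?_, ?_⟩, ?_⟩
  · have h1 := hΦ.1.contDiffAt (hB (hsB s hs))
    have h2 : ContDiffAt ℝ ∞ (fun s : ℝ => (((t₀, x₀, s), u₀) : Total)) s := by fun_prop
    exact PY.contDiff.contDiffAt.comp s (ContDiffAt.comp s h1 h2)
  · rw [(hηd _ _ _ _ (hsB s hs)).deriv]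
    exact hΦ.fderiv_y_ne_zero (hB (hsB s hs))
  · rintro ⟨⟨t, x, y⟩, u⟩ hq
    refine Prod.ext ?_ (Prod.ext ?_ ?_)
    · have := hT _ hq
      simp only [hPT] at this ⊢
      simp at this ⊢
      linarith
    · simp only
      rw [(hηd _ _ _ _ hq).deriv]
      exact (hΦ.base_relations (hB hq)).2.2
    · exact hY _ hq

/-! ### Determining equations for the transformed dependent variable. -/

theorem deriv_smooth {η : ℝ → ℝ} {s : ℝ} (h : ContDiffAt ℝ ∞ η s) : ContDiffAt ℝ ∞ (deriv η) s := by
  have h1 : ContDiffAt ℝ ∞ (fderiv ℝ η) s := h.fderiv_right (by simp)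
  exact h1.clm_apply contDiffAt_const

/-- Test solutions with arbitrary value and x-slope that, unlike the logarithmic ones, are also
defined at x = 0. -/
theorem isSolutionOn_affine (u b x : ℝ) :
    IsSolutionOn (fun z : Base => u + b * (z.2.1 - x)) Set.univ := by
  refine ⟨isOpen_univ, ?_, fun t x' y _ => ?_⟩
  · apply ContDiff.contDiffOn; fun_prop
  · have hd : deriv (fun s : ℝ => u + b * (s - x)) = fun _ => b := by
      ext s
      have : HasDerivAt (fun s : ℝ => u + b * (s - x)) (b * 1) s :=
        (((hasDerivAt_id' s).sub_const x).const_mul b).const_add u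
      rw [this.deriv, mul_one]
    simp [EquationAt, iteratedDeriv_succ, hd]

section LocalForm

variable {Φ : OpenPartialHomeomorph Total Total} {t₀ x₀ y₀ u₀ r lam : ℝ} {η : ℝ → ℝ}

/-- The image of a solution that is locally of the form `u + b (x' - x)`. -/
theorem IsPointSymmetry.exists_image_affine (hΦ : IsPointSymmetry Φ)
    (hB : Metric.ball ((t₀, x₀, y₀), u₀) r ⊆ Φ.source)
    (hη : ∀ s, |s - y₀| < r → ContDiffAt ℝ ∞ η s ∧ deriv η s ≠ 0)
    (hform : ∀ q ∈ Metric.ball (((t₀, x₀, y₀), u₀) : Total) r,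
      (Φ q).1 = (q.1.1 + lam, q.1.2.1 * deriv η q.1.2.2, η q.1.2.2))
    {t x y u : ℝ} (hq : ((t, x, y), u) ∈ Metric.ball (((t₀, x₀, y₀), u₀) : Total) r) (b : ℝ) :
    ∃ w : Base → ℝ, ContDiffAt ℝ ∞ w (t + lam, x * deriv η y, η y) ∧
      EquationAt w (t + lam) (x * deriv η y) (η y) ∧
      ∀ᶠ z : Base in 𝓝 (t, x, y), w (z.1 + lam, z.2.1 * deriv η z.2.2, η z.2.2) =
        (Φ (z, u + b * (z.2.1 - x))).2 := by
  have hv := isSolutionOn_affine u b x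
  set v := fun z : Base => u + b * (z.2.1 - x) with hvdef
  have hv0 : v (t, x, y) = u := by simp [hvdef]
  have hy := (mem_ball_total.1 hq).1.2.2
  have hin := hΦ.exists_image (z₀ := (t, x, y)) hv (Set.mem_univ _) (by rw [hv0]; exact hB hq) (by
    rw [hv0]
    intro n hn
    obtain ⟨b1, b2, -⟩ := hΦ.base_relations (hB hq)
    have n1 : n.1 = 0 := by
      have := b1 (n, fderiv ℝ v (t, x, y) n)
      rw [hn] at this; exact this.symm
    have n3 : n.2.2 = 0 := by
      have := b2 (n, fderiv ℝ v (t, x, y) n)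
      rw [hn] at this
      exact (mul_eq_zero.1 this.symm).resolve_right (hΦ.fderiv_y_ne_zero (hB hq))
    set m := fderiv ℝ v (t, x, y) n
    -- Transversality holds for every gradient: along a vector without y-component, X = x η'(y)
    -- grows at the rate n₂ η'(y), and η' ≠ 0.
    have hd := hasDerivAt_line (differentiableAt_of_smooth (hΦ.1.contDiffAt (hB hq))) (n, m) 0
    have h1 := (((ContinuousLinearMap.fst ℝ ℝ ℝ).comp (ContinuousLinearMap.snd ℝ ℝ (ℝ × ℝ))).comp
        (ContinuousLinearMap.fst ℝ Base ℝ)).hasFDerivAt.comp_hasDerivAt 0 hd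
    have h2 : HasDerivAt (fun s : ℝ => (x + s * n.2.1) * deriv η y) (1 * n.2.1 * deriv η y) 0 :=
      (((hasDerivAt_id' (0 : ℝ)).mul_const n.2.1).const_add x).mul_const (deriv η y)
    have h3 := h1.unique (h2.congr_of_eventuallyEq (by
      have hc : ContinuousAt (fun s : ℝ => ((((t, x, y), u) : Total) + (s - 0) • (n, m))) 0 := by
        fun_prop
      filter_upwards [hc.preimage_mem_nhds (Metric.isOpen_ball.mem_nhds (by simpa using hq))]
        with s hs
      have := hform _ hs
      simp only [Function.comp, ContinuousLinearMap.comp_apply, ContinuousLinearMap.coe_fst',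
        ContinuousLinearMap.coe_snd']
      rw [this]
      simp [n3]))
    have h4 : n.2.1 * deriv η y = 0 := by
      simp only [ContinuousLinearMap.comp_apply, ContinuousLinearMap.coe_fst',
        ContinuousLinearMap.coe_snd', hn] at h3
      simpa using h3.symm
    have n2 := (mul_eq_zero.1 h4).resolve_right (hη y hy).2
    exact Prod.ext n1 (Prod.ext n2 n3))
  rw [hv0, hform _ hq] at hin
  obtain ⟨w, h1, h2, h3⟩ := hin
  refine ⟨w, h1, h2, ?_⟩
  have hc : ContinuousAt (fun z : Base => (z, v z)) (t, x, y) := by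
    simp only [hvdef]; fun_prop
  filter_upwards [h3, hc.preimage_mem_nhds (Metric.isOpen_ball.mem_nhds (by rw [hv0]; exact hq))]
    with z hz hz'
  rw [← hz, hform _ hz']

/-- The determining equations for the transformed dependent variable. -/
theorem IsPointSymmetry.determining_u (hΦ : IsPointSymmetry Φ)
    (hB : Metric.ball ((t₀, x₀, y₀), u₀) r ⊆ Φ.source)
    (hη : ∀ s, |s - y₀| < r → ContDiffAt ℝ ∞ η s ∧ deriv η s ≠ 0)
    (hform : ∀ q ∈ Metric.ball (((t₀, x₀, y₀), u₀) : Total) r,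
      (Φ q).1 = (q.1.1 + lam, q.1.2.1 * deriv η q.1.2.2, η q.1.2.2))
    {t x y u : ℝ} (hq : ((t, x, y), u) ∈ Metric.ball (((t₀, x₀, y₀), u₀) : Total) r) (b : ℝ) :
    deriv (fun s => (Φ ((s, x, y), u)).2) t + x * deriv (fun s => (Φ ((t, x, s), u)).2) y -
        deriv (deriv η) y / deriv η y * x ^ 2 *
          deriv (fun s => (Φ ((t, s, y), u + b * (s - x))).2) x =
      x ^ 2 * iteratedDeriv 2 (fun s => (Φ ((t, s, y), u + b * (s - x))).2) x := by
  obtain ⟨w, h1, h2, h3⟩ := hΦ.exists_image_affine hB hη hform hq b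
  have hy := hη y (mem_ball_total.1 hq).1.2.2
  have := (equationAt_iff_pullback (differentiableAt_of_smooth hy.1).hasDerivAt
    (differentiableAt_of_smooth (deriv_smooth hy.1)).hasDerivAt hy.2 h1 h3).1 h2
  simpa using this

/-- The transformed dependent variable is affine in `u`. -/
theorem IsPointSymmetry.exists_affine (hΦ : IsPointSymmetry Φ) (hr : 0 < r)
    (hB : Metric.ball ((t₀, x₀, y₀), u₀) r ⊆ Φ.source)
    (hη : ∀ s, |s - y₀| < r → ContDiffAt ℝ ∞ η s ∧ deriv η s ≠ 0)
    (hform : ∀ q ∈ Metric.ball (((t₀, x₀, y₀), u₀) : Total) r,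
      (Φ q).1 = (q.1.1 + lam, q.1.2.1 * deriv η q.1.2.2, η q.1.2.2)) :
    ∃ W V : Base → ℝ, (∀ z ∈ Metric.ball (t₀, x₀, y₀) r, ContDiffAt ℝ ∞ W z ∧
      ContDiffAt ℝ ∞ V z ∧ W z ≠ 0) ∧
      ∀ q ∈ Metric.ball (((t₀, x₀, y₀), u₀) : Total) r, (Φ q).2 = W q.1 * q.2 + V q.1 := by
  set B := Metric.ball (((t₀, x₀, y₀), u₀) : Total) r with hBdef
  have hconv : Convex ℝ B := convex_ball _ _
  have hBo : IsOpen B := Metric.isOpen_ball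
  set U : Total → ℝ := fun q => (Φ q).2 with hU
  have sU : ∀ q ∈ B, ContDiffAt ℝ ∞ U q := fun q hq => (hΦ.1.contDiffAt (hB hq)).snd
  have sU' : ∀ q ∈ B, ContDiffAt ℝ ∞ (fun q => fderiv ℝ U q (0, 1)) q := fun q hq =>
    ((sU q hq).fderiv_right (by simp)).clm_apply contDiffAt_const
  have sU'' : ContDiffOn ℝ ∞ (fun q => fderiv ℝ (fderiv ℝ U) q (0, 1) (0, 1)) B := fun q hq =>
    (((((sU q hq).fderiv_right (m := ∞) (by simp)).fderiv_right (m := ∞) (by simp)).clm_apply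
      contDiffAt_const).clm_apply contDiffAt_const).contDiffWithinAt
  have Uuu : ∀ q ∈ B, fderiv ℝ (fderiv ℝ U) q (0, 1) (0, 1) = 0 := by
    intro q hq
    refine eq_zero_of_generic (Φ := Φ) hBo hB sU''.continuousOn ?_ hq
    rintro ⟨⟨t, x, y⟩, u⟩ hq hx -
    have main : ∀ b : ℝ, fderiv ℝ U ((t, x, y), u) ((1, 0, 0), 0) +
        x * fderiv ℝ U ((t, x, y), u) ((0, 0, 1), 0) - deriv (deriv η) y / deriv η y * x ^ 2 *
          fderiv ℝ U ((t, x, y), u) ((0, 1, 0), b) =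
        x ^ 2 * fderiv ℝ (fderiv ℝ U) ((t, x, y), u) ((0, 1, 0), b) ((0, 1, 0), b) := by
      intro b
      have h := hΦ.determining_u hB hη hform hq b
      have hd := differentiableAt_of_smooth (sU _ hq)
      have e1 := (hasDerivAt_line hd ((1, 0, 0), 0) t).deriv
      have e2 := (hasDerivAt_line hd ((0, 0, 1), 0) y).deriv
      have e3 := (hasDerivAt_line hd ((0, 1, 0), b) x).deriv
      have e4 := iteratedDeriv_two_line (contDiffAt_two_of_smooth (sU _ hq)) ((0, 1, 0), b) x
      simp [hU, mul_comm _ b] at e1 e2 e3 e4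
      rw [← e1, ← e2, ← e3, ← e4]
      exact h
    have split : ∀ b : ℝ, (((0, 1, 0), b) : Total) = ((0, 1, 0), 0) + b • (0, 1) := fun b => by simp
    -- The left side of `main` is affine in b, and the right side is quadratic with the leading
    -- coefficient x² U_uu, which the second difference isolates.
    have m0 := main 0
    have m1 := main 1
    have m2 := main (-1)
    rw [split 1] at m1
    rw [split (-1)] at m2
    simp only [map_add, map_smul, add_apply, smul_apply, smul_eq_mul] at m1 m2
    have h3 : x ^ 2 * (2 * fderiv ℝ (fderiv ℝ U) ((t, x, y), u) (0, 1) (0, 1)) = 0 := by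
      linear_combination 2 * m0 - m1 - m2
    simpa [hx] using h3
  have hzB : ∀ z ∈ Metric.ball (t₀, x₀, y₀) r, (z, u₀) ∈ B := by
    rintro ⟨t, x, y⟩ hz
    exact mem_ball_total.2 ⟨mem_ball_base.1 hz, by simpa using hr⟩
  have hBz : ∀ q ∈ B, q.1 ∈ Metric.ball (t₀, x₀, y₀) r := by
    rintro ⟨⟨t, x, y⟩, u⟩ hq
    exact mem_ball_base.2 (mem_ball_total.1 hq).1
  set W : Base → ℝ := fun z => fderiv ℝ U (z, u₀) (0, 1) with hW
  have hUu : ∀ q ∈ B, fderiv ℝ U q (0, 1) = W q.1 := by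
    rintro ⟨z, u⟩ hq
    have hz := hzB z (hBz _ hq)
    refine eq_of_fderiv_apply_eq_zero (f := fun q => fderiv ℝ U q (0, 1)) hconv
      (fun q hq => differentiableAt_of_smooth (sU' q hq)) hz hq fun q' hq' => ?_
    have hq'B := hconv.segment_subset hz hq hq'
    have e : ((z, u) - (z, u₀) : Total) = (u - u₀) • (0, 1) := by simp
    have hdd : DifferentiableAt ℝ (fderiv ℝ U) q' :=
      ((contDiffAt_two_of_smooth (sU q' hq'B)).fderiv_right (m := 1)
        (by norm_num)).differentiableAt (by simp)
    have h2 := hdd.hasFDerivAt.clm_apply (hasFDerivAt_const ((0, 1) : Total) q')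
    rw [h2.fderiv, e, map_smul]
    simp [Uuu q' hq'B]
  have haff : ∀ q ∈ B, U q = W q.1 * q.2 + (U (q.1, u₀) - W q.1 * u₀) := by
    rintro ⟨z, u⟩ hq
    have hz := hzB z (hBz _ hq)
    set c := W z with hc
    have hdf : ∀ q ∈ B, HasFDerivAt (fun q => U q - c * q.2)
        (fderiv ℝ U q - c • ContinuousLinearMap.snd ℝ Base ℝ) q := fun q hq =>
      (differentiableAt_of_smooth (sU q hq)).hasFDerivAt.sub
        ((ContinuousLinearMap.snd ℝ Base ℝ).hasFDerivAt.const_mul c)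
    have := eq_of_fderiv_apply_eq_zero (f := fun q => U q - c * q.2) hconv
      (fun q hq => (hdf q hq).differentiableAt) hz hq fun q' hq' => ?_
    · simp only at this ⊢
      linarith
    · have hq'B := hconv.segment_subset hz hq hq'
      have e : ((z, u) - (z, u₀) : Total) = (u - u₀) • (0, 1) := by simp
      have hq1 : q'.1 = z := by
        obtain ⟨a, b, ha, hb, hab, rfl⟩ := hq'
        simp only [Prod.fst_add, Prod.smul_fst]
        rw [← add_smul, hab, one_smul]
      rw [(hdf q' hq'B).fderiv, e, map_smul]
      simp only [sub_apply, smul_apply, ContinuousLinearMap.coe_snd', smul_eq_mul]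
      rw [hUu q' hq'B, hq1]
      ring
  refine ⟨W, fun z => U (z, u₀) - W z * u₀, fun z hz => ?_, haff⟩
  have hzc : ContDiffAt ℝ ∞ (fun z : Base => (z, u₀)) z := by fun_prop
  have sW : ContDiffAt ℝ ∞ W z :=
    ContDiffAt.comp (g := fun q => fderiv ℝ U q (0, 1)) z (sU' _ (hzB z hz)) hzc
  refine ⟨sW, ?_, ?_⟩
  · exact (ContDiffAt.comp (g := U) z (sU _ (hzB z hz)) hzc).sub (sW.mul contDiffAt_const)
  -- If W vanished, DΦ would annihilate ∂_u.
  · intro h0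
    have hs := hB (hzB z hz)
    have hinj := hΦ.1.fderiv_injective hs
    obtain ⟨b1, b2, -⟩ := hΦ.base_relations hs
    have hd := differentiableAt_of_smooth (hΦ.1.contDiffAt hs)
    have hX : (fderiv ℝ Φ (z, u₀) (0, 1)).1.2.1 = 0 := by
      have h1 := (((ContinuousLinearMap.fst ℝ ℝ ℝ).comp
        (ContinuousLinearMap.snd ℝ ℝ (ℝ × ℝ))).comp
          (ContinuousLinearMap.fst ℝ Base ℝ)).hasFDerivAt.comp_hasDerivAt 0
            (hasDerivAt_line hd (0, 1) 0)
      refine h1.unique ((hasDerivAt_const 0 (z.2.1 * deriv η z.2.2)).congr_of_eventuallyEq ?_)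
      have hc : ContinuousAt (fun s : ℝ => (((z, u₀) : Total) + (s - 0) • (0, 1))) 0 := by
        fun_prop
      filter_upwards [hc.preimage_mem_nhds (hBo.mem_nhds (by simpa using hzB z hz))]
        with s hs
      have := hform _ hs
      simp only [Function.comp, ContinuousLinearMap.comp_apply, ContinuousLinearMap.coe_fst',
        ContinuousLinearMap.coe_snd']
      rw [this]
      simp
    have hU0 : (fderiv ℝ Φ (z, u₀) (0, 1)).2 = 0 := by
      have h1 : HasFDerivAt U ((ContinuousLinearMap.snd ℝ Base ℝ).comp (fderiv ℝ Φ (z, u₀)))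
          (z, u₀) := (ContinuousLinearMap.snd ℝ Base ℝ).hasFDerivAt.comp _ hd.hasFDerivAt
      have h2 : W z = _ := congrArg (fun L : Total →L[ℝ] ℝ => L (0, 1)) h1.fderiv
      rw [h0] at h2
      simpa using h2.symm
    have h3 : fderiv ℝ Φ (z, u₀) (0, 1) = fderiv ℝ Φ (z, u₀) 0 := by
      rw [map_zero]
      refine Prod.ext (Prod.ext ?_ (Prod.ext hX ?_)) hU0
      · rw [b1]; rfl
      · rw [b2]; simp
    have h4 := hinj h3
    simp [Prod.ext_iff] at h4

end LocalForm

section LocalForm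

variable {Φ : OpenPartialHomeomorph Total Total} {t₀ x₀ y₀ u₀ r lam : ℝ} {η : ℝ → ℝ}

/-- The determining equations for the factor at `u`. -/
theorem IsPointSymmetry.determining_factor (hΦ : IsPointSymmetry Φ) (hr : 0 < r)
    (hB : Metric.ball ((t₀, x₀, y₀), u₀) r ⊆ Φ.source)
    (hη : ∀ s, |s - y₀| < r → ContDiffAt ℝ ∞ η s ∧ deriv η s ≠ 0)
    (hform : ∀ q ∈ Metric.ball (((t₀, x₀, y₀), u₀) : Total) r,
      (Φ q).1 = (q.1.1 + lam, q.1.2.1 * deriv η q.1.2.2, η q.1.2.2))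
    {W V : Base → ℝ} (hWV : ∀ z ∈ Metric.ball (t₀, x₀, y₀) r, ContDiffAt ℝ ∞ W z ∧
      ContDiffAt ℝ ∞ V z ∧ W z ≠ 0)
    (hU : ∀ q ∈ Metric.ball (((t₀, x₀, y₀), u₀) : Total) r, (Φ q).2 = W q.1 * q.2 + V q.1)
    {t x y : ℝ} (hz : (t, x, y) ∈ Metric.ball (t₀, x₀, y₀) r) :
    x ^ 2 * (2 * fderiv ℝ W (t, x, y) (0, 1, 0) +
      deriv (deriv η) y / deriv η y * W (t, x, y)) = 0 ∧
    fderiv ℝ W (t, x, y) (1, 0, 0) + x * fderiv ℝ W (t, x, y) (0, 0, 1) -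
      deriv (deriv η) y / deriv η y * x ^ 2 * fderiv ℝ W (t, x, y) (0, 1, 0) =
        x ^ 2 * fderiv ℝ (fderiv ℝ W) (t, x, y) (0, 1, 0) (0, 1, 0) := by
  obtain ⟨sW, sV, -⟩ := hWV _ hz
  have dW := differentiableAt_of_smooth sW
  have dV := differentiableAt_of_smooth sV
  set κ := deriv (deriv η) y / deriv η y
  have main : ∀ u b : ℝ, |u - u₀| < r →
      (fderiv ℝ W (t, x, y) (1, 0, 0) * u + fderiv ℝ V (t, x, y) (1, 0, 0)) +
      x * (fderiv ℝ W (t, x, y) (0, 0, 1) * u + fderiv ℝ V (t, x, y) (0, 0, 1)) -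
      κ * x ^ 2 * (fderiv ℝ W (t, x, y) (0, 1, 0) * u + W (t, x, y) * b +
        fderiv ℝ V (t, x, y) (0, 1, 0)) =
      x ^ 2 * (fderiv ℝ (fderiv ℝ W) (t, x, y) (0, 1, 0) (0, 1, 0) * u +
        2 * b * fderiv ℝ W (t, x, y) (0, 1, 0) +
        fderiv ℝ (fderiv ℝ V) (t, x, y) (0, 1, 0) (0, 1, 0)) := by
    intro u b hu
    have hq : ((t, x, y), u) ∈ Metric.ball (((t₀, x₀, y₀), u₀) : Total) r :=
      mem_ball_total.2 ⟨mem_ball_base.1 hz, hu⟩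
    have h := hΦ.determining_u hB hη hform hq b
    have hn := Metric.isOpen_ball.mem_nhds hq
    have e1 : (fun s => (Φ ((s, x, y), u)).2) =ᶠ[𝓝 t] fun s => W (s, x, y) * u + V (s, x, y) := by
      have hc : ContinuousAt (fun s : ℝ => (((s, x, y), u) : Total)) t := by fun_prop
      filter_upwards [hc.preimage_mem_nhds hn] with s hs using hU _ hs
    have e2 : (fun s => (Φ ((t, x, s), u)).2) =ᶠ[𝓝 y] fun s => W (t, x, s) * u + V (t, x, s) := by
      have hc : ContinuousAt (fun s : ℝ => (((t, x, s), u) : Total)) y := by fun_prop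
      filter_upwards [hc.preimage_mem_nhds hn] with s hs using hU _ hs
    have e3 : (fun s => (Φ ((t, s, y), u + b * (s - x))).2) =ᶠ[𝓝 x]
        fun s => W (t, s, y) * (u + b * (s - x)) + V (t, s, y) := by
      have hc : ContinuousAt (fun s : ℝ => (((t, s, y), u + b * (s - x)) : Total)) x := by fun_prop
      filter_upwards [hc.preimage_mem_nhds (by simpa using hn)] with s hs using hU _ hs
    have hlin : ∀ s : ℝ, HasDerivAt (fun s : ℝ => u + b * (s - x)) b s := fun s => by
      simpa using ((((hasDerivAt_id' s).sub_const x).const_mul b).const_add u)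
    have hdx : deriv (fun s => W (t, s, y) * (u + b * (s - x)) + V (t, s, y)) =ᶠ[𝓝 x] fun s =>
        deriv (fun s => W (t, s, y)) s * (u + b * (s - x)) + W (t, s, y) * b +
          deriv (fun s => V (t, s, y)) s := by
      have hc : ContinuousAt (fun s : ℝ => ((t, s, y) : Base)) x := by fun_prop
      filter_upwards [hc.preimage_mem_nhds (Metric.isOpen_ball.mem_nhds hz)] with s hs
      have a1 := hasDerivAt_slice_x (differentiableAt_of_smooth (hWV _ hs).1)
      have a2 := hasDerivAt_slice_x (differentiableAt_of_smooth (hWV _ hs).2.1)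
      rw [a1.deriv, a2.deriv]
      exact ((a1.mul (hlin s)).add a2).deriv
    have d1 : deriv (fun s => W (s, x, y) * u + V (s, x, y)) t =
        fderiv ℝ W (t, x, y) (1, 0, 0) * u + fderiv ℝ V (t, x, y) (1, 0, 0) :=
      (((hasDerivAt_slice_t dW).mul_const u).add (hasDerivAt_slice_t dV)).deriv
    have d2 : deriv (fun s => W (t, x, s) * u + V (t, x, s)) y =
        fderiv ℝ W (t, x, y) (0, 0, 1) * u + fderiv ℝ V (t, x, y) (0, 0, 1) :=
      (((hasDerivAt_slice_y dW).mul_const u).add (hasDerivAt_slice_y dV)).deriv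
    have a3 := hasDerivAt_deriv_slice_x (contDiffAt_two_of_smooth sW)
    have a4 := hasDerivAt_deriv_slice_x (contDiffAt_two_of_smooth sV)
    have d4 := (((a3.mul (hlin x)).add ((hasDerivAt_slice_x dW).mul_const b)).add a4).deriv
    have d4' := hdx.deriv_eq.trans d4
    rw [e1.deriv_eq, e2.deriv_eq, e3.deriv_eq, e3.iteratedDeriv_eq 2, d1, d2, hdx.self_of_nhds,
      iteratedDeriv_succ, iteratedDeriv_one, d4'] at h
    simp only [sub_self, mul_zero, add_zero, (hasDerivAt_slice_x dW).deriv,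
      (hasDerivAt_slice_x dV).deriv] at h
    linear_combination h
  -- `main` is affine in b, and for b = 0 affine in u. The two differences extract the coefficients
  -- of b and of u.
  have m00 := main u₀ 0 (by simpa using hr)
  have m01 := main u₀ 1 (by simpa using hr)
  have m10 := main (u₀ + r / 2) 0 (by
    rw [add_sub_cancel_left, abs_of_pos (by linarith)]; linarith)
  constructor
  · linear_combination m00 - m01
  · have hr2 : r / 2 ≠ 0 := by positivity
    apply mul_right_cancel₀ hr2
    linear_combination m10 - m00

/-- The factor at `u` is `σ exp(h(y) x)`, where `h = -η'' / (2 η')` satisfies `h' = -h²`. -/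
theorem IsPointSymmetry.exists_factor (hΦ : IsPointSymmetry Φ) (hr : 0 < r)
    (hB : Metric.ball ((t₀, x₀, y₀), u₀) r ⊆ Φ.source)
    (hη : ∀ s, |s - y₀| < r → ContDiffAt ℝ ∞ η s ∧ deriv η s ≠ 0)
    (hform : ∀ q ∈ Metric.ball (((t₀, x₀, y₀), u₀) : Total) r,
      (Φ q).1 = (q.1.1 + lam, q.1.2.1 * deriv η q.1.2.2, η q.1.2.2))
    {W V : Base → ℝ} (hWV : ∀ z ∈ Metric.ball (t₀, x₀, y₀) r, ContDiffAt ℝ ∞ W z ∧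
      ContDiffAt ℝ ∞ V z ∧ W z ≠ 0)
    (hU : ∀ q ∈ Metric.ball (((t₀, x₀, y₀), u₀) : Total) r, (Φ q).2 = W q.1 * q.2 + V q.1)
    {h : ℝ → ℝ} (hh : ∀ s, h s = -(deriv (deriv η) s / deriv η s) / 2) :
    (∀ s, |s - y₀| < r → HasDerivAt h (-(h s) ^ 2) s) ∧
      ∃ σ : ℝ, σ ≠ 0 ∧ ∀ z ∈ Metric.ball (t₀, x₀, y₀) r, W z = σ * Real.exp (h z.2.2 * z.2.1) := by
  set B₀ : Set Base := Metric.ball (t₀, x₀, y₀) r with hB₀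
  have hconv : Convex ℝ B₀ := convex_ball _ _
  have sh : ∀ s, |s - y₀| < r → ContDiffAt ℝ ∞ h s := fun s hs => by
    have e : h = fun s => -(deriv (deriv η) s / deriv η s) / 2 := funext hh
    have h1 := deriv_smooth (hη s hs).1
    have h2 := deriv_smooth h1
    rw [e]
    exact ((h2.div h1 (hη s hs).2).neg).div_const 2
  have hyB : ∀ z ∈ B₀, |z.2.2 - y₀| < r := by
    rintro ⟨t, x, y⟩ hz
    exact (mem_ball_base.1 hz).2.2
  have Wx : ∀ z ∈ B₀, fderiv ℝ W z (0, 1, 0) = h z.2.2 * W z := by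
    intro z hz
    have hmem : (z, u₀) ∈ Metric.ball (((t₀, x₀, y₀), u₀) : Total) r := by
      obtain ⟨t, x, y⟩ := z
      exact mem_ball_total.2 ⟨mem_ball_base.1 hz, by simpa using hr⟩
    have hBz : ∀ q ∈ Metric.ball (((t₀, x₀, y₀), u₀) : Total) r, q.1 ∈ B₀ := by
      rintro ⟨⟨t, x, y⟩, u⟩ hq
      exact mem_ball_base.2 (mem_ball_total.1 hq).1
    rw [← sub_eq_zero]
    refine eq_zero_of_generic (Φ := Φ) (f := fun q => fderiv ℝ W q.1 (0, 1, 0) - h q.1.2.2 * W q.1)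
      Metric.isOpen_ball hB ?_ ?_ hmem
    · intro q hq
      apply ContinuousAt.continuousWithinAt
      have c1 : ContinuousAt (fun z => fderiv ℝ W z (0, 1, 0)) q.1 :=
        (((hWV _ (hBz q hq)).1.fderiv_right (m := ∞) (by simp)).clm_apply
          contDiffAt_const).continuousAt
      have c2 : ContinuousAt (fun z : Base => h z.2.2) q.1 :=
        ContinuousAt.comp (g := h) (sh _ (hyB _ (hBz q hq))).continuousAt (by fun_prop)
      have c3 := (hWV _ (hBz q hq)).1.continuousAt
      exact ContinuousAt.comp (f := Prod.fst) (c1.sub (c2.mul c3)) continuousAt_fst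
    · rintro ⟨⟨t, x, y⟩, u⟩ hq hx -
      have h1 := (hΦ.determining_factor hr hB hη hform hWV hU (hBz _ hq)).1
      have h2 := (mul_eq_zero.1 h1).resolve_left (pow_ne_zero 2 hx)
      simp only
      rw [hh]
      linear_combination h2 / 2
  have Wrel : ∀ t x y, (t, x, y) ∈ B₀ → fderiv ℝ W (t, x, y) (1, 0, 0) +
      x * fderiv ℝ W (t, x, y) (0, 0, 1) + x ^ 2 * h y ^ 2 * W (t, x, y) = 0 := by
    intro t x y hz
    have h1 := (hΦ.determining_factor hr hB hη hform hWV hU hz).2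
    have sW := (hWV _ hz).1
    have h2 := hasDerivAt_deriv_slice_x (contDiffAt_two_of_smooth sW)
    have hev : deriv (fun s => W (t, s, y)) =ᶠ[𝓝 x] fun s => h y * W (t, s, y) := by
      have hc : ContinuousAt (fun s : ℝ => ((t, s, y) : Base)) x := by fun_prop
      filter_upwards [hc.preimage_mem_nhds (Metric.isOpen_ball.mem_nhds hz)] with s hs
      rw [(hasDerivAt_slice_x (differentiableAt_of_smooth (hWV _ hs).1)).deriv, Wx _ hs]
    have h3 := h2.unique (((hasDerivAt_slice_x (differentiableAt_of_smooth sW)).const_mul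
      (h y)).congr_of_eventuallyEq hev)
    have h4 : deriv (deriv η) y / deriv η y = -2 * h y := by rw [hh]; ring
    have h5 := Wx _ hz
    simp only at h5
    rw [h3, h4, h5] at h1
    linear_combination h1
  -- W_x = hW makes E independent of x. It remains to show that E is constant.
  set E : Base → ℝ := fun z => W z * Real.exp (-(h z.2.2 * z.2.1)) with hE
  have hE0 : ∀ z ∈ B₀, E z ≠ 0 := fun z hz => mul_ne_zero (hWV z hz).2.2 (Real.exp_ne_zero _)
  have dE : ∀ z ∈ B₀, DifferentiableAt ℝ E z := fun z hz => by
    have c1 := differentiableAt_of_smooth (hWV z hz).1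
    have c2 : DifferentiableAt ℝ (fun z : Base => h z.2.2) z :=
      DifferentiableAt.comp (g := h) z (differentiableAt_of_smooth (sh _ (hyB z hz)))
        (by fun_prop)
    exact c1.mul ((c2.mul (by fun_prop : DifferentiableAt ℝ (fun z : Base => z.2.1) z)).neg.exp)
  have Ex : ∀ t x y, (t, x, y) ∈ B₀ → fderiv ℝ E (t, x, y) (0, 1, 0) = 0 := by
    intro t x y hz
    have h1 := hasDerivAt_slice_x (dE _ hz)
    have h2 := hasDerivAt_slice_x (differentiableAt_of_smooth (hWV _ hz).1)
    have h3 := (((hasDerivAt_id' x).const_mul (h y)).neg.exp)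
    rw [h1.unique (h2.mul h3), Wx _ hz]
    simp only [Pi.neg_apply]
    ring
  have Et : ∀ t x y, (t, x, y) ∈ B₀ → fderiv ℝ E (t, x, y) (1, 0, 0) =
      fderiv ℝ W (t, x, y) (1, 0, 0) * Real.exp (-(h y * x)) := by
    intro t x y hz
    have h1 := hasDerivAt_slice_t (dE _ hz)
    have h2 := hasDerivAt_slice_t (differentiableAt_of_smooth (hWV _ hz).1)
    exact h1.unique (h2.mul_const (Real.exp (-(h y * x))))
  have Ey : ∀ t x y, (t, x, y) ∈ B₀ → fderiv ℝ E (t, x, y) (0, 0, 1) =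
      (fderiv ℝ W (t, x, y) (0, 0, 1) - deriv h y * x * W (t, x, y)) *
        Real.exp (-(h y * x)) := by
    intro t x y hz
    have h1 := hasDerivAt_slice_y (dE _ hz)
    have h2 := hasDerivAt_slice_y (differentiableAt_of_smooth (hWV _ hz).1)
    have h3 := ((differentiableAt_of_smooth (sh y (hyB _ hz))).hasDerivAt.mul_const x).neg.exp
    rw [h1.unique (h2.mul h3)]
    simp only [Pi.neg_apply]
    ring
  have Erel : ∀ t x y, (t, x, y) ∈ B₀ → fderiv ℝ E (t, x, y) (1, 0, 0) +
      x * fderiv ℝ E (t, x, y) (0, 0, 1) + x ^ 2 * (deriv h y + h y ^ 2) * E (t, x, y) = 0 := by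
    intro t x y hz
    rw [Et t x y hz, Ey t x y hz]
    simp only [hE]
    linear_combination Real.exp (-(h y * x)) * Wrel t x y hz
  have Econst : ∀ t x x' y, (t, x, y) ∈ B₀ → (t, x', y) ∈ B₀ → E (t, x, y) = E (t, x', y) := by
    intro t x x' y hz hz'
    refine eq_of_fderiv_apply_eq_zero hconv dE hz' hz fun z hzs => ?_
    have e : ((t, x, y) - (t, x', y) : Base) = (x - x') • (0, 1, 0) := by simp
    rw [e, map_smul, Ex z.1 z.2.1 z.2.2 (hconv.segment_subset hz' hz hzs), smul_zero]
  have Etconst : ∀ t x x' y, (t, x, y) ∈ B₀ → (t, x', y) ∈ B₀ →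
      fderiv ℝ E (t, x, y) (1, 0, 0) = fderiv ℝ E (t, x', y) (1, 0, 0) := by
    intro t x x' y hz hz'
    refine (hasDerivAt_slice_t (dE _ hz)).unique
      ((hasDerivAt_slice_t (dE _ hz')).congr_of_eventuallyEq ?_)
    have hc : ContinuousAt (fun s : ℝ => ((s, x, y) : Base)) t := by fun_prop
    have hc' : ContinuousAt (fun s : ℝ => ((s, x', y) : Base)) t := by fun_prop
    filter_upwards [hc.preimage_mem_nhds (Metric.isOpen_ball.mem_nhds hz),
      hc'.preimage_mem_nhds (Metric.isOpen_ball.mem_nhds hz')] with s h1 h2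
    exact Econst _ _ _ _ h1 h2
  have Eyconst : ∀ t x x' y, (t, x, y) ∈ B₀ → (t, x', y) ∈ B₀ →
      fderiv ℝ E (t, x, y) (0, 0, 1) = fderiv ℝ E (t, x', y) (0, 0, 1) := by
    intro t x x' y hz hz'
    refine (hasDerivAt_slice_y (dE _ hz)).unique
      ((hasDerivAt_slice_y (dE _ hz')).congr_of_eventuallyEq ?_)
    have hc : ContinuousAt (fun s : ℝ => ((t, x, s) : Base)) y := by fun_prop
    have hc' : ContinuousAt (fun s : ℝ => ((t, x', s) : Base)) y := by fun_prop
    filter_upwards [hc.preimage_mem_nhds (Metric.isOpen_ball.mem_nhds hz),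
      hc'.preimage_mem_nhds (Metric.isOpen_ball.mem_nhds hz')] with s h1 h2
    exact Econst _ _ _ _ h1 h2
  -- `Erel` is a quadratic polynomial in x whose coefficients E_t, E_y and (h' + h²)E do not depend
  -- on x. It vanishes at the three points x₀, x₀ ± r/2, so all coefficients are zero.
  have coeffs : ∀ t x y, (t, x, y) ∈ B₀ → fderiv ℝ E (t, x, y) (1, 0, 0) = 0 ∧
      fderiv ℝ E (t, x, y) (0, 0, 1) = 0 ∧ deriv h y + h y ^ 2 = 0 := by
    intro t x y hz
    obtain ⟨ht, hx, hy⟩ := mem_ball_base.1 hz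
    have i1 : (t, x₀, y) ∈ B₀ := mem_ball_base.2 ⟨ht, by simpa using hr, hy⟩
    have i2 : (t, x₀ + r / 2, y) ∈ B₀ := mem_ball_base.2 ⟨ht, by
      rw [add_sub_cancel_left, abs_of_pos (by linarith)]; linarith, hy⟩
    have i3 : (t, x₀ - r / 2, y) ∈ B₀ := mem_ball_base.2 ⟨ht, by
      rw [sub_sub_cancel_left, abs_neg, abs_of_pos (by linarith)]; linarith, hy⟩
    have r1 := Erel _ _ _ i1
    have r2 := Erel _ _ _ i2
    have r3 := Erel _ _ _ i3
    rw [Etconst _ _ x _ i1 hz, Eyconst _ _ x _ i1 hz, Econst _ _ x _ i1 hz] at r1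
    rw [Etconst _ _ x _ i2 hz, Eyconst _ _ x _ i2 hz, Econst _ _ x _ i2 hz] at r2
    rw [Etconst _ _ x _ i3 hz, Eyconst _ _ x _ i3 hz, Econst _ _ x _ i3 hz] at r3
    have hr2 : r ^ 2 / 2 ≠ 0 := by positivity
    have k1 : r ^ 2 / 2 * ((deriv h y + h y ^ 2) * E (t, x, y)) = 0 := by
      linear_combination r2 + r3 - 2 * r1
    have k2 := (mul_eq_zero.1 ((mul_eq_zero.1 k1).resolve_left hr2)).resolve_right (hE0 _ hz)
    rw [k2] at r1 r2
    have k3 : r / 2 * fderiv ℝ E (t, x, y) (0, 0, 1) = 0 := by linear_combination r2 - r1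
    have k4 := (mul_eq_zero.1 k3).resolve_left (by positivity)
    rw [k4] at r1
    exact ⟨by linarith, k4, k2⟩
  have hz₀ : (t₀, x₀, y₀) ∈ B₀ := Metric.mem_ball_self hr
  refine ⟨fun s hs => ?_, E (t₀, x₀, y₀), hE0 _ hz₀, fun z hz => ?_⟩
  · have hm : (t₀, x₀, s) ∈ B₀ := mem_ball_base.2 ⟨by simpa using hr, by simpa using hr, hs⟩
    have := (coeffs _ _ _ hm).2.2
    exact (differentiableAt_of_smooth (sh s hs)).hasDerivAt.congr_deriv (by linarith)
  · have : E z = E (t₀, x₀, y₀) := by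
      refine eq_of_fderiv_apply_eq_zero hconv dE hz₀ hz fun z' hz' => ?_
      obtain ⟨t, x, y⟩ := z'
      have hm := hconv.segment_subset hz₀ hz hz'
      obtain ⟨k1, k2, -⟩ := coeffs t x y hm
      rw [show z - (t₀, x₀, y₀) = ((z - (t₀, x₀, y₀)).1, (z - (t₀, x₀, y₀)).2.1,
        (z - (t₀, x₀, y₀)).2.2) from rfl, base_apply, k1, k2, Ex t x y hm]
      simp
    rw [← this]
    simp only [hE]
    rw [mul_assoc, ← Real.exp_add]
    simp

end LocalForm

/-! ### Fractional linear functions and the local form. -/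

/-- A function with zero Schwarzian derivative is fractional linear. -/
theorem exists_fractional_linear {η h : ℝ → ℝ} {y₀ r : ℝ} (hr : 0 < r)
    (hη : ∀ s, |s - y₀| < r → ContDiffAt ℝ ∞ η s ∧ deriv η s ≠ 0)
    (hh : ∀ s, h s = -(deriv (deriv η) s / deriv η s) / 2)
    (hh' : ∀ s, |s - y₀| < r → HasDerivAt h (-(h s) ^ 2) s) :
    ∃ α β γ δ : ℝ, (α * δ - β * γ = 1 ∨ α * δ - β * γ = -1) ∧ ∀ s, |s - y₀| < r →
      γ * s + δ ≠ 0 ∧ η s = (α * s + β) / (γ * s + δ) ∧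
        deriv η s = (α * δ - β * γ) / (γ * s + δ) ^ 2 ∧ h s = γ / (γ * s + δ) := by
  have hI : ∀ s, s ∈ Set.Ioo (y₀ - r) (y₀ + r) ↔ |s - y₀| < r := fun s => by
    rw [abs_lt, Set.mem_Ioo]; constructor <;> rintro ⟨h1, h2⟩ <;> constructor <;> linarith
  have hy₀ : y₀ ∈ Set.Ioo (y₀ - r) (y₀ + r) := (hI _).2 (by simpa using hr)
  set ρ := deriv η with hρ
  -- This is |η'|^(-1/2), for either sign of η'. It satisfies g' = hg, and h' = -h² makes hg
  -- constant, so g is affine and becomes the denominator.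
  set g : ℝ → ℝ := fun s => Real.exp (-(Real.log (ρ s)) / 2) with hg
  have g0 : ∀ s, g s ≠ 0 := fun s => Real.exp_ne_zero _
  have dη : ∀ s, |s - y₀| < r → HasDerivAt η (ρ s) s := fun s hs =>
    (differentiableAt_of_smooth (hη s hs).1).hasDerivAt
  have dρ : ∀ s, |s - y₀| < r → HasDerivAt ρ (-2 * h s * ρ s) s := fun s hs =>
    (differentiableAt_of_smooth (deriv_smooth (hη s hs).1)).hasDerivAt.congr_deriv (by
      have := (hη s hs).2
      rw [hh, ← hρ]; field_simp)
  have dg : ∀ s, |s - y₀| < r → HasDerivAt g (h s * g s) s := fun s hs => by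
    refine (((dρ s hs).log (hη s hs).2).neg.div_const 2).exp.congr_deriv ?_
    have h0 := (hη s hs).2
    have h1 : -(-2 * h s * ρ s / ρ s) / 2 = h s := by field_simp
    rw [h1, mul_comm]
    rfl
  have dhg : ∀ s ∈ Set.Ioo (y₀ - r) (y₀ + r), HasDerivAt (fun s => h s * g s) 0 s := fun s hs =>
    ((hh' s ((hI s).1 hs)).mul (dg s ((hI s).1 hs))).congr_deriv (by ring)
  set γ := h y₀ * g y₀ with hγ
  have eγ : ∀ s, |s - y₀| < r → h s * g s = γ := fun s hs =>
    eq_of_hasDerivAt_zero dhg ((hI s).2 hs) hy₀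
  have dlin : ∀ c s : ℝ, HasDerivAt (fun s => c * s) c s := fun c s => by
    simpa using (hasDerivAt_id' s).const_mul c
  set δ := g y₀ - γ * y₀ with hδ
  have eg : ∀ s, |s - y₀| < r → g s = γ * s + δ := fun s hs => by
    have := eq_of_hasDerivAt_zero (f := fun s => g s - γ * s) (fun s hs =>
      ((dg s ((hI s).1 hs)).sub (dlin γ s)).congr_deriv (by rw [eγ s ((hI s).1 hs), sub_self]))
      ((hI s).2 hs) hy₀
    linarith
  -- The derivative of ηg, which is also constant; ηg becomes the numerator.
  set α := ρ y₀ * g y₀ + η y₀ * γ with hα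
  have eα : ∀ s, |s - y₀| < r → ρ s * g s + η s * γ = α := fun s hs =>
    eq_of_hasDerivAt_zero (f := fun s => ρ s * g s + η s * γ) (fun s hs => by
      have hs' := (hI s).1 hs
      refine (((dρ s hs').mul (dg s hs')).add ((dη s hs').mul_const γ)).congr_deriv ?_
      rw [← eγ s hs']
      ring) ((hI s).2 hs) hy₀
  set β := η y₀ * g y₀ - α * y₀ with hβ
  have eβ : ∀ s, |s - y₀| < r → η s * g s = α * s + β := fun s hs => by
    have := eq_of_hasDerivAt_zero (f := fun s => η s * g s - α * s) (fun s hs => by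
      have hs' := (hI s).1 hs
      refine (((dη s hs').mul (dg s hs')).sub (dlin α s)).congr_deriv ?_
      rw [eγ s hs', ← eα s hs', sub_self]) ((hI s).2 hs) hy₀
    linarith
  have det : ∀ s, |s - y₀| < r → ρ s * g s ^ 2 = α * δ - β * γ := fun s hs => by
    linear_combination g s * eα s hs - γ * eβ s hs + α * eg s hs
  refine ⟨α, β, γ, δ, ?_, fun s hs => ⟨?_, ?_, ?_, ?_⟩⟩
  · have hm : |y₀ - y₀| < r := by simpa using hr
    rw [← det y₀ hm]
    -- The determinant η' g² is therefore the sign of η'.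
    have h1 : g y₀ ^ 2 = |ρ y₀|⁻¹ := by
      have h2 : g y₀ ^ 2 = Real.exp (-Real.log (ρ y₀)) := by
        simp only [hg]
        rw [← Real.exp_nat_mul]
        congr 1
        push_cast
        ring
      rw [h2, Real.exp_neg, Real.exp_log_eq_abs (hη y₀ hm).2]
    rw [h1]
    rcases lt_or_gt_of_ne (hη y₀ hm).2 with h3 | h3
    · right
      rw [abs_of_neg h3, inv_neg, mul_neg, mul_inv_cancel₀ (hη y₀ hm).2]
    · left
      rw [abs_of_pos h3, mul_inv_cancel₀ (hη y₀ hm).2]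
  · rw [← eg s hs]; exact g0 s
  · rw [← eg s hs, ← eβ s hs, mul_div_cancel_right₀ _ (g0 s)]
  · rw [← eg s hs, ← det s hs, mul_div_cancel_right₀ _ (pow_ne_zero 2 (g0 s))]
  · rw [← eg s hs, ← eγ s hs, mul_div_cancel_right₀ _ (g0 s)]

theorem equationAt_const_add {v : Base → ℝ} {c t x y : ℝ} :
    EquationAt (fun z => c + v z) t x y ↔ EquationAt v t x y := by
  have h : deriv (fun s => c + v (t, s, y)) = deriv (fun s => v (t, s, y)) := by
    ext s; simp
  simp only [EquationAt, deriv_const_add, iteratedDeriv_succ, iteratedDeriv_zero, h]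

/-- Point symmetries have the required form locally. -/
theorem IsPointSymmetry.exists_hasFormOn {Φ : OpenPartialHomeomorph Total Total}
    (hΦ : IsPointSymmetry Φ) {p : Total} (hp : p ∈ Φ.source) :
    ∃ Ω : Set Total, IsOpen Ω ∧ p ∈ Ω ∧ Ω ⊆ Φ.source ∧
      ∃ (A : Params) (f : Base → ℝ), HasFormOn Φ A f Ω := by
  obtain ⟨⟨t₀, x₀, y₀⟩, u₀⟩ := p
  obtain ⟨r, hr, hB⟩ := Metric.isOpen_iff.1 Φ.open_source _ hp
  obtain ⟨lam, η, hη, hform⟩ := hΦ.exists_base_form hr hB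
  obtain ⟨W, V, hWV, hU⟩ := hΦ.exists_affine hr hB hη hform
  set h : ℝ → ℝ := fun s => -(deriv (deriv η) s / deriv η s) / 2 with hh
  obtain ⟨hh', σ, hσ, hW⟩ := hΦ.exists_factor hr hB hη hform hWV hU (h := h) (fun _ => rfl)
  obtain ⟨α, β, γ, δ, hdet, hmob⟩ := exists_fractional_linear (h := h) hr hη (fun _ => rfl) hh'
  set A : Params := ⟨α, β, γ, δ, lam, σ, hdet, hσ⟩ with hA
  set f : Base → ℝ := fun z => V z / W z with hf
  have hBz : ∀ q ∈ Metric.ball (((t₀, x₀, y₀), u₀) : Total) r,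
      q.1 ∈ Metric.ball (t₀, x₀, y₀) r := by
    rintro ⟨⟨t, x, y⟩, u⟩ hq
    exact mem_ball_base.2 (mem_ball_total.1 hq).1
  have hzB : ∀ z ∈ Metric.ball (t₀, x₀, y₀) r,
      (z, u₀) ∈ Metric.ball (((t₀, x₀, y₀), u₀) : Total) r := by
    rintro ⟨t, x, y⟩ hz
    exact mem_ball_total.2 ⟨mem_ball_base.1 hz, by simpa using hr⟩
  have himg : Prod.fst '' Metric.ball (((t₀, x₀, y₀), u₀) : Total) r =
      Metric.ball (t₀, x₀, y₀) r := by
    ext z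
    constructor
    · rintro ⟨q, hq, rfl⟩; exact hBz q hq
    · intro hz; exact ⟨_, hzB z hz, rfl⟩
  have hyB : ∀ z ∈ Metric.ball ((t₀, x₀, y₀) : Base) r, |z.2.2 - y₀| < r := by
    rintro ⟨t, x, y⟩ hz
    exact (mem_ball_base.1 hz).2.2
  have hfac : ∀ z ∈ Metric.ball (t₀, x₀, y₀) r, W z = A.factor z := fun z hz => by
    rw [hW z hz, (hmob _ (hyB z hz)).2.2.2]
    rfl
  have hbase : ∀ z ∈ Metric.ball ((t₀, x₀, y₀) : Base) r,
      ((z.1 + lam, z.2.1 * deriv η z.2.2, η z.2.2) : Base) = A.baseMap z := fun z hz => by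
    obtain ⟨-, m2, m3, -⟩ := hmob _ (hyB z hz)
    rw [m2, m3, Params.baseMap, mul_comm z.2.1]
  have hform' : ∀ q ∈ Metric.ball (((t₀, x₀, y₀), u₀) : Total) r, Φ q = A.map f q := by
    rintro ⟨z, u⟩ hq
    have hz := hBz _ hq
    have hW0 := (hWV z hz).2.2
    rw [Params.map_apply]
    refine Prod.ext ?_ ?_
    · rw [hform _ hq]; exact hbase z hz
    · rw [hU _ hq, ← hfac z hz]
      simp only [hf]
      field_simp
  have hfs : ∀ z ∈ Metric.ball (t₀, x₀, y₀) r, ContDiffAt ℝ ∞ f z := fun z hz =>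
    (hWV z hz).2.1.div (hWV z hz).1 (hWV z hz).2.2
  refine ⟨Metric.ball ((t₀, x₀, y₀), u₀) r, Metric.isOpen_ball, Metric.mem_ball_self hr, hB, A, f,
    ⟨?_, fun z hz => (hfs z (himg ▸ hz)).contDiffWithinAt, ?_⟩, ?_, hform'⟩
  · rw [himg]; exact Metric.isOpen_ball
  · intro t x y hz
    rw [himg] at hz
    -- The image w of the constant solution u₀ pulls back to the factor times u₀ + f. Hence u₀ + f
    -- is a solution, and so is f.
    obtain ⟨w, h1, h2, h3⟩ := hΦ.exists_image_affine hB hη hform (hzB _ hz) 0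
    have hb := hbase _ hz
    simp only at hb
    rw [hb] at h1
    have h4 := (A.equationAt_iff (v := fun z => u₀ + f z) (hmob _ (hyB _ hz)).1
      (contDiffAt_const.add (hfs _ hz)) h1 ?_).1 ?_
    · exact equationAt_const_add.1 h4
    · filter_upwards [h3, Metric.isOpen_ball.mem_nhds hz] with z hz1 hz2
      rw [← hbase z hz2, hz1, zero_mul, add_zero, hform' _ (hzB z hz2), Params.map_apply]
    · rw [← hb]; exact h2
  · intro q hq
    exact (hmob _ (hyB _ (hBz q hq))).1

/-! ### Inverse transformations and the converse implication. -/

/-- The parameters of the inverse transformation. -/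
noncomputable def Params.inv (A : Params) : Params where
  -- The adjugate matrix equals the inverse up to the sign of the determinant, which is immaterial
  -- here. It needs no division, and taking it twice returns the original matrix.
  α := A.δ
  β := -A.β
  γ := -A.γ
  δ := A.α
  lam := -A.lam
  σ := A.σ⁻¹
  det_eq := by
    have h : A.δ * A.α - -A.β * -A.γ = A.α * A.δ - A.β * A.γ := by ring
    rw [h]; exact A.det_eq
  σ_ne_zero := inv_ne_zero A.σ_ne_zero

theorem Params.inv_inv (A : Params) : A.inv.inv = A := by
  simp [Params.inv]

/-- The denominators of a fractional linear map and of its adjugate multiply to the determinant; the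
inversion formulas rest on this. -/
theorem Params.inv_denominator (A : Params) {z : Base} (hz : A.γ * z.2.2 + A.δ ≠ 0) :
    A.inv.γ * (A.baseMap z).2.2 + A.inv.δ =
      (A.α * A.δ - A.β * A.γ) / (A.γ * z.2.2 + A.δ) := by
  simp only [Params.inv, Params.baseMap]
  field_simp
  ring

theorem Params.inv_regular (A : Params) {z : Base} (hz : A.γ * z.2.2 + A.δ ≠ 0) :
    A.inv.γ * (A.baseMap z).2.2 + A.inv.δ ≠ 0 := by
  rw [A.inv_denominator hz]
  exact div_ne_zero A.det_ne_zero hz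

theorem Params.inv_det (A : Params) :
    A.inv.α * A.inv.δ - A.inv.β * A.inv.γ = A.α * A.δ - A.β * A.γ := by
  simp only [Params.inv]; ring

theorem Params.inv_baseMap_baseMap (A : Params) {z : Base} (hz : A.γ * z.2.2 + A.δ ≠ 0) :
    A.inv.baseMap (A.baseMap z) = z := by
  have hd := A.det_ne_zero
  have hi := A.inv_denominator hz
  refine Prod.ext ?_ (Prod.ext ?_ ?_)
  · simp [Params.baseMap, Params.inv]
  · simp only [Params.baseMap] at hi ⊢
    rw [A.inv_det, hi]
    field_simp
  · simp only [Params.baseMap] at hi ⊢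
    rw [hi, div_div_eq_mul_div, div_eq_iff hd]
    simp only [Params.inv]
    rw [add_mul, mul_assoc, div_mul_cancel₀ _ hz]
    ring

theorem Params.inv_factor_mul (A : Params) {z : Base} (hz : A.γ * z.2.2 + A.δ ≠ 0) :
    A.inv.factor (A.baseMap z) * A.factor z = 1 := by
  have hd := A.det_ne_zero
  have e : A.inv.γ / (A.inv.γ * (A.baseMap z).2.2 + A.inv.δ) * (A.baseMap z).2.1 =
      -(A.γ / (A.γ * z.2.2 + A.δ) * z.2.1) := by
    rw [A.inv_denominator hz]
    simp only [Params.inv, Params.baseMap]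
    set d := A.α * A.δ - A.β * A.γ
    field_simp
  rw [Params.factor, Params.factor, e, Real.exp_neg]
  have := A.σ_ne_zero
  have := Real.exp_ne_zero (A.γ / (A.γ * z.2.2 + A.δ) * z.2.1)
  simp only [Params.inv]
  field_simp

theorem Params.isOpen_regular_base (A : Params) : IsOpen {z : Base | A.γ * z.2.2 + A.δ ≠ 0} :=
  isOpen_ne.preimage (by fun_prop : Continuous fun z : Base => A.γ * z.2.2 + A.δ)

theorem Params.contDiffAt_map (A : Params) {f : Base → ℝ} {q : Total} (hq : q ∈ A.regular)
    (hf : ContDiffAt ℝ ∞ f q.1) : ContDiffAt ℝ ∞ (A.map f) q := by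
  have h1 : ContDiffAt ℝ ∞ (fun q : Total => A.baseMap q.1) q :=
    ContDiffAt.comp q (A.contDiffAt_baseMap hq) contDiffAt_fst
  have h2 : ContDiffAt ℝ ∞ (fun q : Total => A.factor q.1) q :=
    ContDiffAt.comp (g := A.factor) q (A.contDiffAt_factor hq) contDiffAt_fst
  have h3 : ContDiffAt ℝ ∞ (fun q : Total => f q.1) q :=
    ContDiffAt.comp q hf contDiffAt_fst
  exact h1.prodMk (h2.mul (contDiffAt_snd.add h3))

/-- The inverse of the transformation with parameters `A` and `f`. -/
noncomputable def Params.invMap (A : Params) (f : Base → ℝ) : Total → Total :=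
  fun q => (A.inv.baseMap q.1, A.inv.factor q.1 * q.2 - f (A.inv.baseMap q.1))

theorem Params.contDiffAt_invMap (A : Params) {f : Base → ℝ} {q : Total}
    (hq : A.inv.γ * q.1.2.2 + A.inv.δ ≠ 0) (hf : ContDiffAt ℝ ∞ f (A.inv.baseMap q.1)) :
    ContDiffAt ℝ ∞ (A.invMap f) q := by
  have h1 : ContDiffAt ℝ ∞ (fun q : Total => A.inv.baseMap q.1) q :=
    ContDiffAt.comp q (A.inv.contDiffAt_baseMap hq) contDiffAt_fst
  have h2 : ContDiffAt ℝ ∞ (fun q : Total => A.inv.factor q.1) q :=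
    ContDiffAt.comp (g := A.inv.factor) q (A.inv.contDiffAt_factor hq) contDiffAt_fst
  have h3 : ContDiffAt ℝ ∞ (fun q : Total => f (A.inv.baseMap q.1)) q :=
    ContDiffAt.comp q hf h1
  exact h1.prodMk ((h2.mul contDiffAt_snd).sub h3)

/-- The transformation with parameters `A` and `f`, on its natural domain. -/
noncomputable def Params.toHomeomorph (A : Params) (f : Base → ℝ) {D : Set Base} (hD : IsOpen D)
    (hf : ContDiffOn ℝ ∞ f D) : OpenPartialHomeomorph Total Total where
  toFun := A.map f
  invFun := A.invMap f
  source := Prod.fst ⁻¹' D ∩ A.regular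
  target := Prod.fst ⁻¹' ({z | A.inv.γ * z.2.2 + A.inv.δ ≠ 0} ∩ A.inv.baseMap ⁻¹' D)
  map_source' := by
    rintro ⟨z, u⟩ ⟨hz, hr⟩
    refine ⟨A.inv_regular hr, ?_⟩
    change A.inv.baseMap (A.baseMap z) ∈ D
    rwa [A.inv_baseMap_baseMap hr]
  map_target' := by
    rintro ⟨z, u⟩ ⟨hz, hr⟩
    refine ⟨hr, ?_⟩
    have := A.inv.inv_regular hz
    rwa [A.inv_inv] at this
  left_inv' := by
    rintro ⟨z, u⟩ ⟨hz, hr⟩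
    rw [Params.map_apply, Params.invMap]
    simp only
    rw [A.inv_baseMap_baseMap hr, ← mul_assoc, A.inv_factor_mul hr]
    simp
  right_inv' := by
    rintro ⟨z, u⟩ ⟨hz, hr⟩
    have h1 := A.inv.inv_baseMap_baseMap hz
    have h2 := A.inv.inv_factor_mul hz
    rw [A.inv_inv] at h1 h2
    rw [Params.invMap, Params.map_apply]
    simp only
    rw [h1, sub_add_cancel, ← mul_assoc, h2, one_mul]
  open_source := (hD.preimage continuous_fst).inter
    (isOpen_ne.preimage (by fun_prop : Continuous fun q : Total => A.γ * q.1.2.2 + A.δ))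
  open_target := by
    refine IsOpen.preimage continuous_fst ?_
    refine ContinuousOn.isOpen_inter_preimage (fun z hz => ?_) A.inv.isOpen_regular_base hD
    exact (A.inv.contDiffAt_baseMap hz).continuousAt.continuousWithinAt
  continuousOn_toFun := fun q hq =>
    (A.contDiffAt_map hq.2 (hf.contDiffAt (hD.mem_nhds hq.1))).continuousAt.continuousWithinAt
  continuousOn_invFun := fun q hq => (A.contDiffAt_invMap hq.1
    (hf.contDiffAt (hD.mem_nhds hq.2))).continuousAt.continuousWithinAt

theorem equationAt_add_iff {v f : Base → ℝ} {t x y : ℝ} (hv : ContDiffAt ℝ ∞ v (t, x, y))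
    (hf : ContDiffAt ℝ ∞ f (t, x, y)) (h : EquationAt f t x y) :
    EquationAt (fun z => v z + f z) t x y ↔ EquationAt v t x y := by
  have h1 := differentiableAt_of_smooth hv
  have h2 := differentiableAt_of_smooth hf
  have hev : fderiv ℝ (fun z => v z + f z) =ᶠ[𝓝 (t, x, y)] fun z => fderiv ℝ v z + fderiv ℝ f z := by
    filter_upwards [eventually_smooth hv, eventually_smooth hf] with z a b
    exact fderiv_fun_add a b
  have d1 : DifferentiableAt ℝ (fderiv ℝ v) (t, x, y) :=
    differentiableAt_of_smooth (hv.fderiv_right (by simp))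
  have d2 : DifferentiableAt ℝ (fderiv ℝ f) (t, x, y) :=
    differentiableAt_of_smooth (hf.fderiv_right (by simp))
  rw [equationAt_iff_fderiv hf] at h
  rw [equationAt_iff_fderiv (hv.add hf), equationAt_iff_fderiv hv, hev.fderiv_eq,
    fderiv_fun_add d1 d2, fderiv_fun_add h1 h2]
  simp only [add_apply]
  constructor
  · intro h3; linear_combination h3 - h
  · intro h3; linear_combination h3 + h

/-- A transformation of the given form transforms the equation for `v` into that for `w`. -/
theorem HasFormOn.equationAt_iff {Φ : Total → Total} {A : Params} {f : Base → ℝ} {Ω : Set Total}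
    (hΦ : HasFormOn Φ A f Ω) (hΩ : IsOpen Ω) {v w : Base → ℝ} {t x y : ℝ}
    (hp : ((t, x, y), v (t, x, y)) ∈ Ω) (hv : ContDiffAt ℝ ∞ v (t, x, y))
    (hw : ContDiffAt ℝ ∞ w (Φ ((t, x, y), v (t, x, y))).1)
    (h : ∀ᶠ z in 𝓝 (t, x, y), w (Φ (z, v z)).1 = (Φ (z, v z)).2) :
    EquationAt w (Φ ((t, x, y), v (t, x, y))).1.1 (Φ ((t, x, y), v (t, x, y))).1.2.1
      (Φ ((t, x, y), v (t, x, y))).1.2.2 ↔ EquationAt v t x y := by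
  obtain ⟨hf, hreg, heq⟩ := hΦ
  have hz : (t, x, y) ∈ Prod.fst '' Ω := ⟨_, hp, rfl⟩
  have e : (Φ ((t, x, y), v (t, x, y))).1 = A.baseMap (t, x, y) := by
    rw [heq hp, Params.map_apply]
  rw [e] at hw ⊢
  rw [A.equationAt_iff (v := fun z => v z + f z) (hreg hp) (hv.add (hf.contDiffAt hz)) hw,
    equationAt_add_iff hv (hf.contDiffAt hz) (hf.equation _ _ _ hz)]
  have hc : ContinuousAt (fun z => (z, v z)) (t, x, y) := continuousAt_id.prodMk hv.continuousAt
  filter_upwards [h, hc.preimage_mem_nhds (hΩ.mem_nhds hp)] with z h1 h2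
  rw [heq h2, Params.map_apply] at h1
  exact h1

/-- Transformations that locally have the given form are point symmetries. -/
theorem isPointSymmetry_of_hasFormOn {Φ : OpenPartialHomeomorph Total Total}
    (h : ∀ p ∈ Φ.source, ∃ Ω : Set Total, IsOpen Ω ∧ p ∈ Ω ∧ Ω ⊆ Φ.source ∧
      ∃ (A : Params) (f : Base → ℝ), HasFormOn Φ A f Ω) : IsPointSymmetry Φ := by
  refine ⟨⟨fun p hp => ?_, fun p hp => ?_⟩, ?_⟩
  · obtain ⟨Ω, hΩ, hpΩ, -, A, f, hf, hreg, heq⟩ := h p hp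
    have h1 := A.contDiffAt_map (hreg hpΩ) (hf.contDiffAt ⟨p, hpΩ, rfl⟩)
    exact (h1.congr_of_eventuallyEq (heq.eventuallyEq_of_mem (hΩ.mem_nhds hpΩ))).contDiffWithinAt
  · obtain ⟨Ω, hΩ, hpΩ, hΩs, A, f, hf, hreg, heq⟩ := h (Φ.symm p) (Φ.map_target hp)
    -- Near p the inverse of Φ coincides with that of the explicit model Ψ, which is visibly smooth.
    set Ψ := A.toHomeomorph f hf.isOpen hf.smooth with hΨ
    have hΩΨ : Ω ⊆ Ψ.source := fun q hq => ⟨⟨q, hq, rfl⟩, hreg hq⟩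
    have hpΨ : p = Ψ (Φ.symm p) := (Φ.right_inv hp).symm.trans (heq hpΩ)
    have hpt : p ∈ Ψ.target := by
      rw [hpΨ]; exact Ψ.map_source (hΩΨ hpΩ)
    have h1 : ContDiffAt ℝ ∞ (A.invMap f) p := A.contDiffAt_invMap hpt.1 (hf.contDiffAt hpt.2)
    refine (h1.congr_of_eventuallyEq ?_).contDiffWithinAt
    filter_upwards [Φ.open_target.mem_nhds hp,
      (Φ.symm.continuousAt hp).preimage_mem_nhds (hΩ.mem_nhds hpΩ)] with q hq hq'
    have h2 : q = Ψ (Φ.symm q) := (Φ.right_inv hq).symm.trans (heq hq')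
    change Φ.symm q = Ψ.symm q
    nth_rewrite 2 [h2]
    rw [Ψ.left_inv (hΩΨ hq')]
  · intro v w D D' hD hD' hv hw hsub himg
    have key : ∀ t x y, (t, x, y) ∈ D →
        (Φ ((t, x, y), v (t, x, y))).1 ∈ D' ∧
        (EquationAt w (Φ ((t, x, y), v (t, x, y))).1.1 (Φ ((t, x, y), v (t, x, y))).1.2.1
          (Φ ((t, x, y), v (t, x, y))).1.2.2 ↔ EquationAt v t x y) := by
      intro t x y hz
      have hmem : ∀ z ∈ D, (Φ (z, v z)).1 ∈ D' ∧ w (Φ (z, v z)).1 = (Φ (z, v z)).2 := by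
        intro z hz
        have : Φ (z, v z) ∈ Set.graphOn w D' := himg ▸ ⟨_, ⟨z, hz, rfl⟩, rfl⟩
        rwa [Set.mem_graphOn] at this
      have hp : ((t, x, y), v (t, x, y)) ∈ Φ.source := hsub ⟨_, hz, rfl⟩
      obtain ⟨Ω, hΩ, hpΩ, -, A, f, hform⟩ := h _ hp
      refine ⟨(hmem _ hz).1, hform.equationAt_iff hΩ hpΩ (hv.contDiffAt (hD.mem_nhds hz))
        (hw.contDiffAt (hD'.mem_nhds (hmem _ hz).1)) ?_⟩
      filter_upwards [hD.mem_nhds hz] with z hz using (hmem z hz).2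
    constructor
    · intro hs
      refine ⟨hD', hw, fun t x y hz => ?_⟩
      have : ((t, x, y), w (t, x, y)) ∈ Φ '' Set.graphOn v D := himg ▸ ⟨_, hz, rfl⟩
      obtain ⟨_, ⟨⟨t', x', y'⟩, hz', rfl⟩, heq⟩ := this
      have h1 := ((key t' x' y' hz').2).2 (hs.equation _ _ _ hz')
      simp only at heq
      rw [heq] at h1
      exact h1
    · intro hs
      refine ⟨hD, hv, fun t x y hz => ?_⟩
      exact ((key t x y hz).2).1 (hs.equation _ _ _ (key t x y hz).1)

theorem isPointSymmetry_iff {Φ : OpenPartialHomeomorph Total Total} :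
    IsPointSymmetry Φ ↔ ∀ p ∈ Φ.source, ∃ Ω : Set Total, IsOpen Ω ∧ p ∈ Ω ∧ Ω ⊆ Φ.source ∧
      ∃ (A : Params) (f : Base → ℝ), HasFormOn Φ A f Ω :=
  ⟨fun h _ hp => h.exists_hasFormOn hp, isPointSymmetry_of_hasFormOn⟩

/-! ### Composition and the pseudogroup. -/

/-- The parameters of the composition: first `A`, then `B`. -/
noncomputable def Params.comp (B A : Params) : Params where
  α := B.α * A.α + B.β * A.γ
  β := B.α * A.β + B.β * A.δ
  γ := B.γ * A.α + B.δ * A.γ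
  δ := B.γ * A.β + B.δ * A.δ
  lam := A.lam + B.lam
  σ := B.σ * A.σ
  det_eq := by
    have h : (B.α * A.α + B.β * A.γ) * (B.γ * A.β + B.δ * A.δ) -
        (B.α * A.β + B.β * A.δ) * (B.γ * A.α + B.δ * A.γ) =
        (B.α * B.δ - B.β * B.γ) * (A.α * A.δ - A.β * A.γ) := by ring
    rw [h]
    rcases A.det_eq with h1 | h1 <;> rcases B.det_eq with h2 | h2 <;> simp [h1, h2]
  σ_ne_zero := mul_ne_zero B.σ_ne_zero A.σ_ne_zero

/-- The cocycle property of the automorphy factor γy + δ. -/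
theorem Params.comp_denominator (A B : Params) {z : Base} (hz : A.γ * z.2.2 + A.δ ≠ 0) :
    (B.comp A).γ * z.2.2 + (B.comp A).δ =
      (B.γ * (A.baseMap z).2.2 + B.δ) * (A.γ * z.2.2 + A.δ) := by
  have hY : (A.baseMap z).2.2 * (A.γ * z.2.2 + A.δ) = A.α * z.2.2 + A.β := div_mul_cancel₀ _ hz
  simp only [Params.comp]
  linear_combination -B.γ * hY

theorem Params.comp_baseMap (A B : Params) {z : Base} (hz : A.γ * z.2.2 + A.δ ≠ 0) :
    (B.comp A).baseMap z = B.baseMap (A.baseMap z) := by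
  have hi := A.comp_denominator B hz
  refine Prod.ext ?_ (Prod.ext ?_ ?_)
  · simp [Params.baseMap, Params.comp, add_assoc]
  · have hd : (B.comp A).α * (B.comp A).δ - (B.comp A).β * (B.comp A).γ =
        (B.α * B.δ - B.β * B.γ) * (A.α * A.δ - A.β * A.γ) := by
      simp only [Params.comp]; ring
    have e1 : ((B.comp A).baseMap z).2.1 = ((B.comp A).α * (B.comp A).δ -
      (B.comp A).β * (B.comp A).γ) / ((B.comp A).γ * z.2.2 + (B.comp A).δ) ^ 2 * z.2.1 := rfl
    have e2 : (B.baseMap (A.baseMap z)).2.1 = (B.α * B.δ - B.β * B.γ) /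
      (B.γ * (A.baseMap z).2.2 + B.δ) ^ 2 * ((A.α * A.δ - A.β * A.γ) /
        (A.γ * z.2.2 + A.δ) ^ 2 * z.2.1) := rfl
    rw [e1, e2, hd, hi, mul_pow, ← mul_assoc, div_mul_div_comm]
  · have e1 : ((B.comp A).baseMap z).2.2 = ((B.comp A).α * z.2.2 + (B.comp A).β) /
      ((B.comp A).γ * z.2.2 + (B.comp A).δ) := rfl
    have e2 : (B.baseMap (A.baseMap z)).2.2 = (B.α * (A.baseMap z).2.2 + B.β) /
      (B.γ * (A.baseMap z).2.2 + B.δ) := rfl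
    have e3 : (B.comp A).α * z.2.2 + (B.comp A).β =
        (B.α * (A.baseMap z).2.2 + B.β) * (A.γ * z.2.2 + A.δ) := by
      have hY : (A.baseMap z).2.2 * (A.γ * z.2.2 + A.δ) = A.α * z.2.2 + A.β :=
        div_mul_cancel₀ _ hz
      simp only [Params.comp]
      linear_combination -B.α * hY
    rw [e1, e2, hi, e3, mul_div_mul_right _ _ hz]

/-- The coefficient γ/(γy+δ) is the logarithmic derivative of the denominator, so the cocycle
property differentiates to an additive one. Its Jacobian ỹ' is absorbed by x̃ = ±ỹ'x with the sign
in fact +, as ỹ' = (αδ-βγ)/(γy+δ)². -/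
theorem Params.comp_factor (A B : Params) {z : Base} (hz : A.γ * z.2.2 + A.δ ≠ 0)
    (hz' : B.γ * (A.baseMap z).2.2 + B.δ ≠ 0) :
    (B.comp A).factor z = B.factor (A.baseMap z) * A.factor z := by
  have hi := A.comp_denominator B hz
  have e : (B.comp A).γ / ((B.comp A).γ * z.2.2 + (B.comp A).δ) * z.2.1 =
      B.γ / (B.γ * (A.baseMap z).2.2 + B.δ) * (A.baseMap z).2.1 +
        A.γ / (A.γ * z.2.2 + A.δ) * z.2.1 := by
    have hx : (A.baseMap z).2.1 =
      (A.α * A.δ - A.β * A.γ) / (A.γ * z.2.2 + A.δ) ^ 2 * z.2.1 := rfl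
    have key : (B.comp A).γ * (A.γ * z.2.2 + A.δ) = B.γ * (A.α * A.δ - A.β * A.γ) +
        A.γ * ((B.γ * (A.baseMap z).2.2 + B.δ) * (A.γ * z.2.2 + A.δ)) := by
      rw [← hi]
      simp only [Params.comp]
      ring
    rw [hi, hx]
    set g := A.γ * z.2.2 + A.δ
    set k := B.γ * (A.baseMap z).2.2 + B.δ
    field_simp
    linear_combination z.2.1 * key
  have e1 : (B.comp A).factor z = B.σ * A.σ *
    Real.exp ((B.comp A).γ / ((B.comp A).γ * z.2.2 + (B.comp A).δ) * z.2.1) := rfl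
  rw [e1, e, Real.exp_add, Params.factor, Params.factor]
  ring

theorem HasFormOn.mono {Φ : Total → Total} {A : Params} {f : Base → ℝ} {Ω Ω' : Set Total}
    (h : HasFormOn Φ A f Ω) (hs : Ω' ⊆ Ω) (ho : IsOpen Ω') : HasFormOn Φ A f Ω' :=
  ⟨h.1.mono (Set.image_mono hs) (isOpenMap_fst _ ho), hs.trans h.2.1, h.2.2.mono hs⟩

/-- The composition of transformations of the given form is of the given form. -/
theorem HasFormOn.comp {Φ Ψ : Total → Total} {A B : Params} {f g : Base → ℝ} {Ω Ω' : Set Total}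
    (h' : HasFormOn Ψ B g Ω') (h : HasFormOn Φ A f Ω) (ho : IsOpen Ω) (hm : Set.MapsTo Φ Ω Ω') :
    HasFormOn (Ψ ∘ Φ) (B.comp A) (fun z => (A.factor z)⁻¹ * g (A.baseMap z) + f z) Ω := by
  obtain ⟨hf, hr, he⟩ := h
  obtain ⟨hg, hr', he'⟩ := h'
  have hbase : ∀ q ∈ Ω, (Φ q).1 = A.baseMap q.1 := fun q hq => by
    rw [he hq]; rfl
  have hreg : ∀ q ∈ Ω, B.γ * (A.baseMap q.1).2.2 + B.δ ≠ 0 := fun q hq => by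
    rw [← hbase q hq]; exact hr' (hm hq)
  have hgs : ∀ q ∈ Ω, A.baseMap q.1 ∈ Prod.fst '' Ω' := fun q hq => ⟨Φ q, hm hq, hbase q hq⟩
  have hsm : ∀ q ∈ Ω, ContDiffAt ℝ ∞ (fun z => (A.factor z)⁻¹ * g (A.baseMap z)) q.1 := by
    intro q hq
    exact ((A.contDiffAt_factor (hr hq)).inv (A.factor_ne_zero _)).mul
      (ContDiffAt.comp q.1 (hg.contDiffAt (hgs q hq)) (A.contDiffAt_baseMap (hr hq)))
  have hfs : ∀ q ∈ Ω, ContDiffAt ℝ ∞ f q.1 := fun q hq => hf.contDiffAt ⟨q, hq, rfl⟩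
  refine ⟨⟨isOpenMap_fst _ ho, ?_, ?_⟩, fun q hq => ?_, fun q hq => ?_⟩
  · rintro _ ⟨q, hq, rfl⟩
    exact ((hsm q hq).add (hfs q hq)).contDiffWithinAt
  · rintro t x y ⟨q, hq, hqz⟩
    have h1 := hsm q hq
    have h2 := hfs q hq
    have h3 := hg.contDiffAt (hgs q hq)
    have h4 := hr hq
    have h5 := hg.equation _ _ _ (hgs q hq)
    have h6 := hf.equation t x y ⟨q, hq, hqz⟩
    simp only [Params.regular, Set.mem_ofPred_eq] at h4
    rw [hqz] at h1 h2 h3 h4 h5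
    rw [equationAt_add_iff h1 h2 h6]
    refine (A.equationAt_iff h4 h1 h3 (Eventually.of_forall fun z => ?_)).1 h5
    rw [← mul_assoc, mul_inv_cancel₀ (A.factor_ne_zero z), one_mul]
  · change (B.comp A).γ * q.1.2.2 + (B.comp A).δ ≠ 0
    rw [A.comp_denominator B (hr hq)]
    exact mul_ne_zero (hreg q hq) (hr hq)
  · rw [Function.comp, he' (hm hq), he hq]
    obtain ⟨z, u⟩ := q
    simp only [Params.map_apply]
    have hz := hr hq
    have hz' := hreg _ hq
    rw [A.comp_baseMap B hz, A.comp_factor B hz hz']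
    have := A.factor_ne_zero z
    congr 1
    field_simp
    ring

theorem IsPointSymmetry.symm {Φ : OpenPartialHomeomorph Total Total} (h : IsPointSymmetry Φ) :
    IsPointSymmetry Φ.symm := by
  refine ⟨⟨h.1.2, by simpa using h.1.1⟩, ?_⟩
  intro v w D D' hD hD' hv hw hsub himg
  have hsub' : Set.graphOn w D' ⊆ Φ.source := by
    rw [← himg]
    rintro _ ⟨q, hq, rfl⟩
    exact Φ.map_target (hsub hq)
  have himg' : Φ '' Set.graphOn w D' = Set.graphOn v D := by
    rw [← himg, Set.image_image]
    exact (Set.image_congr fun q hq => Φ.right_inv (hsub hq)).trans (Set.image_id _)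
  exact (h.2 w v D' D hD' hD hw hv hsub' himg').symm

/-- The definition does not compose directly, since the intermediate image of a graph is not known a
priori to be a graph. The local form avoids this. -/
theorem IsPointSymmetry.trans {Φ Ψ : OpenPartialHomeomorph Total Total} (h : IsPointSymmetry Φ)
    (h' : IsPointSymmetry Ψ) : IsPointSymmetry (Φ.trans Ψ) := by
  refine isPointSymmetry_of_hasFormOn fun p hp => ?_
  rw [OpenPartialHomeomorph.trans_source] at hp ⊢
  obtain ⟨Ω, hΩ, hpΩ, hs, A, f, hA⟩ := h.exists_hasFormOn hp.1
  obtain ⟨Ω', hΩ', hpΩ', hs', B, g, hB⟩ := h'.exists_hasFormOn hp.2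
  have ho : IsOpen (Ω ∩ Φ ⁻¹' Ω') := (Φ.continuousOn.mono hs).isOpen_inter_preimage hΩ hΩ'
  exact ⟨Ω ∩ Φ ⁻¹' Ω', ho, ⟨hpΩ, hpΩ'⟩, fun q hq => ⟨hs hq.1, hs' hq.2⟩, B.comp A, _,
    hB.comp (hA.mono Set.inter_subset_left ho) ho fun q hq => hq.2⟩

/-- The parameters of the identity transformation. -/
noncomputable def Params.id : Params where
  α := 1
  β := 0
  γ := 0
  δ := 1
  lam := 0
  σ := 1
  det_eq := by simp
  σ_ne_zero := one_ne_zero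

theorem isPointSymmetry_refl : IsPointSymmetry (OpenPartialHomeomorph.refl Total) := by
  refine isPointSymmetry_of_hasFormOn fun p _ => ⟨Set.univ, isOpen_univ, trivial, by simp,
    Params.id, fun _ => 0, ⟨isOpenMap_fst _ isOpen_univ, contDiffOn_const, ?_⟩, ?_, ?_⟩
  · intro t x y _
    simp [EquationAt]
  · intro q _
    simp [Params.regular, Params.id]
  · rintro ⟨z, u⟩ _
    simp [Params.map_apply, Params.baseMap, Params.factor, Params.id]

theorem IsPointSymmetry.restr {Φ : OpenPartialHomeomorph Total Total} (h : IsPointSymmetry Φ)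
    (s : Set Total) : IsPointSymmetry (Φ.restr s) := by
  refine isPointSymmetry_of_hasFormOn fun p hp => ?_
  rw [OpenPartialHomeomorph.restr_source] at hp ⊢
  obtain ⟨Ω, hΩ, hpΩ, hs, A, f, hA⟩ := h.exists_hasFormOn hp.1
  exact ⟨Ω ∩ interior s, hΩ.inter isOpen_interior, ⟨hpΩ, hp.2⟩,
    fun q hq => ⟨hs hq.1, hq.2⟩, A, f, hA.mono Set.inter_subset_left (hΩ.inter isOpen_interior)⟩

/-- The pseudogroup of point symmetries. -/
noncomputable def symmetryGroupoid : StructureGroupoid Total where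
  members := {Φ | IsPointSymmetry Φ}
  trans' _ _ h h' := h.trans h'
  symm' _ h := h.symm
  id_mem' := isPointSymmetry_refl
  -- The definition speaks of graphs over whole domains, whereas having the local form is a
  -- condition near each point, so gluing becomes immediate.
  locality' Φ h := by
    refine isPointSymmetry_of_hasFormOn fun p hp => ?_
    obtain ⟨s, hs, hps, hsym⟩ := h p hp
    have hp' : p ∈ (Φ.restr s).source := by
      rw [Φ.restr_source' s hs]; exact ⟨hp, hps⟩
    obtain ⟨Ω, hΩ, hpΩ, hsub, A, f, hA⟩ := IsPointSymmetry.exists_hasFormOn hsym hp'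
    rw [Φ.restr_source' s hs] at hsub
    exact ⟨Ω, hΩ, hpΩ, hsub.trans Set.inter_subset_left, A, f, hA⟩
  mem_of_eqOnSource' Φ Φ' h he := by
    refine isPointSymmetry_of_hasFormOn fun p hp => ?_
    rw [he.1] at hp ⊢
    obtain ⟨Ω, hΩ, hpΩ, hsub, A, f, h1, h2, h3⟩ := IsPointSymmetry.exists_hasFormOn h hp
    exact ⟨Ω, hΩ, hpΩ, hsub, A, f, h1, h2,
      fun q hq => (he.2 (by rw [he.1]; exact hsub hq)).trans (h3 hq)⟩

/-! ### Uniqueness of the parameters. -/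

theorem Params.SameUpToSign.baseMap_eq {A B : Params} (h : A.SameUpToSign B) :
    A.baseMap = B.baseMap := by
  obtain ⟨h1, -, ⟨h3, h4, h5, h6⟩ | ⟨h3, h4, h5, h6⟩⟩ := h
  · funext z
    simp only [Params.baseMap, h1, h3, h4, h5, h6]
  · funext z
    simp only [Params.baseMap, h1, h3, h4, h5, h6, neg_mul_neg]
    rw [show -B.γ * z.2.2 + -B.δ = -(B.γ * z.2.2 + B.δ) by ring,
      show -B.α * z.2.2 + -B.β = -(B.α * z.2.2 + B.β) by ring, neg_div_neg_eq, neg_sq]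

theorem Params.SameUpToSign.factor_eq {A B : Params} (h : A.SameUpToSign B) :
    A.factor = B.factor := by
  obtain ⟨-, h2, ⟨-, -, h5, h6⟩ | ⟨-, -, h5, h6⟩⟩ := h
  · funext z
    simp only [Params.factor, h2, h5, h6]
  · funext z
    simp only [Params.factor, h2, h5, h6]
    rw [show -B.γ * z.2.2 + -B.δ = -(B.γ * z.2.2 + B.δ) by ring, neg_div_neg_eq]

theorem Params.SameUpToSign.map_eq {A B : Params} (h : A.SameUpToSign B) (f : Base → ℝ) :
    A.map f = B.map f := by
  funext ⟨z, u⟩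
  rw [Params.map_apply, Params.map_apply, h.baseMap_eq, h.factor_eq]

theorem Params.SameUpToSign.regular_eq {A B : Params} (h : A.SameUpToSign B) :
    A.regular = B.regular := by
  obtain ⟨-, -, ⟨-, -, h5, h6⟩ | ⟨-, -, h5, h6⟩⟩ := h
  · simp only [Params.regular, h5, h6]
  · ext q
    simp only [Params.regular, h5, h6, Set.mem_ofPred_eq]
    rw [show -B.γ * q.1.2.2 + -B.δ = -(B.γ * q.1.2.2 + B.δ) by ring, neg_ne_zero]

theorem HasFormOn.congr {Φ : Total → Total} {A B : Params} {f : Base → ℝ} {Ω : Set Total}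
    (h : HasFormOn Φ B f Ω) (hAB : A.SameUpToSign B) : HasFormOn Φ A f Ω := by
  obtain ⟨h1, h2, h3⟩ := h
  exact ⟨h1, hAB.regular_eq ▸ h2, hAB.map_eq f ▸ h3⟩

/-- The constants are determined by the transformation up to the sign. -/
theorem sameUpToSign_of_eqOn {A B : Params} {f g : Base → ℝ} {Ω : Set Total} (hΩ : IsOpen Ω)
    (hne : Ω.Nonempty) (hA : Ω ⊆ A.regular) (hB : Ω ⊆ B.regular)
    (h : Set.EqOn (A.map f) (B.map g) Ω) : A.SameUpToSign B := by
  obtain ⟨⟨⟨t, x, y⟩, u⟩, hq, hx⟩ := exists_x_ne_zero hΩ hne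
  obtain ⟨r, hr, hball⟩ := Metric.isOpen_iff.1 hΩ _ hq
  have hs : |r / 2| < r := by rw [abs_of_pos (by linarith)]; linarith
  have hr0 : |(0 : ℝ)| < r := by simpa using hr
  -- The factor is the slope in u, so two values of u isolate it without knowledge of f and g. Two
  -- values of x then yield γ/(γy+δ) and σ.
  have fac : ∀ x' : ℝ, |x' - x| < r → A.factor (t, x', y) = B.factor (t, x', y) := by
    intro x' hx'
    have m1 : ((t, x', y), u) ∈ Ω := hball (mem_ball_total.2
      ⟨⟨by simpa using hr, hx', by simpa using hr⟩, by simpa using hr⟩)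
    have m2 : ((t, x', y), u + r / 2) ∈ Ω := hball (mem_ball_total.2
      ⟨⟨by simpa using hr, hx', by simpa using hr⟩, by simpa using hs⟩)
    have h1 := congrArg Prod.snd (h m1)
    have h2 := congrArg Prod.snd (h m2)
    rw [Params.map_apply, Params.map_apply] at h1 h2
    have h3 : r / 2 * A.factor (t, x', y) = r / 2 * B.factor (t, x', y) := by
      linear_combination h2 - h1
    exact mul_left_cancel₀ (by positivity) h3
  set gA := A.γ * y + A.δ with hgA
  set gB := B.γ * y + B.δ with hgB
  have gA0 : gA ≠ 0 := hA hq
  have gB0 : gB ≠ 0 := hB hq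
  have f1 := fac x (by simpa using hr)
  have f2 := fac (x + r / 2) (by simpa using hs)
  simp only [Params.factor] at f1 f2
  rw [mul_add, mul_add, Real.exp_add, Real.exp_add, ← mul_assoc, ← mul_assoc, f1] at f2
  have f3 := mul_left_cancel₀ (B.factor_ne_zero (t, x, y)) f2
  have f4 : A.γ / gA = B.γ / gB := mul_right_cancel₀ (by positivity) (Real.exp_injective f3)
  have hσ : A.σ = B.σ := by
    change A.σ * Real.exp (A.γ / gA * x) = B.σ * Real.exp (B.γ / gB * x) at f1
    rw [f4] at f1
    exact mul_right_cancel₀ (Real.exp_ne_zero _) f1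
  have b0 : A.baseMap (t, x, y) = B.baseMap (t, x, y) := congrArg Prod.fst (h hq)
  have m3 : ((t, x, y + r / 2), u) ∈ Ω := hball (mem_ball_total.2
      ⟨⟨by simpa using hr, by simpa using hr, by simpa using hs⟩, by simpa using hr⟩)
  have b1 : A.baseMap (t, x, y + r / 2) = B.baseMap (t, x, y + r / 2) := congrArg Prod.fst (h m3)
  have gA1 : A.γ * (y + r / 2) + A.δ ≠ 0 := hA m3
  have gB1 : B.γ * (y + r / 2) + B.δ ≠ 0 := hB m3
  have hlam : A.lam = B.lam := by
    have := congrArg Prod.fst b0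
    simpa [Params.baseMap] using this
  have hX : (A.α * A.δ - A.β * A.γ) / gA ^ 2 = (B.α * B.δ - B.β * B.γ) / gB ^ 2 := by
    have : (A.α * A.δ - A.β * A.γ) / gA ^ 2 * x = (B.α * B.δ - B.β * B.γ) / gB ^ 2 * x :=
      congrArg (fun z => z.2.1) b0
    exact mul_right_cancel₀ hx this
  have hY0 : (A.α * y + A.β) / gA = (B.α * y + B.β) / gB := congrArg (fun z => z.2.2) b0
  have hY1 : (A.α * (y + r / 2) + A.β) / (A.γ * (y + r / 2) + A.δ) =
    (B.α * (y + r / 2) + B.β) / (B.γ * (y + r / 2) + B.δ) := congrArg (fun z => z.2.2) b1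
  rw [div_eq_div_iff (pow_ne_zero 2 gA0) (pow_ne_zero 2 gB0)] at hX
  have pA : 0 < gA ^ 2 := by positivity
  have pB : 0 < gB ^ 2 := by positivity
  -- Both determinants are ±1 and the squares are positive, so the determinants agree and the
  -- denominators differ only by a sign ε, which then propagates to all four entries.
  have hsq : gA ^ 2 = gB ^ 2 := by
    rcases A.det_eq with h1 | h1 <;> rcases B.det_eq with h2 | h2 <;> rw [h1, h2] at hX <;> linarith
  have hg : ∃ ε : ℝ, (ε = 1 ∨ ε = -1) ∧ gA = ε * gB := by
    rcases sq_eq_sq_iff_eq_or_eq_neg.1 hsq with h1 | h1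
    · exact ⟨1, Or.inl rfl, by rw [h1]; ring⟩
    · exact ⟨-1, Or.inr rfl, by rw [h1]; ring⟩
  obtain ⟨ε, hε, hg⟩ := hg
  have ε0 : ε ≠ 0 := by rcases hε with rfl | rfl <;> norm_num
  have hγ : A.γ = ε * B.γ := by
    rw [div_eq_div_iff gA0 gB0, hg] at f4
    apply mul_right_cancel₀ gB0
    linear_combination f4
  have hδ : A.δ = ε * B.δ := by
    rw [hgA, hgB, hγ] at hg
    linear_combination hg
  have e0 : A.α * y + A.β = ε * (B.α * y + B.β) := by
    rw [div_eq_div_iff gA0 gB0, hg] at hY0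
    apply mul_right_cancel₀ gB0
    linear_combination hY0
  have e1 : A.α * (y + r / 2) + A.β = ε * (B.α * (y + r / 2) + B.β) := by
    rw [div_eq_div_iff gA1 gB1, hγ, hδ] at hY1
    apply mul_right_cancel₀ gB1
    linear_combination hY1
  have hα : A.α = ε * B.α := by
    have hr2 : r / 2 ≠ 0 := by positivity
    apply mul_right_cancel₀ hr2
    linear_combination e1 - e0
  have hβ : A.β = ε * B.β := by
    rw [hα] at e0
    linear_combination e0
  refine ⟨hlam, hσ, ?_⟩
  rcases hε with rfl | rfl
  · left; simp [hα, hβ, hγ, hδ]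
  · right; simp [hα, hβ, hγ, hδ]

theorem eqOn_map_iff {A B : Params} {f g : Base → ℝ} {Ω : Set Total} (hΩ : IsOpen Ω)
    (hne : Ω.Nonempty) (hA : Ω ⊆ A.regular) (hB : Ω ⊆ B.regular) :
    Set.EqOn (A.map f) (B.map g) Ω ↔ A.SameUpToSign B ∧ Set.EqOn f g (Prod.fst '' Ω) := by
  constructor
  · intro h
    have hs := sameUpToSign_of_eqOn hΩ hne hA hB h
    refine ⟨hs, ?_⟩
    rintro _ ⟨⟨z, u⟩, hq, rfl⟩
    have h1 := congrArg Prod.snd (h hq)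
    rw [Params.map_apply, Params.map_apply, hs.factor_eq] at h1
    exact add_left_cancel (mul_left_cancel₀ (B.factor_ne_zero z) h1)
  · rintro ⟨hs, hfg⟩ ⟨z, u⟩ hq
    rw [hs.map_eq, Params.map_apply, Params.map_apply, hfg ⟨_, hq, rfl⟩]

/-! ### Global form on connected domains. -/

/-- On a connected domain, the constants can be taken the same at all points. -/
theorem IsPointSymmetry.exists_params {Φ : OpenPartialHomeomorph Total Total}
    (hΦ : IsPointSymmetry Φ) (hc : IsPreconnected Φ.source) :
    ∃ A : Params, ∀ p ∈ Φ.source, ∃ Ω : Set Total, IsOpen Ω ∧ p ∈ Ω ∧ Ω ⊆ Φ.source ∧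
      ∃ f : Base → ℝ, HasFormOn Φ A f Ω := by
  rcases Φ.source.eq_empty_or_nonempty with he | ⟨p₀, hp₀⟩
  · exact ⟨Params.id, fun p hp => by simp [he] at hp⟩
  obtain ⟨Ω₀, hΩ₀, hpΩ₀, hs₀, A, f₀, hA₀⟩ := hΦ.exists_hasFormOn hp₀
  refine ⟨A, ?_⟩
  -- S consists of the points near which the constants `A` serve, S' of those near which essentially
  -- different ones do. Both are open, they cover the domain, and by uniqueness they are disjoint.
  set S : Set Total := {p | ∃ Ω : Set Total, IsOpen Ω ∧ p ∈ Ω ∧ Ω ⊆ Φ.source ∧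
      ∃ f : Base → ℝ, HasFormOn Φ A f Ω} with hS
  set S' : Set Total := {p | ∃ Ω : Set Total, IsOpen Ω ∧ p ∈ Ω ∧ Ω ⊆ Φ.source ∧
      ∃ (B : Params) (f : Base → ℝ), HasFormOn Φ B f Ω ∧ ¬ A.SameUpToSign B} with hS'
  have hSo : IsOpen S := isOpen_iff_mem_nhds.2 fun p ⟨Ω, h1, h2, h3⟩ =>
    mem_of_superset (h1.mem_nhds h2) fun q hq => ⟨Ω, h1, hq, h3⟩
  have hSo' : IsOpen S' := isOpen_iff_mem_nhds.2 fun p ⟨Ω, h1, h2, h3⟩ =>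
    mem_of_superset (h1.mem_nhds h2) fun q hq => ⟨Ω, h1, hq, h3⟩
  have hcover : Φ.source ⊆ S ∪ S' := fun p hp => by
    obtain ⟨Ω, h1, h2, h3, B, f, h4⟩ := hΦ.exists_hasFormOn hp
    by_cases hAB : A.SameUpToSign B
    · exact Or.inl ⟨Ω, h1, h2, h3, f, h4.congr hAB⟩
    · exact Or.inr ⟨Ω, h1, h2, h3, B, f, h4, hAB⟩
  have hdisj : ¬ (Φ.source ∩ (S ∩ S')).Nonempty := by
    rintro ⟨p, -, ⟨Ω, h1, h2, -, f, h4⟩, ⟨Ω', h1', h2', -, B, g, h4', hAB⟩⟩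
    refine hAB (sameUpToSign_of_eqOn (f := f) (g := g) (h1.inter h1') ⟨p, h2, h2'⟩
      (fun q hq => h4.2.1 hq.1) (fun q hq => h4'.2.1 hq.2) fun q hq => ?_)
    rw [← h4.2.2 hq.1, h4'.2.2 hq.2]
  intro p hp
  by_contra hpS
  exact hdisj (hc S S' hSo hSo' hcover ⟨p₀, hp₀, Ω₀, hΩ₀, hpΩ₀, hs₀, f₀, hA₀⟩
    ⟨p, hp, (hcover hp).resolve_left hpS⟩)

/-- On a connected domain with connected vertical fibres, the form is global. -/
theorem IsPointSymmetry.exists_hasFormOn_source {Φ : OpenPartialHomeomorph Total Total}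
    (hΦ : IsPointSymmetry Φ) (hc : IsPreconnected Φ.source)
    (hfib : ∀ z : Base, IsPreconnected {u : ℝ | (z, u) ∈ Φ.source}) :
    ∃ (A : Params) (f : Base → ℝ), HasFormOn Φ A f Φ.source := by
  classical
  obtain ⟨A, hA⟩ := hΦ.exists_params hc
  -- The value that f is forced to take. By the local form it is locally constant along vertical
  -- lines, hence constant on each connected fibre.
  set F : Total → ℝ := fun q => (Φ q).2 / A.factor q.1 - q.2 with hF
  have hFf : ∀ {Ω : Set Total} {f : Base → ℝ}, HasFormOn Φ A f Ω → ∀ q ∈ Ω, F q = f q.1 := by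
    rintro Ω f h ⟨z, u⟩ hq
    simp only [hF]
    rw [h.2.2 hq, Params.map_apply]
    have := A.factor_ne_zero z
    field_simp
    ring
  have hFc : ∀ z u u', (z, u) ∈ Φ.source → (z, u') ∈ Φ.source → F (z, u) = F (z, u') := by
    intro z u u' hu hu'
    have hloc : ∀ v, (z, v) ∈ Φ.source →
        ∀ᶠ w in 𝓝 v, (z, w) ∈ Φ.source ∧ F (z, w) = F (z, v) := by
      intro v hv
      obtain ⟨Ω, h1, h2, h3, g, hg⟩ := hA _ hv
      have hcont : ContinuousAt (fun w : ℝ => (z, w)) v := by fun_prop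
      filter_upwards [hcont.preimage_mem_nhds (h1.mem_nhds h2)] with w hw
      exact ⟨h3 hw, by rw [hFf hg _ hw, hFf hg _ h2]⟩
    by_contra hne
    obtain ⟨w, -, hw, hw'⟩ := hfib z {v | (z, v) ∈ Φ.source ∧ F (z, v) = F (z, u)}
      {v | (z, v) ∈ Φ.source ∧ F (z, v) ≠ F (z, u)}
      (isOpen_iff_mem_nhds.2 fun v hv => (hloc v hv.1).mono fun w hw => ⟨hw.1, hw.2.trans hv.2⟩)
      (isOpen_iff_mem_nhds.2 fun v hv => (hloc v hv.1).mono fun w hw =>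
        ⟨hw.1, fun h => hv.2 (hw.2.symm.trans h)⟩)
      (fun v hv => (em (F (z, v) = F (z, u))).imp (fun h => ⟨hv, h⟩) fun h => ⟨hv, h⟩)
      ⟨u, hu, hu, rfl⟩ ⟨u', hu', hu', fun h => hne h.symm⟩
    exact hw'.2 hw.2
  -- The choice of u is immaterial by `hFc`, and so is the value 0 outside the projection of the
  -- domain.
  set f : Base → ℝ := fun z => if h : ∃ u, (z, u) ∈ Φ.source then F (z, h.choose) else 0 with hf
  have hfF : ∀ q ∈ Φ.source, f q.1 = F q := by
    rintro ⟨z, u⟩ hq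
    have h : ∃ u, (z, u) ∈ Φ.source := ⟨u, hq⟩
    simp only [hf, dif_pos h]
    exact hFc _ _ _ h.choose_spec hq
  have hfg : ∀ p ∈ Φ.source, ∃ (Ω : Set Total) (g : Base → ℝ), p ∈ Ω ∧ HasFormOn Φ A g Ω ∧
      Set.EqOn f g (Prod.fst '' Ω) := by
    intro p hp
    obtain ⟨Ω, h1, h2, h3, g, hg⟩ := hA p hp
    refine ⟨Ω, g, h2, hg, ?_⟩
    rintro _ ⟨q, hq, rfl⟩
    rw [hfF q (h3 hq), hFf hg q hq]
  refine ⟨A, f, ⟨isOpenMap_fst _ Φ.open_source, ?_, ?_⟩, fun p hp => ?_, fun p hp => ?_⟩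
  · rintro _ ⟨p, hp, rfl⟩
    obtain ⟨Ω, g, h2, hg, he⟩ := hfg p hp
    have hm : Prod.fst '' Ω ∈ 𝓝 p.1 := hg.1.isOpen.mem_nhds ⟨p, h2, rfl⟩
    exact ((hg.1.contDiffAt ⟨p, h2, rfl⟩).congr_of_eventuallyEq
      (he.eventuallyEq_of_mem hm)).contDiffWithinAt
  · rintro t x y ⟨p, hp, hpe⟩
    obtain ⟨Ω, g, h2, hg, he⟩ := hfg p hp
    have hm : Prod.fst '' Ω ∈ 𝓝 (t, x, y) := hg.1.isOpen.mem_nhds ⟨p, h2, hpe⟩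
    exact (EquationAt.congr (he.eventuallyEq_of_mem hm)).2 (hg.1.equation t x y ⟨p, h2, hpe⟩)
  · obtain ⟨Ω, g, h2, hg, -⟩ := hfg p hp
    exact hg.2.1 h2
  · obtain ⟨Ω, g, h2, hg, he⟩ := hfg p hp
    rw [hg.2.2 h2, show p = (p.1, p.2) from rfl, Params.map_apply, Params.map_apply,
      he ⟨p, h2, rfl⟩]

end FineKolmogorov

open FineKolmogorov in
/-- The point symmetries form a pseudogroup, and they are exactly the transformations of the given
form. Point transformations are local, so "of the given form" is read in a neighbourhood of each
point of the domain; on a connected domain the constants are the same everywhere, and if moreover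
each vertical line meets the domain in an interval, then one single-valued function `f` serves for
the entire domain. -/
theorem theorem1 :
    -- the point symmetries constitute a pseudogroup
    (∃ G : StructureGroupoid Total, ClosedUnderRestriction G ∧
      ∀ Φ : OpenPartialHomeomorph Total Total, Φ ∈ G ↔ IsPointSymmetry Φ) ∧
    -- the point symmetries are exactly the transformations that locally have the form
    (∀ Φ : OpenPartialHomeomorph Total Total,
      IsPointSymmetry Φ ↔
        ∀ p ∈ Φ.source, ∃ Ω : Set Total, IsOpen Ω ∧ p ∈ Ω ∧ Ω ⊆ Φ.source ∧
          ∃ (A : Params) (f : Base → ℝ), HasFormOn Φ A f Ω) ∧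
    -- on a connected domain, the constants are the same at all points
    (∀ Φ : OpenPartialHomeomorph Total Total, IsPreconnected Φ.source →
      (IsPointSymmetry Φ ↔
        ∃ A : Params, ∀ p ∈ Φ.source, ∃ Ω : Set Total, IsOpen Ω ∧ p ∈ Ω ∧ Ω ⊆ Φ.source ∧
          ∃ f : Base → ℝ, HasFormOn Φ A f Ω)) ∧
    -- if moreover the vertical fibres are connected, the form is global
    (∀ Φ : OpenPartialHomeomorph Total Total, IsPreconnected Φ.source →
      (∀ z : Base, IsPreconnected {u : ℝ | (z, u) ∈ Φ.source}) →
      (IsPointSymmetry Φ ↔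
        ∃ (A : Params) (f : Base → ℝ), HasFormOn Φ A f Φ.source)) ∧
    -- all constants and all solutions `f` occur, on the natural maximal domain
    (∀ (A : Params) (f : Base → ℝ) (D : Set Base), IsSolutionOn f D →
      ∃ Φ : OpenPartialHomeomorph Total Total, IsPointSymmetry Φ ∧
        Φ.source = (Prod.fst ⁻¹' D) ∩ A.regular ∧ Set.EqOn Φ (A.map f) Φ.source) ∧
    -- the parameters are defined exactly up to the common sign of `α`, `β`, `γ`, `δ`
    (∀ (A B : Params) (f g : Base → ℝ) (Ω : Set Total), IsOpen Ω → Ω.Nonempty →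
      Ω ⊆ A.regular → Ω ⊆ B.regular →
      (Set.EqOn (A.map f) (B.map g) Ω ↔
        A.SameUpToSign B ∧ Set.EqOn f g (Prod.fst '' Ω))) := by
  refine ⟨⟨symmetryGroupoid, ⟨fun h s _ => IsPointSymmetry.restr h s⟩, fun Φ => Iff.rfl⟩,
    fun Φ => isPointSymmetry_iff, fun Φ hc => ⟨fun h => h.exists_params hc, ?_⟩,
    fun Φ hc hfib => ⟨fun h => h.exists_hasFormOn_source hc hfib, ?_⟩, fun A f D hf => ?_,
    fun A B f g Ω h1 h2 h3 h4 => eqOn_map_iff h1 h2 h3 h4⟩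
  · rintro ⟨A, h⟩
    refine isPointSymmetry_of_hasFormOn fun p hp => ?_
    obtain ⟨Ω, h1, h2, h3, f, hf⟩ := h p hp
    exact ⟨Ω, h1, h2, h3, A, f, hf⟩
  · rintro ⟨A, f, h⟩
    exact isPointSymmetry_of_hasFormOn fun p hp =>
      ⟨Φ.source, Φ.open_source, hp, subset_rfl, A, f, h⟩
  · refine ⟨A.toHomeomorph f hf.isOpen hf.smooth, isPointSymmetry_of_hasFormOn fun p hp =>
      ⟨_, OpenPartialHomeomorph.open_source _, hp, subset_rfl, A, f, hf.mono ?_ ?_,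
        fun q hq => hq.2, fun _ _ => rfl⟩, rfl, fun _ _ => rfl⟩
    · rintro _ ⟨q, hq, rfl⟩
      exact hq.1
    · exact isOpenMap_fst _ (OpenPartialHomeomorph.open_source _)
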